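/- Consider three-dimensional (pseudo)Euclidean space with coordinates $(t,x^1,x^2)$ and metric $\mathrm{diag}(\eta,g_{11},g_{22})$, $\eta,g_{11},g_{22}\in\{1,-1\}$. Unparametrized curves are written as graphs $t\mapsto(t,x(t))$, and $t,x^i,v^i,v'^i,v''^i$ ($i=1,2$) are the corresponding coordinates on third-order one-dimensional contact elements; an equation $E_i(t,x,v,v',v'')=0$ in these coordinates is parameter-indifferent. For spatial vectors put $a\cdot b=\sum_i g_{ii}a^ib^i$, $a_i=g_{ii}a^i$, $(\ast w)_i=\varepsilon_{ji}w^j$ with $\varepsilon_{12}=1$, $\ast(a\wedge b)=a^1b^2-a^2b^1$, $\|a\wedge b\|^2=(a\cdot a)(b\cdot b)-(a\cdot b)^2$, and $N=1+\eta\,v\cdot v$. Let $\Omega$ be a non-empty connected open set of first-order contact elements $(t,x,v)$ on which $N>0$ (for instance the set of all of them). A smooth $E=(E_1,E_2)$, defined for $(t,x,v)\in\Omega$ and all $v',v''$, is called * third-order, if some $\partial E_i/\partial v''^j$ is not identically zero; * variational, if around every jet over $\Omega$ there is a smooth local Lagrange function $L(t,x,v,\dots,v_{k-1})$, of some finite order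 $k$, with $E_i=\sum_{s=0}^{k}(-1)^s\frac{d^s}{dt^s}\frac{\partial L}{\partial v^i_{s-1}}$ (where $v_{-1}=x$, $v_0=v$, $v_1=v'$) along every smooth curve; * (pseudo)Euclidean invariant, if, with $A_{ij}=\partial E_i/\partial v''^j$ and $K_i=E_i|_{v''=0}$ (a variational $E$ is $E_i=A_{ij}v''^j+K_i$ with $A,K$ not depending on $v''$), the forms $\epsilon_i=A_{ij}\,dv'^j+K_i\,dt$ on second-order contact elements over $\Omega$ satisfy: for every infinitesimal (pseudo)Euclidean transformation $X$ (translations and (pseudo)rotations, prolonged to $(t,x,v,v')$) there are matrix functions $\Phi,\Xi,\Psi$ such that the Lie derivative is $X(\epsilon)=\Phi\,\epsilon+\Xi\,(dx-v\,dt)+\Psi\,(dv-v'\,dt)$. (1) A smooth $E$ is third-order, variational and (pseudo)Euclidean invariant if and only if there are constants $c\neq0$ and $\mu$ such that on its whole domain $E=c\,\mathcal E^{(\mu)}$, where $$\mathcal E^{(\mu)}=-\frac{\ast v''}{N^{3/2}}+3\,\frac{\ast v'}{N^{5/2}}\,\eta\,(v\cdot v')+\frac{\mu}{N^{3/2}}\bigl(N\,v'-\eta\,(v'\cdot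 v)\,v\bigr)$$ (in the last bracket, the vectors are taken with lowered index). Thus every such equation is $\mathcal E^{(\mu)}=0$ with one arbitrary constant $\mu$. For $\eta=1$ one has $N=1+v\cdot v$. (2) For $j=1,2$ and every $\mu$, the second-order Lagrange function (no summation over $j$) $$L_{(j)}=\frac{\ast(v'\wedge e_{(j)})}{N^{1/2}\bigl(1+\eta\,g_{jj}\|v\wedge e_{(j)}\|^2\bigr)}\,v^j-\eta\,\mu\,N^{1/2}$$ has $\mathcal E^{(\mu)}$ as its Euler–Poisson expression over the part of $\Omega$ where its denominator does not vanish. (3) Where both denominators are non-zero, $L_{(2)}-L_{(1)}=\frac{d}{dt}F(z)$ along every smooth curve, with $z=v^1v^2/\sqrt N$, where $F(z)=\arctan z$ if $g_{11}g_{22}=1$, and $F(z)=\tfrac12\ln\left|\frac{1+z}{1-z}\right|$ if $g_{11}g_{22}=-1$. -/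

import Mathlib

open scoped ContDiff

noncomputable section

namespace MatsyukThird

/-- The chart `J^k(ℝ, ℝ²)` of the space `C^k(M, 1)` of `k`-th order one-dimensional contact elements
of a three-dimensional space `M` with coordinates `(t, x^1, x^2)`.  A point is `(t, (x, v, v', …))`;
the spatial indices `1, 2` are the elements `0, 1` of `Fin 2`. An equation written on contact
elements refers to unparametrized curves: it is parameter-indifferent. -/
abbrev Jet (k : ℕ) : Type := ℝ × (Fin (k + 1) → Fin 2 → ℝ)

/-- The `k`-jet at `t` of the graph `t ↦ (t, γ t)`. -/
def jet (k : ℕ) (γ : ℝ → Fin 2 → ℝ) (t : ℝ) : Jet k :=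
  (t, fun s => iteratedDeriv s γ t)

/-- The projection to first-order contact elements, `(t, x, v, …) ↦ (t, x, v)`. -/
def toOne {k : ℕ} (p : Jet (k + 1)) : Jet 1 := (p.1, ![p.2 0, p.2 1])

/-- The coordinate direction `∂ / ∂ v_{s-1}^i` of `J^k` (with `v_{-1} = x`). -/
def dir (k : ℕ) (s : Fin (k + 1)) (i : Fin 2) : Jet k := (0, Pi.single s (Pi.single i 1))

/-- The coordinate differential `d v_{s-1}^i` on `J^k` (with `v_{-1} = x`). -/
def dCoord (k : ℕ) (s : Fin (k + 1)) (i : Fin 2) : Jet k →L[ℝ] ℝ :=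
  ((ContinuousLinearMap.proj (R := ℝ) (φ := fun _ : Fin 2 => ℝ) i).comp
    (ContinuousLinearMap.proj (R := ℝ) (φ := fun _ : Fin (k + 1) => Fin 2 → ℝ) s)).comp
    (ContinuousLinearMap.snd ℝ ℝ (Fin (k + 1) → Fin 2 → ℝ))

/-- The differential `dt` on `J^k`. -/
def dTime (k : ℕ) : Jet k →L[ℝ] ℝ :=
  ContinuousLinearMap.fst ℝ ℝ (Fin (k + 1) → Fin 2 → ℝ)

/-! ### Variational equations -/

/-- The Euler–Poisson expression `∑ₛ (-1)ˢ (d/dt)ˢ (∂L/∂v_{s-1}^i)` of a Lagrange function of order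
`k`, evaluated along the curve `γ` at time `t`. -/
def eulerPoisson (k : ℕ) (L : Jet k → ℝ) (γ : ℝ → Fin 2 → ℝ) (i : Fin 2) (t : ℝ) : ℝ :=
  ∑ s : Fin (k + 1), (-1 : ℝ) ^ (s : ℕ) *
    iteratedDeriv s (fun τ => fderiv ℝ L (jet k γ τ) (dir k s i)) t

/-- `L`, smooth on the open set `W ⊆ J^k`, is a Lagrange function of the third-order expression `E`
(which is considered over the set `Ω` of first-order contact elements). -/
def IsLagrangianOn (Ω : Set (Jet 1)) (k : ℕ) (L : Jet k → ℝ) (W : Set (Jet k))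
    (E : Jet 3 → Fin 2 → ℝ) : Prop :=
  IsOpen W ∧ ContDiffOn ℝ ∞ L W ∧
    ∀ γ : ℝ → Fin 2 → ℝ, ContDiff ℝ ∞ γ → ∀ t : ℝ, jet k γ t ∈ W → jet 1 γ t ∈ Ω →
      ∀ i, E (jet 3 γ t) i = eulerPoisson k L γ i t

/-- `E` is variational over `Ω`: around every jet over `Ω` there is a local Lagrange function, of
some finite order, whose Euler–Poisson expression is `E`. -/
def IsVariational (Ω : Set (Jet 1)) (E : Jet 3 → Fin 2 → ℝ) : Prop :=
  ∀ γ : ℝ → Fin 2 → ℝ, ContDiff ℝ ∞ γ → ∀ t : ℝ, jet 1 γ t ∈ Ω →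
    ∃ (k : ℕ) (L : Jet k → ℝ) (W : Set (Jet k)), jet k γ t ∈ W ∧ IsLagrangianOn Ω k L W E

/-- The matrix `A_{ij} = ∂E_i/∂v''^j`. -/
def leading (E : Jet 3 → Fin 2 → ℝ) (q : Jet 3) (i j : Fin 2) : ℝ :=
  fderiv ℝ (fun r => E r i) q (dir 3 3 j)

/-- `E` is genuinely of the third order over `Ω`: it depends on `v''`. -/
def IsThirdOrder (Ω : Set (Jet 1)) (E : Jet 3 → Fin 2 → ℝ) : Prop :=
  ∃ q : Jet 3, toOne q ∈ Ω ∧ ∃ i j, leading E q i j ≠ 0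

/-! ### The (pseudo)Euclidean metric `diag(η, g 0, g 1)` and its symmetries -/

/-- The scalar product `a · b` of spatial vectors. -/
def dot (g : Fin 2 → ℝ) (a b : Fin 2 → ℝ) : ℝ := ∑ i, g i * a i * b i

/-- The quantity `1 + η v · v`; up to the factor `η`, it is the square of the vector `(1, v)`. -/
def speedSq (η : ℝ) (g : Fin 2 → ℝ) (v : Fin 2 → ℝ) : ℝ := 1 + η * dot g v v

/-- The rotation generator `ρ (x_1 ∂_2 - x_2 ∂_1)` of the spatial plane, where `x_i = g_{ii} x^i`. -/
def rot (g : Fin 2 → ℝ) (ρ : ℝ) (x : Fin 2 → ℝ) : Fin 2 → ℝ :=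
  ![-(ρ * g 1 * x 1), ρ * g 0 * x 0]

/-- The general infinitesimal (pseudo)Euclidean transformation, prolonged to `J²`:
translations `(a₀, a)`, the `t`-`x` (pseudo)rotations `π` and the rotation `ρ`. -/
def generator (η : ℝ) (g : Fin 2 → ℝ) (a₀ : ℝ) (a π : Fin 2 → ℝ) (ρ : ℝ) (p : Jet 2) : Jet 2 :=
  (a₀ - dot g π (p.2 0),
    ![a + (η * p.1) • π + rot g ρ (p.2 0),
      η • π + dot g π (p.2 1) • p.2 1 + rot g ρ (p.2 1),
      (2 * dot g π (p.2 1)) • p.2 2 + dot g π (p.2 2) • p.2 1 + rot g ρ (p.2 2)])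

/-- The Lie derivative of a differential one-form along a vector field, on a normed space. -/
def lieDeriv {V : Type*} [NormedAddCommGroup V] [NormedSpace ℝ V] (X : V → V) (α : V → V →L[ℝ] ℝ)
    (p : V) : V →L[ℝ] ℝ :=
  fderiv ℝ α p (X p) + (α p).comp (fderiv ℝ X p)

/-- The point of `J³` over `p ∈ J²` with `v'' = 0`. -/
def zeroLift (p : Jet 2) : Jet 3 := (p.1, ![p.2 0, p.2 1, p.2 2, 0])

/-- The one-forms `ε_i = A_{ij} dv'^j + K_i dt` on `J²` of an expression `E_i = A_{ij} v''^j + K_i`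
that is affine in `v''` (every third-order Euler–Poisson expression is). -/
def pfaff (E : Jet 3 → Fin 2 → ℝ) (i : Fin 2) (p : Jet 2) : Jet 2 →L[ℝ] ℝ :=
  ∑ j, leading E (zeroLift p) i j • dCoord 2 2 j + E (zeroLift p) i • dTime 2

/-- The contact forms `dx^j - v^j dt`. -/
def theta₁ (j : Fin 2) (p : Jet 2) : Jet 2 →L[ℝ] ℝ := dCoord 2 0 j - p.2 1 j • dTime 2

/-- The contact forms `dv^j - v'^j dt`. -/
def theta₂ (j : Fin 2) (p : Jet 2) : Jet 2 →L[ℝ] ℝ := dCoord 2 1 j - p.2 2 j • dTime 2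

/-- The equation `E = 0` is invariant, over `Ω`, under the (pseudo)Euclidean transformations of the
metric `diag(η, g 0, g 1)`: the exterior differential system generated by the Pfaff forms `ε_i` and
the contact forms is preserved by every infinitesimal transformation `X`, that is,
`X(ε) = Φ ε + Ξ (dx - v dt) + Ψ (dv - v' dt)` with some matrix functions `Φ`, `Ξ`, `Ψ`. -/
def IsInvariant (η : ℝ) (g : Fin 2 → ℝ) (Ω : Set (Jet 1)) (E : Jet 3 → Fin 2 → ℝ) : Prop :=
  ∀ (a₀ : ℝ) (a π : Fin 2 → ℝ) (ρ : ℝ), ∃ Φ Ξ Ψ : Jet 2 → Matrix (Fin 2) (Fin 2) ℝ,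
    ∀ p : Jet 2, toOne p ∈ Ω → ∀ i,
      lieDeriv (generator η g a₀ a π ρ) (pfaff E i) p =
        ∑ j, (Φ p i j • pfaff E j p + Ξ p i j • theta₁ j p + Ψ p i j • theta₂ j p)

/-! ### The equation and its Lagrange functions -/

/-- The star operator on spatial vectors, `(∗w)_i = ε_{ji} w^j` with `ε_{12} = 1`. -/
def star (w : Fin 2 → ℝ) : Fin 2 → ℝ := ![-(w 1), w 0]

/-- The star operator on bivectors, `∗(a ∧ b)`, with `∗(e_1 ∧ e_2) = 1`. -/
def starWedge (a b : Fin 2 → ℝ) : ℝ := a 0 * b 1 - a 1 * b 0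

/-- The square `‖a ∧ b‖²` in the spatial metric. -/
def wedgeSq (g : Fin 2 → ℝ) (a b : Fin 2 → ℝ) : ℝ := dot g a a * dot g b b - dot g a b ^ 2

/-- Lowering an index, `a_i = g_{ij} a^j`. -/
def lower (g : Fin 2 → ℝ) (a : Fin 2 → ℝ) : Fin 2 → ℝ := fun i => g i * a i

/-- The left-hand side
`-∗v''/N^{3/2} + 3 (∗v'/N^{5/2}) η v·v' + (μ/N^{3/2}) (N v' - η (v'·v) v)`, where `N = 1 + η v·v`. -/
def standardExpr (η : ℝ) (g : Fin 2 → ℝ) (μ : ℝ) (q : Jet 3) : Fin 2 → ℝ :=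
  let v := q.2 1
  let v' := q.2 2
  let v'' := q.2 3
  let N := speedSq η g v
  (-(1 / N ^ (3 / 2 : ℝ))) • star v''
    + (3 * (η * dot g v v') / N ^ (5 / 2 : ℝ)) • star v'
    + (μ / N ^ (3 / 2 : ℝ)) • (N • lower g v' - (η * dot g v' v) • lower g v)

/-- The quantity `1 + η g_{jj} ‖v ∧ e_j‖²`. -/
def lagDenom (η : ℝ) (g : Fin 2 → ℝ) (j : Fin 2) (v : Fin 2 → ℝ) : ℝ :=
  1 + η * g j * wedgeSq g v (Pi.single j 1)

/-- The Lagrange function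
`L_(j) = ∗(v' ∧ e_j) v^j / (N^{1/2} (1 + η g_{jj} ‖v ∧ e_j‖²)) - η μ N^{1/2}`, `N = 1 + η v·v`. -/
def lagrangian (η : ℝ) (g : Fin 2 → ℝ) (μ : ℝ) (j : Fin 2) (p : Jet 2) : ℝ :=
  let v := p.2 1
  let v' := p.2 2
  starWedge v' (Pi.single j 1) / (Real.sqrt (speedSq η g v) * lagDenom η g j v) * v j
    - η * μ * Real.sqrt (speedSq η g v)

/-- The function `arctan z` (if `g 0 * g 1 = 1`) or `artanh z = (1/2) log |(1 + z) / (1 - z)|`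
(if `g 0 * g 1 = -1`) of `z = v^1 v^2 / √(1 + η v·v)`. -/
def gauge (η : ℝ) (g : Fin 2 → ℝ) (v : Fin 2 → ℝ) : ℝ :=
  let z := v 0 * v 1 / Real.sqrt (speedSq η g v)
  if g 0 * g 1 = 1 then Real.arctan z else 1 / 2 * Real.log |(1 + z) / (1 - z)|

end MatsyukThird

end

/-! Variationality fixes the algebraic shape of `E` in `v'` and `v''`; symmetry then determines the
remaining functions of `(t, x, v)` up to two constants.

Variational shape. The second variation of an action is a symmetric bilinear form on test functions,
so the linearization of `E` along a curve is formally self-adjoint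
(`IsVariational.exists_selfAdjoint`). Comparing coefficients of this third-order operator gives the
Helmholtz conditions (`IsVariational.helmholtz_jet`), of which the lowest is never needed. They
force `E = A J v'' + (∂_v A · v') J v' + B v' + C`, where `J` is `turn` and `A`, `B`, `C` are
functions on `Ω` (`IsVariational.eq_normal_form`), and they give `B₀₁ - B₁₀ = 3 (∂_t + v ∂_x) A`
(`IsVariational.rotor_linearTerm`).

Symmetry. Where `A ≠ 0`, the `dv'` components of the Lie derivative determine `Φ`, and the `dt`
component becomes a polynomial identity in `v'` that splits by degree (`IsInvariant.graded_eq`). A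
rotation generator vanishing at a given contact element turns this into pure algebra
(`IsInvariant.isotropy_eq`): `C = 0`, the symmetric part of `B` is a multiple of the quadratic form
`N g(w, w) - η (v·w)²`, and `A N^{3/2}` is constant along the fibres. Since the generators span
every tangent space, that multiple divided by `A`, and the skew part of `B` divided by `A √N`, have
zero differential (`IsInvariant.fderiv_ratio`). The skew part must vanish, because otherwise the
relation for `B₀₁ - B₁₀` would equate a multiple of `√N` with a function affine in `v`
(`fderiv_eq_zero_of_drift`). Then `A N^{3/2}` is locally constant where `A ≠ 0`; connectedness makes
`A` nowhere zero and leaves the two constants `c` and `μ` (`IsInvariant.exists_eq_standardExpr`).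

Converse. The standard expression is the total derivative of an explicit momentum
(`hasDerivAt_momentum`), and so is the Euler–Poisson expression of a Lagrange function of `v`, `v'`
affine in `v'` (`eulerPoisson_affine`); hence it suffices to compare momenta. The two denominators
`D₀`, `D₁` cannot vanish together when `N > 0`, so local Lagrange functions exist everywhere.
Invariance is an infinitesimal equivariance check (`hasDerivAt_reducedFree`). The difference of the
Lagrange functions rests on `D₀ D₁ = N (1 + g₀ g₁ z²)` (`hasDerivAt_gauge`). -/

noncomputable section

namespace MatsyukThird

open MeasureTheory Filter Topology Set

/-! ### Parameter integrals and integration by parts -/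

/-- Differentiation under the integral sign over a compact interval. -/
theorem hasFDerivAt_intervalIntegral_of_contDiff {V G : Type*} [NormedAddCommGroup V]
    [NormedSpace ℝ V] [FiniteDimensional ℝ V] [NormedAddCommGroup G] [NormedSpace ℝ G]
    [CompleteSpace G] {F : V × ℝ → G} (hF : ContDiff ℝ 1 F) (a b : ℝ) (u : V) :
    HasFDerivAt (fun u => ∫ τ in a..b, F (u, τ))
      (∫ τ in a..b, (fderiv ℝ F (u, τ)).comp (ContinuousLinearMap.inl ℝ V ℝ)) u := by
  have : ProperSpace V := FiniteDimensional.proper ℝ V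
  have hd : Continuous fun p : V × ℝ => (fderiv ℝ F p).comp (ContinuousLinearMap.inl ℝ V ℝ) :=
    (hF.continuous_fderiv one_ne_zero).clm_comp continuous_const
  obtain ⟨C, hC⟩ := ((isCompact_closedBall u 1).prod (isCompact_uIcc (a := a) (b := b))).exists_bound_of_continuousOn
    hd.continuousOn
  refine intervalIntegral.hasFDerivAt_integral_of_dominated_of_fderiv_le
    (F' := fun u τ => (fderiv ℝ F (u, τ)).comp (ContinuousLinearMap.inl ℝ V ℝ))
    (bound := fun _ => C)
    (Metric.closedBall_mem_nhds u one_pos) (Eventually.of_forall fun x => ?_) ?_ ?_ ?_ ?_ ?_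
  · exact (hF.continuous.comp (Continuous.prodMk_right x)).aestronglyMeasurable
  · exact (hF.continuous.comp (Continuous.prodMk_right u)).intervalIntegrable _ _
  · exact (hd.comp (Continuous.prodMk_right u)).aestronglyMeasurable
  · exact Eventually.of_forall fun τ hτ x hx => hC (x, τ) ⟨hx, uIoc_subset_uIcc hτ⟩
  · exact intervalIntegrable_const
  · refine Eventually.of_forall fun τ _ x _ => ?_
    exact ((hF.differentiable one_ne_zero) (x, τ)).hasFDerivAt.comp x (hasFDerivAt_prodMk_left x τ)

theorem contDiff_iteratedDeriv {V : Type*} [NormedAddCommGroup V] [NormedSpace ℝ V] {φ : ℝ → V}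
    (hφ : ContDiff ℝ ∞ φ) (m : ℕ) : ContDiff ℝ ∞ (iteratedDeriv m φ) := by
  induction m with
  | zero => simpa using hφ
  | succ m ih => rw [iteratedDeriv_succ]; exact (contDiff_infty_iff_deriv.1 ih).2

/-- A derivative in the last variable is the full derivative in the direction `(0, 1)`, so joint
smoothness survives each order. This is what makes Euler–Poisson expressions smooth in the parameter
of a family of curves. -/
theorem contDiff_iteratedDeriv_right {V : Type*} [NormedAddCommGroup V]
    [NormedSpace ℝ V] {F : V × ℝ → ℝ} (hF : ContDiff ℝ ∞ F) (m : ℕ) :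
    ContDiff ℝ ∞ fun p : V × ℝ => iteratedDeriv m (fun τ => F (p.1, τ)) p.2 := by
  induction m with
  | zero => simpa using hF
  | succ m ih =>
    simp only [iteratedDeriv_succ]
    have h1 : ContDiff ℝ ∞ fun p : V × ℝ =>
        fderiv ℝ (fun p : V × ℝ => iteratedDeriv m (fun τ => F (p.1, τ)) p.2) p (0, 1) :=
      (ih.fderiv_right (m := ∞) (by simp)).clm_apply contDiff_const
    convert h1 using 2 with p
    have h2 := (ih.differentiable (by simp) (p.1, p.2)).hasFDerivAt.comp_hasDerivAt p.2
      ((hasDerivAt_const p.2 p.1).prodMk (hasDerivAt_id p.2))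
    exact h2.deriv

theorem hasCompactSupport_iteratedDeriv {f : ℝ → ℝ} (hf : HasCompactSupport f) (m : ℕ) :
    HasCompactSupport (iteratedDeriv m f) := by
  induction m with
  | zero => simpa using hf
  | succ m ih => rw [iteratedDeriv_succ]; exact ih.deriv

theorem tsupport_iteratedDeriv_subset {f : ℝ → ℝ} (m : ℕ) :
    tsupport (iteratedDeriv m f) ⊆ tsupport f := by
  induction m with
  | zero => simp
  | succ m ih => rw [iteratedDeriv_succ]; exact (tsupport_deriv_subset).trans ih

/-- Repeated integration by parts against a test function. -/
theorem integral_mul_iteratedDeriv {u f : ℝ → ℝ} (hu : ContDiff ℝ ∞ u) (hf : ContDiff ℝ ∞ f)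
    (hc : HasCompactSupport f) (m : ℕ) :
    ∫ τ, u τ * iteratedDeriv m f τ = (-1) ^ m * ∫ τ, iteratedDeriv m u τ * f τ := by
  induction m generalizing u with
  | zero => simp
  | succ m ih =>
    have hfm : ContDiff ℝ ∞ (iteratedDeriv m f) := contDiff_iteratedDeriv hf m
    have hcm := hasCompactSupport_iteratedDeriv hc m
    have hu' : ContDiff ℝ ∞ (deriv u) := (contDiff_infty_iff_deriv.1 hu).2
    have hfm' : ContDiff ℝ ∞ (deriv (iteratedDeriv m f)) := (contDiff_infty_iff_deriv.1 hfm).2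
    rw [iteratedDeriv_succ, integral_mul_deriv_eq_deriv_mul_of_integrable (u' := deriv u)
      (fun x _ => (hu.differentiable (by simp) x).hasDerivAt)
      (fun x _ => (hfm.differentiable (by simp) x).hasDerivAt), ih hu', iteratedDeriv_succ']
    · ring
    · exact (hu.continuous.mul hfm'.continuous).integrable_of_hasCompactSupport hcm.deriv.mul_left
    · exact (hu'.continuous.mul hfm.continuous).integrable_of_hasCompactSupport hcm.mul_left
    · exact (hu.continuous.mul hfm.continuous).integrable_of_hasCompactSupport hcm.mul_left

/-! ### First and second variation of the action -/

/-- The variation of the jet of a curve in the direction `φ`. -/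
def jetVar (k : ℕ) (φ : ℝ → Fin 2 → ℝ) (t : ℝ) : Jet k :=
  (0, fun s => iteratedDeriv s φ t)

theorem contDiff_jet {γ : ℝ → Fin 2 → ℝ} (hγ : ContDiff ℝ ∞ γ) (k : ℕ) :
    ContDiff ℝ ∞ (jet k γ) :=
  contDiff_id.prodMk (contDiff_pi.2 fun s => contDiff_iteratedDeriv hγ s)

theorem contDiff_jetVar {γ : ℝ → Fin 2 → ℝ} (hγ : ContDiff ℝ ∞ γ) (k : ℕ) :
    ContDiff ℝ ∞ (jetVar k γ) :=
  contDiff_const.prodMk (contDiff_pi.2 fun s => contDiff_iteratedDeriv hγ s)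

theorem jet_add_smul {γ φ : ℝ → Fin 2 → ℝ} (hγ : ContDiff ℝ ∞ γ) (hφ : ContDiff ℝ ∞ φ) (k : ℕ)
    (r t : ℝ) : jet k (γ + r • φ) t = jet k γ t + r • jetVar k φ t := by
  ext s i
  · simp [jet, jetVar]
  · simp only [jet, jetVar, Prod.snd_add, Prod.smul_mk, Pi.add_apply, Pi.smul_apply]
    rw [iteratedDeriv_add (f := γ) (g := r • φ)
      ((hγ.of_le (by exact_mod_cast le_top)).contDiffAt)
      (((hφ.const_smul r).of_le (by exact_mod_cast le_top)).contDiffAt),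
      iteratedDeriv_const_smul_field]
    rfl

theorem iteratedDeriv_apply {φ : ℝ → Fin 2 → ℝ} (hφ : ContDiff ℝ ∞ φ) (m : ℕ) (t : ℝ) (i : Fin 2) :
    iteratedDeriv m φ t i = iteratedDeriv m (fun τ => φ τ i) t := by
  induction m generalizing t with
  | zero => simp
  | succ m ih =>
    rw [iteratedDeriv_succ, iteratedDeriv_succ]
    have := ((contDiff_iteratedDeriv hφ m).differentiable (by simp) t).hasDerivAt
    rw [← ((hasDerivAt_pi.1 this) i).deriv]
    congr 1
    funext τ
    exact ih τ

theorem jetVar_eq_sum {φ : ℝ → Fin 2 → ℝ} (hφ : ContDiff ℝ ∞ φ) (k : ℕ) (t : ℝ) :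
    jetVar k φ t = ∑ s : Fin (k + 1), ∑ i, iteratedDeriv s (fun τ => φ τ i) t • dir k s i := by
  simp only [← iteratedDeriv_apply hφ]
  ext s i
  · simp [jetVar, dir, Prod.fst_sum]
  · simp only [jetVar, dir, Prod.snd_sum, Prod.smul_mk, Finset.sum_apply, Pi.smul_apply,
      smul_eq_mul]
    rw [Finset.sum_eq_single s (fun s' _ h => by simp [Pi.single_eq_of_ne h.symm]) (by simp)]
    simp [Pi.single_apply]

/-- The space of smooth vector-valued test functions on the interval `(a, b)`. -/
structure IsTest (a b : ℝ) (φ : ℝ → Fin 2 → ℝ) : Prop where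
  contDiff : ContDiff ℝ ∞ φ
  hasCompactSupport : ∀ i, HasCompactSupport fun τ => φ τ i
  tsupport_subset : ∀ i, tsupport (fun τ => φ τ i) ⊆ Ioo a b

theorem IsTest.contDiff_apply {a b : ℝ} {φ : ℝ → Fin 2 → ℝ} (h : IsTest a b φ) (i : Fin 2) :
    ContDiff ℝ ∞ fun τ => φ τ i := contDiff_pi.1 h.contDiff i

theorem intervalIntegral_eq_integral_of_tsupport {f g : ℝ → ℝ} {a b : ℝ}
    (hg : tsupport g ⊆ Ioo a b) :
    ∫ τ in a..b, f τ * g τ = ∫ τ, f τ * g τ := by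
  refine intervalIntegral.integral_eq_integral_of_support_subset ?_
  exact (Function.support_mul_subset_right f g).trans
    ((subset_tsupport g).trans (hg.trans Ioo_subset_Ioc_self))

/-- The first variation of the action is the integral of the Euler–Poisson expression. -/
theorem integral_fderiv_jetVar {k : ℕ} {L : Jet k → ℝ} (hL : ContDiff ℝ ∞ L)
    {γ φ : ℝ → Fin 2 → ℝ} (hγ : ContDiff ℝ ∞ γ) {a b : ℝ} (hφ : IsTest a b φ) :
    ∫ τ in a..b, fderiv ℝ L (jet k γ τ) (jetVar k φ τ) =
      ∫ τ in a..b, ∑ i, eulerPoisson k L γ i τ * φ τ i := by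
  have hp (s : Fin (k + 1)) (i : Fin 2) :
      ContDiff ℝ ∞ fun τ => fderiv ℝ L (jet k γ τ) (dir k s i) :=
    ((hL.fderiv_right (m := ∞) (by simp)).comp (contDiff_jet hγ k)).clm_apply contDiff_const
  have hφd (s : Fin (k + 1)) (i : Fin 2) := contDiff_iteratedDeriv (hφ.contDiff_apply i) s
  have hpd (s : Fin (k + 1)) (i : Fin 2) := contDiff_iteratedDeriv (hp s i) s
  simp only [jetVar_eq_sum hφ.contDiff, map_sum, map_smul, smul_eq_mul, eulerPoisson,
    Finset.sum_mul]
  rw [intervalIntegral.integral_finsetSum fun s _ => ?_,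
    intervalIntegral.integral_finsetSum fun i _ => ?_, ]
  · conv_rhs => enter [2, i]; rw [intervalIntegral.integral_finsetSum fun s _ =>
      (((contDiff_const.mul (hpd s i)).mul (hφ.contDiff_apply i)).continuous).intervalIntegrable _ _]
    rw [Finset.sum_comm]
    refine Finset.sum_congr rfl fun s _ => ?_
    rw [intervalIntegral.integral_finsetSum fun i _ =>
      ((hφd s i).mul (hp s i)).continuous.intervalIntegrable _ _]
    refine Finset.sum_congr rfl fun i _ => ?_
    rw [intervalIntegral_eq_integral_of_tsupport (hφ.tsupport_subset i)]
    simp_rw [mul_assoc]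
    rw [integral_const_mul, ← integral_mul_iteratedDeriv (hp s i) (hφ.contDiff_apply i)
      (hφ.hasCompactSupport i), ← intervalIntegral_eq_integral_of_tsupport
      ((tsupport_iteratedDeriv_subset _).trans (hφ.tsupport_subset i))]
    simp_rw [mul_comm]
  · exact (ContDiff.sum fun s _ => (contDiff_const.mul (hpd s i)).mul
      (hφ.contDiff_apply i)).continuous.intervalIntegrable _ _
  · exact (ContDiff.sum fun i _ => (hφd s i).mul (hp s i)).continuous.intervalIntegrable _ _

theorem contDiff_eulerPoisson {k : ℕ} {L : Jet k → ℝ} (hL : ContDiff ℝ ∞ L)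
    {γ ψ : ℝ → Fin 2 → ℝ} (hγ : ContDiff ℝ ∞ γ) (hψ : ContDiff ℝ ∞ ψ) (i : Fin 2) :
    ContDiff ℝ ∞ fun p : ℝ × ℝ => eulerPoisson k L (γ + p.1 • ψ) i p.2 := by
  simp only [eulerPoisson, jet_add_smul hγ hψ]
  refine ContDiff.sum fun s _ => contDiff_const.mul ?_
  refine contDiff_iteratedDeriv_right
    (F := fun p : ℝ × ℝ => fderiv ℝ L (jet k γ p.2 + p.1 • jetVar k ψ p.2) (dir k s i)) ?_ s
  refine ((hL.fderiv_right (m := ∞) (by simp)).comp ?_).clm_apply contDiff_const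
  exact ((contDiff_jet hγ k).comp contDiff_snd).add
    (contDiff_fst.smul ((contDiff_jetVar hψ k).comp contDiff_snd))

/-- Applied to a first variation in the direction `φ`, this expresses the mixed second variation
through the linearized Euler–Poisson expression. -/
theorem hasDerivAt_integral_eulerPoisson {k : ℕ} {L : Jet k → ℝ} (hL : ContDiff ℝ ∞ L)
    {γ φ ψ : ℝ → Fin 2 → ℝ} (hγ : ContDiff ℝ ∞ γ) (hφ : ContDiff ℝ ∞ φ) (hψ : ContDiff ℝ ∞ ψ)
    (a b : ℝ) :
    HasDerivAt (fun r : ℝ => ∫ τ in a..b, ∑ i, eulerPoisson k L (γ + r • ψ) i τ * φ τ i)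
      (∫ τ in a..b, ∑ i, deriv (fun r : ℝ => eulerPoisson k L (γ + r • ψ) i τ) 0 * φ τ i) 0 := by
  have hE (i : Fin 2) := contDiff_eulerPoisson hL hγ hψ i
  have hF : ContDiff ℝ ∞ fun p : ℝ × ℝ => ∑ i, eulerPoisson k L (γ + p.1 • ψ) i p.2 * φ p.2 i :=
    ContDiff.sum fun i _ => (hE i).mul ((contDiff_pi.1 hφ i).comp contDiff_snd)
  have h := (hasFDerivAt_intervalIntegral_of_contDiff (hF.of_le (by simp)) a b 0).hasDerivAt
  rw [ContinuousLinearMap.intervalIntegral_apply] at h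
  · refine h.congr_deriv (intervalIntegral.integral_congr fun τ _ => ?_)
    have h1 : HasDerivAt (fun r : ℝ => ∑ i, eulerPoisson k L (γ + r • ψ) i τ * φ τ i) _ 0 :=
      HasDerivAt.fun_sum fun i _ => (((hE i).comp (contDiff_id.prodMk contDiff_const)).differentiable
        (by simp) 0).hasDerivAt.mul_const (φ τ i)
    have h2 := ((hF.differentiable (by simp) (0, τ)).hasFDerivAt.comp (0 : ℝ)
      (hasFDerivAt_prodMk_left 0 τ)).hasDerivAt
    exact h2.unique h1
  · exact (((hF.continuous_fderiv (by simp)).clm_comp continuous_const).comp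
      (Continuous.prodMk_right (0 : ℝ))).intervalIntegrable _ _

/-- The second variation of the action is symmetric. -/
theorem second_variation_symm {k : ℕ} {L : Jet k → ℝ} (hL : ContDiff ℝ ∞ L)
    {γ φ ψ : ℝ → Fin 2 → ℝ} (hγ : ContDiff ℝ ∞ γ) {a b : ℝ} (hφ : IsTest a b φ)
    (hψ : IsTest a b ψ) :
    ∫ τ in a..b, ∑ i, deriv (fun r : ℝ => eulerPoisson k L (γ + r • ψ) i τ) 0 * φ τ i =
      ∫ τ in a..b, ∑ i, deriv (fun r : ℝ => eulerPoisson k L (γ + r • φ) i τ) 0 * ψ τ i := by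
  -- The jet of the two-parameter family `γ + u₁ φ + u₂ ψ`. The claim is the equality of the mixed
  -- second derivatives at `u = 0` of the action as a function of `u`.
  set H : (ℝ × ℝ) × ℝ → Jet k := fun p =>
    jet k γ p.2 + p.1.1 • jetVar k φ p.2 + p.1.2 • jetVar k ψ p.2 with hH
  have hHs : ContDiff ℝ ∞ H :=
    (((contDiff_jet hγ k).comp contDiff_snd).add
      ((contDiff_fst.comp contDiff_fst).smul ((contDiff_jetVar hφ.contDiff k).comp contDiff_snd))).add
      ((contDiff_snd.comp contDiff_fst).smul ((contDiff_jetVar hψ.contDiff k).comp contDiff_snd))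
  set F' : (ℝ × ℝ) × ℝ → ℝ × ℝ →L[ℝ] ℝ := fun p =>
    (fderiv ℝ (L ∘ H) p).comp (ContinuousLinearMap.inl ℝ (ℝ × ℝ) ℝ) with hF'
  have hF's : ContDiff ℝ ∞ F' :=
    ((hL.comp hHs).fderiv_right (m := ∞) (by simp)).clm_comp contDiff_const
  have hS (u : ℝ × ℝ) := hasFDerivAt_intervalIntegral_of_contDiff
    ((hL.comp hHs).of_le (by simp)) a b u
  have hS' := hasFDerivAt_intervalIntegral_of_contDiff (hF's.of_le (by simp)) a b (0 : ℝ × ℝ)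
  have hsymm := second_derivative_symmetric hS hS' (0, 1) (1, 0)
  have hF'app (p : (ℝ × ℝ) × ℝ) (w : ℝ × ℝ) :
      F' p w = fderiv ℝ L (H p) (w.1 • jetVar k φ p.2 + w.2 • jetVar k ψ p.2) := by
    have h1 := (hL.differentiable (by simp) (H p)).hasFDerivAt.comp p
      (hHs.differentiable (by simp) p).hasFDerivAt
    have h2 : HasDerivAt (fun r : ℝ => H (p + r • (w, (0 : ℝ))))
        (w.1 • jetVar k φ p.2 + w.2 • jetVar k ψ p.2) 0 := by
      have : (fun r : ℝ => H (p + r • (w, (0 : ℝ)))) = fun r =>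
          H p + r • (w.1 • jetVar k φ p.2 + w.2 • jetVar k ψ p.2) := by
        funext r
        simp only [hH, Prod.fst_add, Prod.snd_add, Prod.smul_fst, Prod.smul_snd, smul_eq_mul,
          mul_zero, add_zero]
        module
      rw [this]
      simpa using ((hasDerivAt_id (0 : ℝ)).smul_const
        (w.1 • jetVar k φ p.2 + w.2 • jetVar k ψ p.2)).const_add (H p)
    have h3 := (hHs.differentiable (by simp) p).hasFDerivAt.hasLineDerivAt (w, (0 : ℝ))
    have h4 := h2.unique h3
    simp only [hF', ContinuousLinearMap.comp_apply, ContinuousLinearMap.inl_apply, h1.fderiv]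
    rw [h4]
  have hint (u w : ℝ × ℝ) : (∫ τ in a..b, F' (u, τ)) w = ∫ τ in a..b, F' (u, τ) w :=
    ContinuousLinearMap.intervalIntegral_apply
      ((hF's.continuous.comp (Continuous.prodMk_right u)).intervalIntegrable _ _) w
  have e1 : HasDerivAt (fun r : ℝ => (∫ τ in a..b, F' ((0, r), τ)) (1, 0))
      ((∫ τ in a..b, (fderiv ℝ F' (0, τ)).comp (ContinuousLinearMap.inl ℝ (ℝ × ℝ) ℝ)) (0, 1)
        (1, 0)) 0 := by
    have h := (hS'.hasLineDerivAt (0, 1)).clm_apply (hasDerivAt_const (0 : ℝ) ((1, 0) : ℝ × ℝ))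
    simpa using h
  have e2 : HasDerivAt (fun r : ℝ => (∫ τ in a..b, F' ((r, 0), τ)) (0, 1))
      ((∫ τ in a..b, (fderiv ℝ F' (0, τ)).comp (ContinuousLinearMap.inl ℝ (ℝ × ℝ) ℝ)) (1, 0)
        (0, 1)) 0 := by
    have h := (hS'.hasLineDerivAt (1, 0)).clm_apply (hasDerivAt_const (0 : ℝ) ((0, 1) : ℝ × ℝ))
    simpa using h
  have hγa {χ : ℝ → Fin 2 → ℝ} (hχ : ContDiff ℝ ∞ χ) (r : ℝ) : ContDiff ℝ ∞ (γ + r • χ) :=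
    hγ.add (contDiff_const.smul hχ)
  -- Along either axis of the parameter plane, the derivative in the other parameter is a first
  -- variation at a shifted curve, hence an integral of the Euler–Poisson expression.
  have e3 (r : ℝ) : (∫ τ in a..b, F' ((0, r), τ)) (1, 0) =
      ∫ τ in a..b, ∑ i, eulerPoisson k L (γ + r • ψ) i τ * φ τ i := by
    rw [hint, ← integral_fderiv_jetVar hL (hγa hψ.contDiff r) hφ]
    simp [hF'app, hH, jet_add_smul hγ hψ.contDiff]
  have e4 (r : ℝ) : (∫ τ in a..b, F' ((r, 0), τ)) (0, 1) =
      ∫ τ in a..b, ∑ i, eulerPoisson k L (γ + r • φ) i τ * ψ τ i := by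
    rw [hint, ← integral_fderiv_jetVar hL (hγa hφ.contDiff r) hψ]
    simp [hF'app, hH, jet_add_smul hγ hφ.contDiff]
  simp only [e3] at e1
  simp only [e4] at e2
  rw [← (hasDerivAt_integral_eulerPoisson hL hγ hφ.contDiff hψ.contDiff a b).unique e1] at hsymm
  rw [← (hasDerivAt_integral_eulerPoisson hL hγ hψ.contDiff hφ.contDiff a b).unique e2] at hsymm
  exact hsymm

/-! ### Localization and self-adjointness of the linearization -/

theorem toOne_jet (k : ℕ) (γ : ℝ → Fin 2 → ℝ) (t : ℝ) : toOne (jet (k + 1) γ t) = jet 1 γ t := by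
  ext s i
  · rfl
  · fin_cases s <;> simp [toOne, jet]

theorem contDiff_toOne (k : ℕ) : ContDiff ℝ ∞ (toOne : Jet (k + 1) → Jet 1) := by
  refine contDiff_fst.prodMk (contDiff_pi.2 fun s => ?_)
  have (m : Fin (k + 2)) : ContDiff ℝ ∞ fun p : Jet (k + 1) => p.2 m :=
    (contDiff_apply ℝ (Fin 2 → ℝ) m).comp contDiff_snd
  fin_cases s
  · exact this 0
  · exact this 1

theorem isOpen_over {Ω : Set (Jet 1)} (hΩ : IsOpen Ω) (k : ℕ) :
    IsOpen {q : Jet (k + 1) | toOne q ∈ Ω} :=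
  hΩ.preimage (contDiff_toOne k).continuous

/-- The jets of `γ` at times near `t` stay in `V`, so only the germ of the Lagrange function
matters. This allows a local Lagrange function to be replaced by a global one. -/
theorem eulerPoisson_congr {k : ℕ} {L L' : Jet k → ℝ} {V : Set (Jet k)} (hV : IsOpen V)
    (h : EqOn L L' V) {γ : ℝ → Fin 2 → ℝ} (hγ : ContDiff ℝ ∞ γ) {t : ℝ} (ht : jet k γ t ∈ V)
    (i : Fin 2) : eulerPoisson k L γ i t = eulerPoisson k L' γ i t := by
  refine Finset.sum_congr rfl fun s _ => ?_
  congr 1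
  refine EventuallyEq.iteratedDeriv_eq _ ?_
  filter_upwards [(contDiff_jet hγ k).continuous.continuousAt (hV.mem_nhds ht)] with τ hτ
  rw [(h.eventuallyEq_of_mem (hV.mem_nhds hτ)).fderiv_eq]

/-- A function smooth on a neighbourhood agrees near the point with a globally smooth function. -/
theorem exists_contDiff_eqOn {V : Type*} [NormedAddCommGroup V] [NormedSpace ℝ V]
    [FiniteDimensional ℝ V] {L : V → ℝ} {W : Set V} (hW : IsOpen W) (hL : ContDiffOn ℝ ∞ L W)
    {p : V} (hp : p ∈ W) :
    ∃ (L' : V → ℝ) (U : Set V), ContDiff ℝ ∞ L' ∧ IsOpen U ∧ p ∈ U ∧ U ⊆ W ∧ EqOn L L' U := by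
  obtain ⟨ε, hε, hb⟩ := Metric.isOpen_iff.1 hW p hp
  let f : ContDiffBump p := ⟨ε / 3, ε / 2, by positivity, by linarith⟩
  have hfW : tsupport f ⊆ W := by
    rw [f.tsupport_eq]
    exact (Metric.closedBall_subset_ball (by simp [f]; linarith)).trans hb
  refine ⟨fun x => f x * L x, Metric.ball p (ε / 3), contDiff_iff_contDiffAt.2 fun x => ?_,
    Metric.isOpen_ball, Metric.mem_ball_self (by positivity),
    (Metric.ball_subset_ball (by linarith)).trans hb, fun x hx => ?_⟩
  · by_cases hx : x ∈ W
    · exact f.contDiff.contDiffAt.mul (hL.contDiffAt (hW.mem_nhds hx))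
    · have : (fun x => f x * L x) =ᶠ[𝓝 x] fun _ => 0 := by
        filter_upwards [notMem_tsupport_iff_eventuallyEq.1 fun h => hx (hfW h)] with y hy
        simp [hy]
      exact contDiffAt_const.congr_of_eventuallyEq this
  · simp [f.one_of_mem_closedBall (Metric.ball_subset_closedBall hx)]

/-- The linearization of a variational expression is formally self-adjoint near any point. -/
theorem IsVariational.exists_selfAdjoint {Ω : Set (Jet 1)} (hΩ : IsOpen Ω)
    {E : Jet 3 → Fin 2 → ℝ} (hE : ContDiffOn ℝ ∞ E {q | toOne q ∈ Ω}) (hv : IsVariational Ω E)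
    {γ : ℝ → Fin 2 → ℝ} (hγ : ContDiff ℝ ∞ γ) {t : ℝ} (ht : jet 1 γ t ∈ Ω) :
    ∃ a b : ℝ, t ∈ Ioo a b ∧ (∀ τ ∈ Icc a b, jet 1 γ τ ∈ Ω) ∧
      ∀ φ ψ, IsTest a b φ → IsTest a b ψ →
        ∫ τ in a..b, ∑ i, fderiv ℝ (fun r => E r i) (jet 3 γ τ) (jetVar 3 ψ τ) * φ τ i =
          ∫ τ in a..b, ∑ i, fderiv ℝ (fun r => E r i) (jet 3 γ τ) (jetVar 3 φ τ) * ψ τ i := by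
  obtain ⟨k, L, W, hW, hWo, hLs, hEP⟩ := hv γ hγ t ht
  -- The variation lemmas need a globally smooth Lagrange function. `U` is where the cut-off one
  -- still computes `E`; the interval is then taken short enough for the jets of `γ` to stay in `U`
  -- and over `Ω`.
  obtain ⟨L', U, hL', hU, htU, hUW, hLL'⟩ := exists_contDiff_eqOn hWo hLs hW
  have hnhds : ∀ᶠ τ in 𝓝 t, jet k γ τ ∈ U ∧ jet 1 γ τ ∈ Ω :=
    (((contDiff_jet hγ k).continuous.continuousAt.eventually_mem (hU.mem_nhds htU))).and
      ((contDiff_jet hγ 1).continuous.continuousAt.eventually_mem (hΩ.mem_nhds ht))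
  obtain ⟨ε, hε, hb⟩ := Metric.nhds_basis_closedBall.eventually_iff.1 hnhds
  rw [Real.closedBall_eq_Icc] at hb
  -- At each fixed `τ` the varied jets remain in `U` for small `r`. No uniformity in `τ` is needed,
  -- since only the derivative at `r = 0` enters.
  have key : ∀ ψ, ContDiff ℝ ∞ ψ → ∀ τ ∈ Icc (t - ε) (t + ε), ∀ i,
      deriv (fun r : ℝ => eulerPoisson k L' (γ + r • ψ) i τ) 0 =
        fderiv ℝ (fun r => E r i) (jet 3 γ τ) (jetVar 3 ψ τ) := by
    intro ψ hψ τ hτ i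
    have hl (m : ℕ) : Continuous fun r : ℝ => jet m γ τ + r • jetVar m ψ τ := by fun_prop
    have h1 : ∀ᶠ r : ℝ in 𝓝 0, jet k (γ + r • ψ) τ ∈ U := by
      simp only [jet_add_smul hγ hψ]
      exact (hl k).continuousAt (hU.mem_nhds (by simpa using (hb hτ).1))
    have h2 : ∀ᶠ r : ℝ in 𝓝 0, jet 1 (γ + r • ψ) τ ∈ Ω := by
      simp only [jet_add_smul hγ hψ]
      exact (hl 1).continuousAt (hΩ.mem_nhds (by simpa using (hb hτ).2))
    have h3 : (fun r : ℝ => eulerPoisson k L' (γ + r • ψ) i τ) =ᶠ[𝓝 0]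
        fun r => E (jet 3 γ τ + r • jetVar 3 ψ τ) i := by
      filter_upwards [h1, h2] with r hr1 hr2
      have hs : ContDiff ℝ ∞ (γ + r • ψ) := hγ.add (contDiff_const.smul hψ)
      rw [← jet_add_smul hγ hψ, hEP _ hs _ (hUW hr1) hr2, eulerPoisson_congr hU hLL' hs hr1]
    rw [h3.deriv_eq]
    have hd : DifferentiableAt ℝ (fun r => E r i) (jet 3 γ τ) :=
      ((contDiffOn_pi.1 hE i).contDiffAt ((isOpen_over hΩ 2).mem_nhds
        (by simpa [toOne_jet] using (hb hτ).2))).differentiableAt (by simp)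
    exact (hd.hasFDerivAt.hasLineDerivAt _).deriv
  refine ⟨t - ε, t + ε, by simp [hε], fun τ hτ => (hb hτ).2, fun φ ψ hφ hψ => ?_⟩
  have h : ∀ φ ψ : ℝ → Fin 2 → ℝ, ContDiff ℝ ∞ ψ →
      ∫ τ in (t - ε)..(t + ε), ∑ i, fderiv ℝ (fun r => E r i) (jet 3 γ τ) (jetVar 3 ψ τ) * φ τ i =
        ∫ τ in (t - ε)..(t + ε),
          ∑ i, deriv (fun r : ℝ => eulerPoisson k L' (γ + r • ψ) i τ) 0 * φ τ i := by
    refine fun φ ψ hψ => intervalIntegral.integral_congr fun τ hτ => ?_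
    rw [uIcc_of_le (by linarith)] at hτ
    simp only [key ψ hψ τ hτ]
  rw [h φ ψ hψ.contDiff, h ψ φ hφ.contDiff, second_variation_symm hL' hγ hφ hψ]

/-! ### Formal adjoints and the Helmholtz conditions -/

theorem contDiff_mul_of_tsupport {V : Type*} [NormedAddCommGroup V] [NormedSpace ℝ V]
    {q h : V → ℝ} {U : Set V} (hU : IsOpen U) (hq : ContDiffOn ℝ ∞ q U) (hh : ContDiff ℝ ∞ h)
    (hs : tsupport h ⊆ U) : ContDiff ℝ ∞ fun x => q x * h x := by
  refine contDiff_iff_contDiffAt.2 fun x => ?_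
  by_cases hx : x ∈ U
  · exact (hq.contDiffAt (hU.mem_nhds hx)).mul hh.contDiffAt
  · have : (fun x => q x * h x) =ᶠ[𝓝 x] fun _ => 0 := by
      filter_upwards [notMem_tsupport_iff_eventuallyEq.1 fun h => hx (hs h)] with y hy
      simp [hy]
    exact contDiffAt_const.congr_of_eventuallyEq this

/-- Two ordinary differential operators adjoint to each other on test functions are formally
adjoint. -/
theorem formal_adjoint_of_integral {n : ℕ} {p q : Fin (n + 1) → ℝ → ℝ} {a b : ℝ}
    (hp : ∀ s, ContDiffOn ℝ ∞ (p s) (Ioo a b)) (hq : ∀ s, ContDiffOn ℝ ∞ (q s) (Ioo a b))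
    {h : ℝ → ℝ} (hh : ContDiff ℝ ∞ h) (hs : tsupport h ⊆ Ioo a b)
    (hpq : ∀ f : ℝ → ℝ, ContDiff ℝ ∞ f → HasCompactSupport f → tsupport f ⊆ Ioo a b →
      ∫ τ in a..b, (∑ s, p s τ * iteratedDeriv s h τ) * f τ =
        ∫ τ in a..b, (∑ s, q s τ * iteratedDeriv s f τ) * h τ) {t : ℝ} (ht : t ∈ Ioo a b) :
    ∑ s, p s t * iteratedDeriv s h t =
      ∑ s : Fin (n + 1), (-1) ^ (s : ℕ) * iteratedDeriv s (fun τ => q s τ * h τ) t := by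
  have hP (s : Fin (n + 1)) : ContDiff ℝ ∞ fun τ => p s τ * iteratedDeriv s h τ :=
    contDiff_mul_of_tsupport isOpen_Ioo (hp s) (contDiff_iteratedDeriv hh s)
      ((tsupport_iteratedDeriv_subset _).trans hs)
  have hQ (s : Fin (n + 1)) : ContDiff ℝ ∞ fun τ => q s τ * h τ :=
    contDiff_mul_of_tsupport isOpen_Ioo (hq s) hh hs
  set G : ℝ → ℝ := fun τ => ∑ s, p s τ * iteratedDeriv s h τ -
    ∑ s : Fin (n + 1), (-1) ^ (s : ℕ) * iteratedDeriv s (fun τ => q s τ * h τ) τ with hG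
  have hGs : Continuous G := ((ContDiff.sum fun s _ => hP s).sub (ContDiff.sum fun s _ =>
    contDiff_const.mul (contDiff_iteratedDeriv (hQ s) s))).continuous
  -- The fundamental lemma of the calculus of variations gives vanishing almost everywhere;
  -- continuity of `G` upgrades it below to vanishing at `t`.
  have hG0 : ∀ᵐ τ, τ ∈ Ioo a b → G τ = 0 := by
    refine isOpen_Ioo.ae_eq_zero_of_integral_contDiff_smul_eq_zero
      (hGs.locallyIntegrable.locallyIntegrableOn _) fun f hf hfc hfs => ?_
    have h1 := hpq f hf hfc hfs
    rw [intervalIntegral_eq_integral_of_tsupport hfs, intervalIntegral_eq_integral_of_tsupport hs]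
      at h1
    have h2 : ∫ τ, (∑ s, q s τ * iteratedDeriv s f τ) * h τ =
        ∫ τ, (∑ s : Fin (n + 1), (-1) ^ (s : ℕ) * iteratedDeriv s (fun τ => q s τ * h τ) τ) * f τ := by
      simp only [Finset.sum_mul]
      rw [integral_finsetSum, integral_finsetSum]
      · refine Finset.sum_congr rfl fun s _ => ?_
        simp_rw [mul_assoc, integral_const_mul]
        rw [← integral_mul_iteratedDeriv (hQ s) hf hfc]
        exact integral_congr_ae (Eventually.of_forall fun τ => by ring)
      · exact fun s _ => ((contDiff_const.mul (contDiff_iteratedDeriv (hQ s) s)).mul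
          hf).continuous.integrable_of_hasCompactSupport hfc.mul_left
      · refine fun s _ => ((hQ s).mul (contDiff_iteratedDeriv hf s)).continuous
          |>.integrable_of_hasCompactSupport (hasCompactSupport_iteratedDeriv hfc s).mul_left |>.congr
          (Eventually.of_forall fun τ => by ring)
    simp only [hG, smul_eq_mul, mul_sub]
    rw [integral_sub]
    · simp_rw [mul_comm (f _)]
      rw [h1, h2, sub_self]
    · exact (hf.mul (ContDiff.sum fun s _ => hP s)).continuous.integrable_of_hasCompactSupport
        hfc.mul_right
    · exact (hf.mul (ContDiff.sum fun s _ => contDiff_const.mul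
        (contDiff_iteratedDeriv (hQ s) s))).continuous.integrable_of_hasCompactSupport hfc.mul_right
  have h0 : G t = 0 := by
    by_contra hne
    have hop : IsOpen (Ioo a b ∩ {τ | G τ ≠ 0}) := isOpen_Ioo.inter (isOpen_ne_fun hGs continuous_const)
    have hz : volume {τ | ¬(τ ∈ Ioo a b → G τ = 0)} = 0 := ae_iff.1 hG0
    have hsub : Ioo a b ∩ {τ | G τ ≠ 0} ⊆ {τ | ¬(τ ∈ Ioo a b → G τ = 0)} :=
      fun τ hτ h => hτ.2 (h hτ.1)
    exact (hop.measure_pos volume ⟨t, ht, hne⟩).ne' (measure_mono_null hsub hz)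
  exact sub_eq_zero.1 h0

/-- There are test functions coinciding with `(τ - t) ^ m` near `t`. -/
theorem exists_test_pow {a b t : ℝ} (ht : t ∈ Ioo a b) (m : ℕ) :
    ∃ h : ℝ → ℝ, ContDiff ℝ ∞ h ∧ HasCompactSupport h ∧ tsupport h ⊆ Ioo a b ∧
      ∀ k, iteratedDeriv k h t = m.descFactorial k * 0 ^ (m - k) := by
  obtain ⟨ε, hε, hb⟩ := Metric.isOpen_iff.1 isOpen_Ioo t ht
  let f : ContDiffBump t := ⟨ε / 3, ε / 2, by positivity, by linarith⟩
  have hf : tsupport f ⊆ Ioo a b := by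
    rw [f.tsupport_eq]
    exact (Metric.closedBall_subset_ball (by simp [f]; linarith)).trans hb
  refine ⟨fun τ => f τ * (τ - t) ^ m, f.contDiff.mul ((contDiff_id.sub contDiff_const).pow m),
    f.hasCompactSupport.mul_right, (closure_mono (Function.support_mul_subset_left _ _)).trans hf,
    fun k => ?_⟩
  have h1 : (fun τ => f τ * (τ - t) ^ m) =ᶠ[𝓝 t] fun τ => (τ - t) ^ m := by
    filter_upwards [f.eventuallyEq_one] with τ hτ
    simp [hτ]
  rw [h1.iteratedDeriv_eq, iteratedDeriv_comp_sub_const k (fun τ => τ ^ m) t]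
  simp [iteratedDeriv_pow]

/-- Coefficients of formally adjoint third-order operators. -/
theorem adjoint_coefficients {p q : Fin 4 → ℝ → ℝ} {a b : ℝ}
    (hp : ∀ s, ContDiffOn ℝ ∞ (p s) (Ioo a b)) (hq : ∀ s, ContDiffOn ℝ ∞ (q s) (Ioo a b))
    (hpq : ∀ f h : ℝ → ℝ, ContDiff ℝ ∞ f → HasCompactSupport f → tsupport f ⊆ Ioo a b →
      ContDiff ℝ ∞ h → HasCompactSupport h → tsupport h ⊆ Ioo a b →
      ∫ τ in a..b, (∑ s, p s τ * iteratedDeriv s h τ) * f τ =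
        ∫ τ in a..b, (∑ s, q s τ * iteratedDeriv s f τ) * h τ) {t : ℝ} (ht : t ∈ Ioo a b) :
    p 3 t + q 3 t = 0 ∧ p 2 t - q 2 t = -3 * deriv (q 3) t ∧
      p 1 t + q 1 t = 2 * deriv (q 2) t - 3 * iteratedDeriv 2 (q 3) t := by
  have hqt (s : Fin 4) : ContDiffAt ℝ ∞ (q s) t := (hq s).contDiffAt (isOpen_Ioo.mem_nhds ht)
  -- For `h` equal to `(τ - t) ^ m` near `t`, only the `m`-th derivative is non-zero at `t`, so the
  -- Leibniz expansion isolates the coefficient of that derivative. The powers `1, 2, 3` are used;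
  -- the zeroth-order condition is not needed.
  have key (m : ℕ) : ∃ h : ℕ → ℝ, (∀ k, h k = m.descFactorial k * 0 ^ (m - k)) ∧
      ∑ s : Fin 4, p s t * h s = ∑ s : Fin 4, (-1) ^ (s : ℕ) *
        ∑ i ∈ Finset.range (s + 1), ((s : ℕ).choose i) * iteratedDeriv i (q s) t * h (s - i) := by
    obtain ⟨h, hh, hc, hs, hk⟩ := exists_test_pow ht m
    refine ⟨fun k => iteratedDeriv k h t, hk, ?_⟩
    rw [formal_adjoint_of_integral hp hq hh hs (fun f hf hfc hfs => hpq f h hf hfc hfs hh hc hs)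
      ht]
    refine Finset.sum_congr rfl fun s _ => ?_
    rw [iteratedDeriv_fun_mul ((hqt s).of_le (by exact_mod_cast le_top))
      (hh.contDiffAt.of_le (by exact_mod_cast le_top))]
  obtain ⟨h1, h1k, e1⟩ := key 1
  obtain ⟨h2, h2k, e2⟩ := key 2
  obtain ⟨h3, h3k, e3⟩ := key 3
  simp [Fin.sum_univ_succ, Finset.sum_range_succ, h1k, Nat.descFactorial, iteratedDeriv_one] at e1
  simp [Fin.sum_univ_succ, Finset.sum_range_succ, h2k, Nat.descFactorial, iteratedDeriv_one] at e2
  simp [Fin.sum_univ_succ, Finset.sum_range_succ, h3k, Nat.descFactorial, iteratedDeriv_one] at e3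
  refine ⟨?_, ?_, ?_⟩ <;> linarith

/-- The coefficients of the linearization of `E` along the curve `γ`. -/
def linCoeff (E : Jet 3 → Fin 2 → ℝ) (γ : ℝ → Fin 2 → ℝ) (i j : Fin 2) (s : Fin 4) (τ : ℝ) : ℝ :=
  fderiv ℝ (fun r => E r i) (jet 3 γ τ) (dir 3 s j)

theorem contDiffAt_linCoeff {Ω : Set (Jet 1)} (hΩ : IsOpen Ω)
    {E : Jet 3 → Fin 2 → ℝ} (hE : ContDiffOn ℝ ∞ E {q | toOne q ∈ Ω})
    {γ : ℝ → Fin 2 → ℝ} (hγ : ContDiff ℝ ∞ γ) {t : ℝ} (ht : jet 1 γ t ∈ Ω) (i j : Fin 2)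
    (s : Fin 4) : ContDiffAt ℝ ∞ (linCoeff E γ i j s) t := by
  have h1 : ContDiffAt ℝ ∞ (fun r => E r i) (jet 3 γ t) :=
    (contDiffOn_pi.1 hE i).contDiffAt ((isOpen_over hΩ 2).mem_nhds (by simpa [toOne_jet] using ht))
  exact ((h1.fderiv_right (m := ∞) (by simp)).comp t (contDiff_jet hγ 3).contDiffAt).clm_apply
    contDiffAt_const

theorem isTest_single {a b : ℝ} {f : ℝ → ℝ} (hf : ContDiff ℝ ∞ f) (hc : HasCompactSupport f)
    (hs : tsupport f ⊆ Ioo a b) (i : Fin 2) : IsTest a b fun τ => Pi.single i (f τ) := by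
  have h (i' : Fin 2) : (fun τ => (Pi.single i (f τ) : Fin 2 → ℝ) i') =
      if i' = i then f else fun _ => 0 := by
    split_ifs with h
    · subst h; simp
    · simp [h]
  refine ⟨contDiff_pi.2 fun i' => ?_, fun i' => ?_, fun i' => ?_⟩ <;> rw [h i'] <;> split_ifs
  · exact hf
  · exact contDiff_const
  · exact hc
  · exact HasCompactSupport.zero
  · exact hs
  · simp [tsupport]

/-- The Helmholtz conditions satisfied by a third-order variational expression. -/
theorem IsVariational.helmholtz {Ω : Set (Jet 1)} (hΩ : IsOpen Ω)
    {E : Jet 3 → Fin 2 → ℝ} (hE : ContDiffOn ℝ ∞ E {q | toOne q ∈ Ω}) (hv : IsVariational Ω E)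
    {γ : ℝ → Fin 2 → ℝ} (hγ : ContDiff ℝ ∞ γ) {t : ℝ} (ht : jet 1 γ t ∈ Ω) (i j : Fin 2) :
    linCoeff E γ i j 3 t + linCoeff E γ j i 3 t = 0 ∧
    linCoeff E γ i j 2 t - linCoeff E γ j i 2 t = -3 * deriv (linCoeff E γ j i 3) t ∧
    linCoeff E γ i j 1 t + linCoeff E γ j i 1 t =
      deriv (linCoeff E γ i j 2) t + deriv (linCoeff E γ j i 2) t := by
  obtain ⟨a, b, htab, hΩab, hself⟩ := hv.exists_selfAdjoint hΩ hE hγ ht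
  have hP (i j : Fin 2) (s : Fin 4) : ContDiffOn ℝ ∞ (linCoeff E γ i j s) (Ioo a b) := fun τ hτ =>
    (contDiffAt_linCoeff hΩ hE hγ (hΩab τ (Ioo_subset_Icc_self hτ)) i j s).contDiffWithinAt
  have hlin {f : ℝ → ℝ} (hf : ContDiff ℝ ∞ f) (i j : Fin 2) (τ : ℝ) :
      fderiv ℝ (fun r => E r i) (jet 3 γ τ) (jetVar 3 (fun τ => Pi.single j (f τ)) τ) =
        ∑ s, linCoeff E γ i j s τ * iteratedDeriv s f τ := by
    have hφ : ContDiff ℝ ∞ fun τ => (Pi.single j (f τ) : Fin 2 → ℝ) :=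
      (ContinuousLinearMap.single ℝ (fun _ : Fin 2 => ℝ) j).contDiff.comp hf
    rw [jetVar_eq_sum hφ, map_sum]
    refine Finset.sum_congr rfl fun s _ => ?_
    rw [map_sum, Finset.sum_eq_single j]
    · simp [linCoeff, mul_comm]
    · intro j' _ hj
      have : (fun τ => (Pi.single j (f τ) : Fin 2 → ℝ) j') = fun _ => 0 := by
        funext τ; simp [hj]
      simp [this]
    · simp
  have hpq : ∀ f h : ℝ → ℝ, ContDiff ℝ ∞ f → HasCompactSupport f → tsupport f ⊆ Ioo a b →
      ContDiff ℝ ∞ h → HasCompactSupport h → tsupport h ⊆ Ioo a b →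
      ∫ τ in a..b, (∑ s, linCoeff E γ i j s τ * iteratedDeriv s h τ) * f τ =
        ∫ τ in a..b, (∑ s, linCoeff E γ j i s τ * iteratedDeriv s f τ) * h τ := by
    intro f h hf hfc hfs hh hhc hhs
    have h1 := hself _ _ (isTest_single hf hfc hfs i) (isTest_single hh hhc hhs j)
    simpa [hlin hf, hlin hh, Pi.single_apply] using h1
  have hco {τ : ℝ} (hτ : τ ∈ Ioo a b) := adjoint_coefficients (hP i j) (hP j i) hpq hτ
  obtain ⟨h3, h2, h1⟩ := hco htab
  refine ⟨h3, h2, ?_⟩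
  -- The second condition holds near `t` and may be differentiated; this eliminates the second
  -- derivative of the leading coefficient and makes the third condition symmetric in `i`, `j`.
  have hev : (fun τ => linCoeff E γ i j 2 τ - linCoeff E γ j i 2 τ) =ᶠ[𝓝 t]
      fun τ => -3 * deriv (linCoeff E γ j i 3) τ := by
    filter_upwards [isOpen_Ioo.mem_nhds htab] with τ hτ
    exact (hco hτ).2.1
  have hd := hev.deriv_eq
  have hdiff (i j : Fin 2) : DifferentiableAt ℝ (linCoeff E γ i j 2) t :=
    (contDiffAt_linCoeff hΩ hE hγ ht i j 2).differentiableAt (by simp)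
  rw [deriv_fun_sub (hdiff i j) (hdiff j i), deriv_const_mul_field] at hd
  rw [iteratedDeriv_succ, iteratedDeriv_one] at h1
  linarith

/-- The holonomic tangent vector of a curve with jet `q` and vanishing fourth derivative. -/
def holonomic (q : Jet 3) : Jet 3 := (1, ![q.2 1, q.2 2, q.2 3, 0])

/-- The cubic curve with a given third-order jet. -/
def cubicCurve (q : Jet 3) (τ : ℝ) : Fin 2 → ℝ :=
  q.2 0 + (τ - q.1) • q.2 1 + ((τ - q.1) ^ 2 / 2) • q.2 2 + ((τ - q.1) ^ 3 / 6) • q.2 3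

theorem iteratedDeriv_cubicCurve (q : Jet 3) :
    deriv (cubicCurve q) = (fun τ => q.2 1 + (τ - q.1) • q.2 2 + ((τ - q.1) ^ 2 / 2) • q.2 3) ∧
    iteratedDeriv 2 (cubicCurve q) = (fun τ => q.2 2 + (τ - q.1) • q.2 3) ∧
    iteratedDeriv 3 (cubicCurve q) = (fun _ => q.2 3) ∧ iteratedDeriv 4 (cubicCurve q) = 0 := by
  have hs (τ : ℝ) : HasDerivAt (fun τ => τ - q.1) 1 τ := (hasDerivAt_id τ).sub_const _
  have h1 : deriv (cubicCurve q) =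
      fun τ => q.2 1 + (τ - q.1) • q.2 2 + ((τ - q.1) ^ 2 / 2) • q.2 3 := by
    funext τ
    refine HasDerivAt.deriv (((((hs τ).smul_const (q.2 1)).const_add (q.2 0)).add
      ((((hs τ).pow 2).div_const 2).smul_const (q.2 2))).add
      ((((hs τ).pow 3).div_const 6).smul_const (q.2 3)) |>.congr_deriv ?_)
    norm_num
    module
  have h2 : iteratedDeriv 2 (cubicCurve q) = fun τ => q.2 2 + (τ - q.1) • q.2 3 := by
    rw [iteratedDeriv_succ, iteratedDeriv_one, h1]
    funext τ
    refine HasDerivAt.deriv ((((hs τ).smul_const (q.2 2)).const_add (q.2 1)).add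
      ((((hs τ).pow 2).div_const 2).smul_const (q.2 3)) |>.congr_deriv ?_)
    norm_num
  have h3 : iteratedDeriv 3 (cubicCurve q) = fun _ => q.2 3 := by
    rw [iteratedDeriv_succ, h2]
    funext τ
    refine HasDerivAt.deriv (((hs τ).smul_const (q.2 3)).const_add (q.2 2) |>.congr_deriv ?_)
    norm_num
  refine ⟨h1, h2, h3, ?_⟩
  rw [iteratedDeriv_succ, h3]
  funext τ
  simp

theorem contDiff_cubicCurve (q : Jet 3) : ContDiff ℝ ∞ (cubicCurve q) := by
  unfold cubicCurve
  fun_prop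

theorem jet_cubicCurve (q : Jet 3) : jet 3 (cubicCurve q) q.1 = q := by
  obtain ⟨h1, h2, h3, -⟩ := iteratedDeriv_cubicCurve q
  refine Prod.ext rfl (funext fun s => ?_)
  fin_cases s
  · simp [jet, cubicCurve]
  · simp [jet, iteratedDeriv_one, h1]
  · simp [jet, h2]
  · simp [jet, h3]

theorem hasDerivAt_jet {γ : ℝ → Fin 2 → ℝ} (hγ : ContDiff ℝ ∞ γ) (k : ℕ) (t : ℝ) :
    HasDerivAt (jet k γ) (1, fun s => iteratedDeriv (s + 1) γ t) t := by
  refine (hasDerivAt_id t).prodMk (hasDerivAt_pi.2 fun s => ?_)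
  rw [iteratedDeriv_succ]
  exact ((contDiff_iteratedDeriv hγ s).differentiable (by simp) t).hasDerivAt

theorem hasDerivAt_jet_cubicCurve (q : Jet 3) :
    HasDerivAt (jet 3 (cubicCurve q)) (holonomic q) q.1 := by
  obtain ⟨h1, h2, h3, h4⟩ := iteratedDeriv_cubicCurve q
  convert hasDerivAt_jet (contDiff_cubicCurve q) 3 q.1 using 1
  refine Prod.ext rfl (funext fun s => ?_)
  fin_cases s
  · simp [holonomic, iteratedDeriv_one, h1]
  · simp [holonomic, h2]
  · simp [holonomic, h3]
  · simp [holonomic, h4]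

/-- The partial derivative `∂E_i/∂v_{s-1}^j`. -/
def partialE (E : Jet 3 → Fin 2 → ℝ) (i j : Fin 2) (s : Fin 4) (q : Jet 3) : ℝ :=
  fderiv ℝ (fun r => E r i) q (dir 3 s j)

section

variable {Ω : Set (Jet 1)} {E : Jet 3 → Fin 2 → ℝ}

theorem contDiffAt_component (hΩ : IsOpen Ω) (hE : ContDiffOn ℝ ∞ E {q | toOne q ∈ Ω}) (i : Fin 2)
    {q : Jet 3} (hq : toOne q ∈ Ω) : ContDiffAt ℝ ∞ (fun r => E r i) q :=
  (contDiffOn_pi.1 hE i).contDiffAt ((isOpen_over hΩ 2).mem_nhds hq)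

theorem contDiffAt_fderiv_apply {V : Type*} [NormedAddCommGroup V] [NormedSpace ℝ V] {f : V → ℝ}
    {x : V} (hf : ContDiffAt ℝ ∞ f x) (u : V) : ContDiffAt ℝ ∞ (fun y => fderiv ℝ f y u) x :=
  (hf.fderiv_right (m := ∞) (by simp)).clm_apply contDiffAt_const

/-- The Helmholtz conditions at a jet. -/
theorem IsVariational.helmholtz_jet (hΩ : IsOpen Ω)
    (hE : ContDiffOn ℝ ∞ E {q | toOne q ∈ Ω}) (hv : IsVariational Ω E)
    {q : Jet 3} (hq : toOne q ∈ Ω) (i j : Fin 2) :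
    partialE E i j 3 q + partialE E j i 3 q = 0 ∧
    partialE E i j 2 q - partialE E j i 2 q =
      -3 * fderiv ℝ (partialE E j i 3) q (holonomic q) ∧
    partialE E i j 1 q + partialE E j i 1 q =
      fderiv ℝ (partialE E i j 2) q (holonomic q) +
        fderiv ℝ (partialE E j i 2) q (holonomic q) := by
  -- Every third-order jet is realized by a cubic curve, whose vanishing fourth derivative turns
  -- total time derivatives at `q` into derivatives along `holonomic q`.
  have hj := jet_cubicCurve q
  have hjq : jet 1 (cubicCurve q) q.1 ∈ Ω := by rwa [← toOne_jet 2, hj]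
  have h := hv.helmholtz hΩ hE (contDiff_cubicCurve q) hjq i j
  have hd (i j : Fin 2) (s : Fin 4) : deriv (linCoeff E (cubicCurve q) i j s) q.1 =
      fderiv ℝ (partialE E i j s) q (holonomic q) := by
    have h1 : DifferentiableAt ℝ (partialE E i j s) (jet 3 (cubicCurve q) q.1) := by
      rw [hj]
      exact (contDiffAt_fderiv_apply (contDiffAt_component hΩ hE i hq) _).differentiableAt (by simp)
    have h2 := h1.hasFDerivAt.comp_hasDerivAt q.1 (hasDerivAt_jet_cubicCurve q)
    rw [hj] at h2
    exact h2.deriv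
  have hl (i j : Fin 2) (s : Fin 4) : linCoeff E (cubicCurve q) i j s q.1 = partialE E i j s q := by
    rw [linCoeff, hj, partialE]
  simpa only [hd, hl] using h

end

/-! ### Normal form of third-order variational expressions -/

theorem fderiv_fderiv_apply_symm {V : Type*} [NormedAddCommGroup V] [NormedSpace ℝ V] {f : V → ℝ}
    {x : V} (hf : ContDiffAt ℝ ∞ f x) (u w : V) :
    fderiv ℝ (fun y => fderiv ℝ f y u) x w = fderiv ℝ (fun y => fderiv ℝ f y w) x u := by
  have hd : DifferentiableAt ℝ (fderiv ℝ f) x :=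
    (hf.fderiv_right (m := ∞) (by simp)).differentiableAt (by simp)
  have h (u : V) : fderiv ℝ (fun y => fderiv ℝ f y u) x = (fderiv ℝ (fderiv ℝ f) x).flip u := by
    have := (hd.hasFDerivAt.clm_apply (hasFDerivAt_const u x)).fderiv
    rw [this]
    ext
    simp
  rw [h, h]
  exact (hf.isSymmSndFDerivAt (by
    rw [minSmoothness_of_isRCLikeNormedField]; exact WithTop.coe_le_coe.2 (le_top : (2 : ℕ∞) ≤ ⊤))).eq w u

theorem clm_fin_two_ext {V : Type*} [NormedAddCommGroup V] [NormedSpace ℝ V]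
    {ℓ m : (Fin 2 → ℝ) →L[ℝ] V} (h : ∀ j, ℓ (Pi.single j 1) = m (Pi.single j 1)) : ℓ = m := by
  have := (Pi.basisFun ℝ (Fin 2)).ext (f₁ := ℓ.toLinearMap) (f₂ := m.toLinearMap)
    (fun j => by simpa using h j)
  exact ContinuousLinearMap.coe_injective this

/-- A function on the plane with vanishing second derivatives is affine. -/
theorem eq_affine_of_hessian_eq_zero {f : (Fin 2 → ℝ) → ℝ} (hf : ContDiff ℝ ∞ f)
    (h : ∀ y j l, fderiv ℝ (fun z => fderiv ℝ f z (Pi.single j 1)) y (Pi.single l 1) = 0)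
    (y : Fin 2 → ℝ) : f y = f 0 + ∑ j, fderiv ℝ f 0 (Pi.single j 1) * y j := by
  have h1 (j : Fin 2) (y : Fin 2 → ℝ) :
      fderiv ℝ f y (Pi.single j 1) = fderiv ℝ f 0 (Pi.single j 1) := by
    refine is_const_of_fderiv_eq_zero (𝕜 := ℝ) (f := fun z => fderiv ℝ f z (Pi.single j 1))
      (fun z => (contDiffAt_fderiv_apply hf.contDiffAt _).differentiableAt (by simp)) (fun z => ?_) y 0
    exact clm_fin_two_ext fun l => by simpa using h z j l
  have h2 (y : Fin 2 → ℝ) : fderiv ℝ f y = fderiv ℝ f 0 := clm_fin_two_ext fun j => h1 j y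
  have h3 : (fun z => f z - fderiv ℝ f 0 z) y = (fun z => f z - fderiv ℝ f 0 z) 0 := by
    refine is_const_of_fderiv_eq_zero (𝕜 := ℝ) (f := fun z => f z - fderiv ℝ f 0 z)
      ((hf.differentiable (by simp)).sub (ContinuousLinearMap.differentiable _)) (fun z => ?_) y 0
    rw [fderiv_fun_sub (hf.differentiable (by simp) z)
      (ContinuousLinearMap.differentiable _ z), ContinuousLinearMap.fderiv, h2, sub_self]
  have h4 : fderiv ℝ f 0 y = ∑ j, fderiv ℝ f 0 (Pi.single j 1) * y j := by
    conv_lhs => rw [pi_eq_sum_univ' y]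
    simp [map_smul, mul_comm]
  simp only [map_zero, sub_zero] at h3
  rw [← h4]
  linarith

/-- The projection `J^{k+1} → J^k`. -/
def truncate (k : ℕ) : Jet (k + 1) →L[ℝ] Jet k :=
  (ContinuousLinearMap.fst ℝ ℝ _).prod ((ContinuousLinearMap.pi fun s : Fin (k + 1) =>
    ContinuousLinearMap.proj (R := ℝ) (φ := fun _ : Fin (k + 2) => Fin 2 → ℝ) s.castSucc).comp
      (ContinuousLinearMap.snd ℝ ℝ _))

theorem truncate_apply (k : ℕ) (q : Jet (k + 1)) : truncate k q = (q.1, fun s => q.2 s.castSucc) :=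
  rfl

theorem toOne_eq_truncate (p : Jet 2) : toOne p = truncate 1 p :=
  Prod.ext rfl (funext fun s => by fin_cases s <;> rfl)

theorem toOne_truncate (q : Jet 3) : toOne (truncate 2 q) = toOne q := rfl

theorem truncate_dir (k : ℕ) (s : Fin (k + 1)) (j : Fin 2) :
    truncate k (dir (k + 1) s.castSucc j) = dir k s j := by
  refine Prod.ext rfl (funext fun s' => ?_)
  simp [truncate_apply, dir, Pi.single_apply]

theorem truncate_dir_last (k : ℕ) (j : Fin 2) :
    truncate k (dir (k + 1) (Fin.last (k + 1)) j) = 0 := by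
  refine Prod.ext rfl (funext fun s' => ?_)
  simp [truncate_apply, dir]

/-- The fibre directions of `J^k → J^{k-1}`. -/
def vert (k : ℕ) : (Fin 2 → ℝ) →L[ℝ] Jet k :=
  (ContinuousLinearMap.inr ℝ ℝ _).comp
    (ContinuousLinearMap.single ℝ (fun _ : Fin (k + 1) => Fin 2 → ℝ) (Fin.last k))

theorem vert_apply (k : ℕ) (w : Fin 2 → ℝ) : vert k w = (0, Pi.single (Fin.last k) w) := rfl

theorem vert_single (k : ℕ) (j : Fin 2) : vert k (Pi.single j 1) = dir k (Fin.last k) j := rfl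

theorem truncate_vert (k : ℕ) (w : Fin 2 → ℝ) : truncate k (vert (k + 1) w) = 0 := by
  refine Prod.ext rfl (funext fun s' => ?_)
  simp [truncate_apply, vert_apply]

/-- The zero section of `J^{k+1} → J^k`. -/
def zeroSection (k : ℕ) : Jet k →L[ℝ] Jet (k + 1) :=
  (ContinuousLinearMap.fst ℝ ℝ _).prod ((ContinuousLinearMap.pi fun s : Fin (k + 2) =>
    if h : (s : ℕ) < k + 1 then
      ContinuousLinearMap.proj (R := ℝ) (φ := fun _ : Fin (k + 1) => Fin 2 → ℝ) ⟨s, h⟩ else 0).comp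
      (ContinuousLinearMap.snd ℝ ℝ _))

theorem zeroSection_add_vert (k : ℕ) (q : Jet (k + 1)) :
    zeroSection k (truncate k q) + vert (k + 1) (q.2 (Fin.last (k + 1))) = q := by
  refine Prod.ext (by simp [zeroSection, truncate, vert]) (funext fun s => ?_)
  refine Fin.lastCases ?_ (fun s => ?_) s
  · simp [zeroSection, truncate, vert]
  · simp [zeroSection, truncate, vert, s.is_le]

theorem truncate_zeroSection (k : ℕ) (p : Jet k) : truncate k (zeroSection k p) = p := by
  refine Prod.ext rfl (funext fun s => ?_)
  simp [zeroSection, truncate, s.is_le]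

theorem zeroSection_last (k : ℕ) (p : Jet k) : (zeroSection k p).2 (Fin.last (k + 1)) = 0 := by
  simp [zeroSection]

theorem zeroSection_castSucc (k : ℕ) (p : Jet k) (s : Fin (k + 1)) :
    (zeroSection k p).2 s.castSucc = p.2 s := by
  simp [zeroSection, s.is_le]

theorem zeroLift_eq (r : Jet 2) : zeroLift r = zeroSection 2 r :=
  Prod.ext rfl (funext fun s => by fin_cases s <;> simp [zeroLift, zeroSection])

/-- The quarter turn `w ↦ (w^2, -w^1) = -∗w`. -/
def turn : (Fin 2 → ℝ) →L[ℝ] (Fin 2 → ℝ) :=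
  ContinuousLinearMap.pi ![ContinuousLinearMap.proj (R := ℝ) (φ := fun _ : Fin 2 => ℝ) 1,
    -ContinuousLinearMap.proj (R := ℝ) (φ := fun _ : Fin 2 => ℝ) 0]

@[simp] theorem turn_zero (w : Fin 2 → ℝ) : turn w 0 = w 1 := rfl
@[simp] theorem turn_one (w : Fin 2 → ℝ) : turn w 1 = -w 0 := rfl

section

variable {Ω : Set (Jet 1)} {E : Jet 3 → Fin 2 → ℝ}

/-- The skew coefficient `∂E_1/∂v''^2` at `v'' = 0`. -/
def skewCoeff (E : Jet 3 → Fin 2 → ℝ) (r : Jet 2) : ℝ := partialE E 0 1 3 (zeroSection 2 r)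

/-- The part of `E` free of `v''`. -/
def freeTerm (E : Jet 3 → Fin 2 → ℝ) (i : Fin 2) (r : Jet 2) : ℝ := E (zeroSection 2 r) i

theorem contDiffAt_partialE (hΩ : IsOpen Ω) (hE : ContDiffOn ℝ ∞ E {q | toOne q ∈ Ω})
    (i j : Fin 2) (s : Fin 4) {q : Jet 3} (hq : toOne q ∈ Ω) : ContDiffAt ℝ ∞ (partialE E i j s) q :=
  contDiffAt_fderiv_apply (contDiffAt_component hΩ hE i hq) _

theorem contDiffAt_skewCoeff (hΩ : IsOpen Ω) (hE : ContDiffOn ℝ ∞ E {q | toOne q ∈ Ω})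
    {r : Jet 2} (hr : toOne r ∈ Ω) : ContDiffAt ℝ ∞ (skewCoeff E) r :=
  (contDiffAt_partialE hΩ hE 0 1 3 (by rwa [← toOne_truncate, truncate_zeroSection])).comp r
    (zeroSection 2).contDiff.contDiffAt

theorem contDiffAt_freeTerm (hΩ : IsOpen Ω) (hE : ContDiffOn ℝ ∞ E {q | toOne q ∈ Ω}) (i : Fin 2)
    {r : Jet 2} (hr : toOne r ∈ Ω) : ContDiffAt ℝ ∞ (freeTerm E i) r :=
  (contDiffAt_component hΩ hE i (by rwa [← toOne_truncate, truncate_zeroSection])).comp r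
    (zeroSection 2).contDiff.contDiffAt

/-- The directional derivative of a function restricted to an affine subspace. -/
theorem fderiv_comp_affine {V W : Type*} [NormedAddCommGroup V] [NormedSpace ℝ V]
    [NormedAddCommGroup W] [NormedSpace ℝ W] {f : W → ℝ} {ℓ : V →L[ℝ] W} {c : W} {x : V}
    (hf : DifferentiableAt ℝ f (c + ℓ x)) (u : V) :
    fderiv ℝ (fun y => f (c + ℓ y)) x u = fderiv ℝ f (c + ℓ x) (ℓ u) := by
  have h := hf.hasFDerivAt.comp x (ℓ.hasFDerivAt.const_add c)
  exact congrArg (fun m => m u) h.fderiv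

/-- A third-order variational expression is affine in `v''`, with a skew leading matrix. -/
theorem IsVariational.eq_affine (hΩ : IsOpen Ω) (hE : ContDiffOn ℝ ∞ E {q | toOne q ∈ Ω})
    (hv : IsVariational Ω E) {q : Jet 3} (hq : toOne q ∈ Ω) (i : Fin 2) :
    E q i = skewCoeff E (truncate 2 q) * turn (q.2 3) i + freeTerm E i (truncate 2 q) := by
  set c := zeroSection 2 (truncate 2 q) with hc
  have hq' (y : Fin 2 → ℝ) : toOne (c + vert 3 y) ∈ Ω := by
    rwa [← toOne_truncate, map_add, truncate_vert, hc, truncate_zeroSection, add_zero]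
  have hfs (i : Fin 2) : ContDiff ℝ ∞ fun y => E (c + vert 3 y) i :=
    contDiff_iff_contDiffAt.2 fun y => (contDiffAt_component hΩ hE i (hq' y)).comp y
      (contDiff_const.add (vert 3).contDiff).contDiffAt
  have hfd (i j : Fin 2) (y : Fin 2 → ℝ) :
      fderiv ℝ (fun y => E (c + vert 3 y) i) y (Pi.single j 1) = partialE E i j 3 (c + vert 3 y) :=
    fderiv_comp_affine ((contDiffAt_component hΩ hE i (hq' y)).differentiableAt (by simp)) _
  have hskew (i j : Fin 2) (y : Fin 2 → ℝ) :
      partialE E i j 3 (c + vert 3 y) = -partialE E j i 3 (c + vert 3 y) := by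
    have := (hv.helmholtz_jet hΩ hE (hq' y) i j).1
    linarith
  set H : Fin 2 → Fin 2 → Fin 2 → (Fin 2 → ℝ) → ℝ := fun i j l y =>
    fderiv ℝ (fun z => partialE E i j 3 (c + vert 3 z)) y (Pi.single l 1) with hH
  have H1 (i j l : Fin 2) (y : Fin 2 → ℝ) : H i j l y = -H j i l y := by
    simp only [hH]
    rw [funext (hskew i j), fderiv_fun_neg]
    rfl
  have H2 (i j l : Fin 2) (y : Fin 2 → ℝ) : H i j l y = H i l j y := by
    simp only [hH, ← hfd]
    exact fderiv_fderiv_apply_symm (hfs i).contDiffAt _ _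
  -- A three-index array that is skew in its first two indices and symmetric in its last two is
  -- zero.
  have H0 (i j l : Fin 2) (y : Fin 2 → ℝ) : H i j l y = 0 := by
    have e1 := H1 i j l y
    have e2 := H2 j i l y
    have e3 := H1 j l i y
    have e4 := H2 l j i y
    have e5 := H1 l i j y
    have e6 := H2 i l j y
    linarith
  have haff := eq_affine_of_hessian_eq_zero (hfs i) (fun y j l => by
    simp only [hfd]; exact H0 i j l y) (q.2 3)
  simp only [hfd, map_zero, add_zero, Fin.sum_univ_two] at haff
  have hcq : c + vert 3 (q.2 3) = q := zeroSection_add_vert 2 q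
  rw [hcq] at haff
  have s00 := hskew 0 0 0
  have s11 := hskew 1 1 0
  have s10 := hskew 1 0 0
  rw [map_zero, add_zero] at s00 s11 s10
  rw [haff, skewCoeff, freeTerm, ← hc]
  fin_cases i
  · simp only [Fin.zero_eta, turn_zero]
    linear_combination (q.2 3 0 / 2) * s00
  · simp only [Fin.mk_one, turn_one]
    linear_combination (q.2 3 1 / 2) * s11 + q.2 3 0 * s10

/-- The horizontal vector `∂_t + v ∂_x + v' ∂_v` at a second-order jet. -/
def horizontal (r : Jet 2) : Jet 2 := (1, ![r.2 1, r.2 2, 0])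

theorem truncate_holonomic (q : Jet 3) :
    truncate 2 (holonomic q) = horizontal (truncate 2 q) + vert 2 (q.2 3) := by
  refine Prod.ext (by simp [truncate_apply, holonomic, horizontal, vert_apply]) (funext fun s => ?_)
  have h (s : Fin 3) : (truncate 2 (holonomic q)).2 s = (horizontal (truncate 2 q)).2 s +
      (Pi.single (Fin.last 2) (q.2 3) : Fin 3 → Fin 2 → ℝ) s := by
    fin_cases s
    · rw [Pi.single_eq_of_ne (by decide), add_zero]; rfl
    · rw [Pi.single_eq_of_ne (by decide), add_zero]; rfl
    · change q.2 3 = 0 + (Pi.single (Fin.last 2) (q.2 3) : Fin 3 → Fin 2 → ℝ) (Fin.last 2)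
      rw [Pi.single_eq_same, zero_add]
  exact h s

theorem toOne_zeroSection_add_vert (r : Jet 2) (y : Fin 2 → ℝ) :
    toOne (zeroSection 2 r + vert 3 y) = toOne r := by
  rw [← toOne_truncate, map_add, truncate_vert, truncate_zeroSection, add_zero]

theorem truncate_zeroSection_add_vert (k : ℕ) (r : Jet k) (y : Fin 2 → ℝ) :
    truncate k (zeroSection k r + vert (k + 1) y) = r := by
  rw [map_add, truncate_vert, truncate_zeroSection, add_zero]

theorem zeroSection_add_vert_last (k : ℕ) (r : Jet k) (y : Fin 2 → ℝ) :
    (zeroSection k r + vert (k + 1) y).2 (Fin.last (k + 1)) = y := by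
  simp [zeroSection, vert_apply]

theorem eventually_over (hΩ : IsOpen Ω) {k : ℕ} {q : Jet (k + 1)} (hq : toOne q ∈ Ω) :
    ∀ᶠ q' in 𝓝 q, toOne q' ∈ Ω :=
  (isOpen_over hΩ k).mem_nhds hq

theorem IsVariational.fderiv_eq (hΩ : IsOpen Ω) (hE : ContDiffOn ℝ ∞ E {q | toOne q ∈ Ω})
    (hv : IsVariational Ω E) {q : Jet 3} (hq : toOne q ∈ Ω) (i : Fin 2) (w : Jet 3) :
    fderiv ℝ (fun r => E r i) q w =
      fderiv ℝ (skewCoeff E) (truncate 2 q) (truncate 2 w) * turn (q.2 3) i +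
        skewCoeff E (truncate 2 q) * turn (w.2 3) i +
        fderiv ℝ (freeTerm E i) (truncate 2 q) (truncate 2 w) := by
  have hev : (fun r => E r i) =ᶠ[𝓝 q] fun q =>
      skewCoeff E (truncate 2 q) * turn (q.2 3) i + freeTerm E i (truncate 2 q) := by
    filter_upwards [eventually_over hΩ hq] with q' hq'
    exact hv.eq_affine hΩ hE hq' i
  have hr : toOne (truncate 2 q) ∈ Ω := hq
  have h1 := ((contDiffAt_skewCoeff hΩ hE hr).differentiableAt (by simp)).hasFDerivAt.comp q
    (truncate 2).hasFDerivAt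
  have h2 := ((contDiffAt_freeTerm hΩ hE i hr).differentiableAt (by simp)).hasFDerivAt.comp q
    (truncate 2).hasFDerivAt
  let m : Jet 3 →L[ℝ] ℝ := (ContinuousLinearMap.proj (R := ℝ) (φ := fun _ : Fin 2 => ℝ) i).comp
    (turn.comp ((ContinuousLinearMap.proj (R := ℝ) (φ := fun _ : Fin 4 => Fin 2 → ℝ) 3).comp
      (ContinuousLinearMap.snd ℝ ℝ _)))
  have h3 := (h1.mul (m.hasFDerivAt (x := q))).add h2
  rw [(hev.hasFDerivAt_iff.2 h3).fderiv]
  simp [m]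
  ring

theorem IsVariational.partialE_castSucc (hΩ : IsOpen Ω) (hE : ContDiffOn ℝ ∞ E {q | toOne q ∈ Ω})
    (hv : IsVariational Ω E) {q : Jet 3} (hq : toOne q ∈ Ω) (i j : Fin 2) (s : Fin 3) :
    partialE E i j s.castSucc q =
      fderiv ℝ (skewCoeff E) (truncate 2 q) (dir 2 s j) * turn (q.2 3) i +
        fderiv ℝ (freeTerm E i) (truncate 2 q) (dir 2 s j) := by
  have h3 : (dir 3 s.castSucc j).2 3 = 0 := Pi.single_eq_of_ne (Fin.castSucc_ne_last s).symm _
  rw [partialE, hv.fderiv_eq hΩ hE hq, h3, truncate_dir]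
  simp

theorem IsVariational.partialE_last (hΩ : IsOpen Ω) (hE : ContDiffOn ℝ ∞ E {q | toOne q ∈ Ω})
    (hv : IsVariational Ω E) {q : Jet 3} (hq : toOne q ∈ Ω) (i j : Fin 2) :
    partialE E i j 3 q = skewCoeff E (truncate 2 q) * turn (Pi.single j 1) i := by
  have h3 : (dir 3 3 j).2 3 = Pi.single j 1 := by simp [dir]
  have h4 : truncate 2 (dir 3 3 j) = 0 := truncate_dir_last 2 j
  rw [partialE, hv.fderiv_eq hΩ hE hq, h3, h4]
  simp

theorem fderiv_comp_truncate {k : ℕ} {f : Jet k → ℝ} {q : Jet (k + 1)}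
    (hf : DifferentiableAt ℝ f (truncate k q)) (w : Jet (k + 1)) :
    fderiv ℝ (fun q => f (truncate k q)) q w = fderiv ℝ f (truncate k q) (truncate k w) :=
  congrArg (fun m => m w) (hf.hasFDerivAt.comp q (truncate k).hasFDerivAt).fderiv

theorem vert_eq_sum (k : ℕ) (y : Fin 2 → ℝ) :
    vert k y = y 0 • dir k (Fin.last k) 0 + y 1 • dir k (Fin.last k) 1 := by
  conv_lhs => rw [pi_eq_sum_univ' y]
  simp [Fin.sum_univ_two, vert_single]

/-- The leading coefficient does not depend on `v'`, and the rotor of the free term in `v'` is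
determined by it. -/
theorem IsVariational.rotor_freeTerm (hΩ : IsOpen Ω) (hE : ContDiffOn ℝ ∞ E {q | toOne q ∈ Ω})
    (hv : IsVariational Ω E) {r : Jet 2} (hr : toOne r ∈ Ω) :
    (∀ j, fderiv ℝ (skewCoeff E) r (dir 2 2 j) = 0) ∧
    fderiv ℝ (freeTerm E 0) r (dir 2 2 1) - fderiv ℝ (freeTerm E 1) r (dir 2 2 0) =
      3 * fderiv ℝ (skewCoeff E) r (horizontal r) := by
  -- The second Helmholtz condition over `r`, with `v'' = y` free, is affine in `y`. Its linear part
  -- reads `a = 3 a` for each `v'`-derivative `a` of the leading coefficient, so `a = 0`; its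
  -- constant part is the rotor relation.
  have key (y : Fin 2 → ℝ) :
      fderiv ℝ (skewCoeff E) r (dir 2 2 1) * y 1 + fderiv ℝ (freeTerm E 0) r (dir 2 2 1) -
        (fderiv ℝ (skewCoeff E) r (dir 2 2 0) * -y 0 + fderiv ℝ (freeTerm E 1) r (dir 2 2 0)) =
      3 * (fderiv ℝ (skewCoeff E) r (horizontal r) +
        (y 0 * fderiv ℝ (skewCoeff E) r (dir 2 2 0) + y 1 * fderiv ℝ (skewCoeff E) r (dir 2 2 1))) := by
    set q := zeroSection 2 r + vert 3 y with hq_def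
    have hqr : truncate 2 q = r := truncate_zeroSection_add_vert 2 r y
    have hqy : q.2 3 = y := zeroSection_add_vert_last 2 r y
    have hq : toOne q ∈ Ω := by rwa [hq_def, toOne_zeroSection_add_vert]
    have h2 := (hv.helmholtz_jet hΩ hE hq 0 1).2.1
    have p1 := hv.partialE_castSucc hΩ hE hq 0 1 2
    have p2 := hv.partialE_castSucc hΩ hE hq 1 0 2
    rw [hqr, hqy] at p1 p2
    have hev : partialE E 1 0 3 =ᶠ[𝓝 q] fun q => -skewCoeff E (truncate 2 q) := by
      filter_upwards [eventually_over hΩ hq] with q' hq'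
      rw [hv.partialE_last hΩ hE hq']
      simp
    rw [hev.fderiv_eq, fderiv_fun_neg, neg_apply, fderiv_comp_truncate
      (by rw [hqr]; exact (contDiffAt_skewCoeff hΩ hE hr).differentiableAt (by simp)),
      truncate_holonomic, hqr, hqy, vert_eq_sum] at h2
    have p1' : partialE E 0 1 2 q = _ := p1
    have p2' : partialE E 1 0 2 q = _ := p2
    rw [p1', p2'] at h2
    simp only [turn_zero, turn_one, map_add, map_smul, smul_eq_mul] at h2
    have hl : (Fin.last 2 : Fin 3) = 2 := rfl
    rw [hl] at h2
    linarith
  have k0 := key 0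
  have k1 := key (Pi.single 0 1)
  have k2 := key (Pi.single 1 1)
  simp at k0 k1 k2
  refine ⟨fun j => ?_, by linarith⟩
  fin_cases j
  · simp only [Fin.zero_eta]; linarith
  · simp only [Fin.mk_one]; linarith

/-- The second derivatives of the free term in `v'`. -/
theorem IsVariational.hessian_freeTerm (hΩ : IsOpen Ω) (hE : ContDiffOn ℝ ∞ E {q | toOne q ∈ Ω})
    (hv : IsVariational Ω E) {r : Jet 2} (hr : toOne r ∈ Ω) (i j l : Fin 2) :
    fderiv ℝ (fun z => fderiv ℝ (freeTerm E i) z (dir 2 2 j)) r (dir 2 2 l) =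
      fderiv ℝ (skewCoeff E) r (dir 2 1 j) * turn (Pi.single l 1) i +
        fderiv ℝ (skewCoeff E) r (dir 2 1 l) * turn (Pi.single j 1) i := by
  set H : Fin 2 → Fin 2 → Fin 2 → ℝ := fun i j l =>
    fderiv ℝ (fun z => fderiv ℝ (freeTerm E i) z (dir 2 2 j)) r (dir 2 2 l) with hH
  have H2 (i j l : Fin 2) : H i j l = H i l j :=
    fderiv_fderiv_apply_symm (contDiffAt_freeTerm hΩ hE i hr) _ _
  -- The third Helmholtz condition is likewise affine in `v'' = y`; its linear part gives the
  -- symmetrization of `H` in `i`, `j`.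
  have key (y : Fin 2 → ℝ) (i j : Fin 2) :
      fderiv ℝ (skewCoeff E) r (dir 2 1 j) * turn y i + fderiv ℝ (freeTerm E i) r (dir 2 1 j) +
        (fderiv ℝ (skewCoeff E) r (dir 2 1 i) * turn y j + fderiv ℝ (freeTerm E j) r (dir 2 1 i)) =
      (fderiv ℝ (fun z => fderiv ℝ (freeTerm E i) z (dir 2 2 j)) r (horizontal r) +
        (y 0 * H i j 0 + y 1 * H i j 1)) +
      (fderiv ℝ (fun z => fderiv ℝ (freeTerm E j) z (dir 2 2 i)) r (horizontal r) +
        (y 0 * H j i 0 + y 1 * H j i 1)) := by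
    set q := zeroSection 2 r + vert 3 y with hq_def
    have hqr : truncate 2 q = r := truncate_zeroSection_add_vert 2 r y
    have hqy : q.2 3 = y := zeroSection_add_vert_last 2 r y
    have hq : toOne q ∈ Ω := by rwa [hq_def, toOne_zeroSection_add_vert]
    have h1 := (hv.helmholtz_jet hΩ hE hq i j).2.2
    have p1 : partialE E i j 1 q = _ := hv.partialE_castSucc hΩ hE hq i j 1
    have p2 : partialE E j i 1 q = _ := hv.partialE_castSucc hΩ hE hq j i 1
    rw [hqr, hqy] at p1 p2
    have hd (i j : Fin 2) : fderiv ℝ (partialE E i j 2) q (holonomic q) =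
        fderiv ℝ (fun z => fderiv ℝ (freeTerm E i) z (dir 2 2 j)) r (horizontal r) +
          (y 0 * H i j 0 + y 1 * H i j 1) := by
      have hev : partialE E i j 2 =ᶠ[𝓝 q]
          fun q => (fun z => fderiv ℝ (freeTerm E i) z (dir 2 2 j)) (truncate 2 q) := by
        filter_upwards [eventually_over hΩ hq] with q' hq'
        have p : partialE E i j 2 q' = _ := hv.partialE_castSucc hΩ hE hq' i j 2
        rw [p, (hv.rotor_freeTerm hΩ hE (r := truncate 2 q') hq').1 j]
        simp
      rw [hev.fderiv_eq, fderiv_comp_truncate (f := fun z => fderiv ℝ (freeTerm E i) z (dir 2 2 j))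
        (by rw [hqr]; exact (contDiffAt_fderiv_apply (contDiffAt_freeTerm hΩ hE i hr)
          _).differentiableAt (by simp)),
        truncate_holonomic, hqr, hqy, vert_eq_sum, map_add, map_add, map_smul, map_smul]
      rfl
    rw [p1, p2, hd, hd] at h1
    exact h1
  have K (i j : Fin 2) := key 0 i j
  have K0 (i j : Fin 2) := key (Pi.single 0 1) i j
  have K1 (i j : Fin 2) := key (Pi.single 1 1) i j
  have S (i j l : Fin 2) : H i j l + H j i l =
      fderiv ℝ (skewCoeff E) r (dir 2 1 j) * turn (Pi.single l 1) i +
      fderiv ℝ (skewCoeff E) r (dir 2 1 i) * turn (Pi.single l 1) j := by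
    have e := K i j
    have e0 := K0 i j
    have e1 := K1 i j
    simp only [map_zero, Pi.zero_apply, Pi.single_eq_same, ne_eq, one_ne_zero, zero_ne_one,
      not_false_eq_true, Pi.single_eq_of_ne] at e e0 e1
    fin_cases l
    · simp only [Fin.zero_eta]; linarith
    · simp only [Fin.mk_one]; linarith
  -- As for Christoffel symbols: `H` is symmetric in `j`, `l` and its symmetrization in the first
  -- two indices is known, so `S i j l + S i l j - S j l i` determines `2 * H i j l`.
  change H i j l = _
  have s1 := S i j l
  have s2 := S i l j
  have s3 := S j l i
  have t1 := H2 i j l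
  have t2 := H2 j i l
  have t3 := H2 l i j
  fin_cases i <;> fin_cases j <;> fin_cases l <;> simp at * <;> linarith

theorem differentiableAt_comp_affine {V W : Type*} [NormedAddCommGroup V] [NormedSpace ℝ V]
    [NormedAddCommGroup W] [NormedSpace ℝ W] {f : W → ℝ} {ℓ : V →L[ℝ] W} {c : W} {x : V}
    (hf : DifferentiableAt ℝ f (c + ℓ x)) : DifferentiableAt ℝ (fun y => f (c + ℓ y)) x :=
  hf.comp x (ℓ.differentiableAt.const_add c)

/-- The leading coefficient as a function on first-order contact elements. -/
def leadCoeff (E : Jet 3 → Fin 2 → ℝ) (p : Jet 1) : ℝ := skewCoeff E (zeroSection 1 p)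

/-- The coefficient of `E` at the first power of `v'`. -/
def linearTerm (E : Jet 3 → Fin 2 → ℝ) (p : Jet 1) (i j : Fin 2) : ℝ :=
  fderiv ℝ (freeTerm E i) (zeroSection 1 p) (dir 2 2 j)

/-- The value of `E` at `v' = v'' = 0`. -/
def constTerm (E : Jet 3 → Fin 2 → ℝ) (p : Jet 1) (i : Fin 2) : ℝ := freeTerm E i (zeroSection 1 p)

theorem toOne_zeroSection (p : Jet 1) : toOne (zeroSection 1 p) = p := by
  rw [toOne_eq_truncate, truncate_zeroSection]

theorem contDiffAt_leadCoeff (hΩ : IsOpen Ω) (hE : ContDiffOn ℝ ∞ E {q | toOne q ∈ Ω})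
    {p : Jet 1} (hp : p ∈ Ω) : ContDiffAt ℝ ∞ (leadCoeff E) p :=
  (contDiffAt_skewCoeff hΩ hE (by rwa [toOne_zeroSection])).comp p
    (zeroSection 1).contDiff.contDiffAt

theorem contDiffAt_linearTerm (hΩ : IsOpen Ω) (hE : ContDiffOn ℝ ∞ E {q | toOne q ∈ Ω})
    {p : Jet 1} (hp : p ∈ Ω) (i j : Fin 2) : ContDiffAt ℝ ∞ (fun p => linearTerm E p i j) p :=
  (contDiffAt_fderiv_apply (contDiffAt_freeTerm hΩ hE i (by rwa [toOne_zeroSection])) _).comp p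
    (zeroSection 1).contDiff.contDiffAt

theorem contDiffAt_constTerm (hΩ : IsOpen Ω) (hE : ContDiffOn ℝ ∞ E {q | toOne q ∈ Ω})
    {p : Jet 1} (hp : p ∈ Ω) (i : Fin 2) : ContDiffAt ℝ ∞ (fun p => constTerm E p i) p :=
  (contDiffAt_freeTerm hΩ hE i (by rwa [toOne_zeroSection])).comp p
    (zeroSection 1).contDiff.contDiffAt

theorem toOne_zeroSection_add_vert' (p : Jet 1) (w : Fin 2 → ℝ) :
    toOne (zeroSection 1 p + vert 2 w) = p := by
  rw [toOne_eq_truncate, truncate_zeroSection_add_vert]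

/-- The `v'`-gradient vanishes by `IsVariational.rotor_freeTerm` and the fibre over a contact
element is the whole plane, so the value at `v' = 0` is the value everywhere on the fibre. -/
theorem IsVariational.skewCoeff_eq (hΩ : IsOpen Ω) (hE : ContDiffOn ℝ ∞ E {q | toOne q ∈ Ω})
    (hv : IsVariational Ω E) {r : Jet 2} (hr : toOne r ∈ Ω) :
    skewCoeff E r = leadCoeff E (truncate 1 r) := by
  set c := zeroSection 1 (truncate 1 r) with hc
  have hq (w : Fin 2 → ℝ) : toOne (c + vert 2 w) ∈ Ω := by
    rwa [hc, toOne_zeroSection_add_vert', ← toOne_eq_truncate]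
  have h1 := is_const_of_fderiv_eq_zero (𝕜 := ℝ) (f := fun w => skewCoeff E (c + vert 2 w))
    (fun w => differentiableAt_comp_affine
      ((contDiffAt_skewCoeff hΩ hE (hq w)).differentiableAt (by simp)))
    (fun w => clm_fin_two_ext fun j => by
      rw [fderiv_comp_affine ((contDiffAt_skewCoeff hΩ hE (hq w)).differentiableAt (by simp)),
        vert_single]
      exact (hv.rotor_freeTerm hΩ hE (hq w)).1 j) (r.2 2) 0
  simp only [map_zero, add_zero] at h1
  rw [leadCoeff, ← hc, ← h1]
  exact congrArg _ (zeroSection_add_vert 1 r).symm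

theorem IsVariational.fderiv_skewCoeff (hΩ : IsOpen Ω) (hE : ContDiffOn ℝ ∞ E {q | toOne q ∈ Ω})
    (hv : IsVariational Ω E) {r : Jet 2} (hr : toOne r ∈ Ω) (u : Jet 2) :
    fderiv ℝ (skewCoeff E) r u = fderiv ℝ (leadCoeff E) (truncate 1 r) (truncate 1 u) := by
  have hev : skewCoeff E =ᶠ[𝓝 r] fun r => leadCoeff E (truncate 1 r) := by
    filter_upwards [eventually_over hΩ hr] with r' hr'
    exact hv.skewCoeff_eq hΩ hE hr'
  rw [hev.fderiv_eq, fderiv_comp_truncate]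
  exact (contDiffAt_leadCoeff hΩ hE (by rwa [← toOne_eq_truncate])).differentiableAt (by simp)

/-- The differential of the leading coefficient in `v`, applied to `w`. -/
def leadGrad (E : Jet 3 → Fin 2 → ℝ) (p : Jet 1) (w : Fin 2 → ℝ) : ℝ :=
  fderiv ℝ (leadCoeff E) p (vert 1 w)

theorem leadGrad_eq (p : Jet 1) (w : Fin 2 → ℝ) :
    leadGrad E p w = leadGrad E p (Pi.single 0 1) * w 0 + leadGrad E p (Pi.single 1 1) * w 1 := by
  simp only [leadGrad, vert_single]
  rw [vert_eq_sum]
  simp [mul_comm]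

theorem IsVariational.freeTerm_eq (hΩ : IsOpen Ω) (hE : ContDiffOn ℝ ∞ E {q | toOne q ∈ Ω})
    (hv : IsVariational Ω E) {r : Jet 2} (hr : toOne r ∈ Ω) (i : Fin 2) :
    freeTerm E i r = leadGrad E (toOne r) (r.2 2) * turn (r.2 2) i +
      ∑ j, linearTerm E (toOne r) i j * r.2 2 j + constTerm E (toOne r) i := by
  set c := zeroSection 1 (truncate 1 r) with hc
  have ht (w : Fin 2 → ℝ) : truncate 1 (c + vert 2 w) = truncate 1 r :=
    truncate_zeroSection_add_vert 1 _ w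
  have hq (w : Fin 2 → ℝ) : toOne (c + vert 2 w) ∈ Ω := by
    rwa [toOne_eq_truncate, ht, ← toOne_eq_truncate]
  have hfs : ContDiff ℝ ∞ fun w => freeTerm E i (c + vert 2 w) :=
    contDiff_iff_contDiffAt.2 fun w => (contDiffAt_freeTerm hΩ hE i (hq w)).comp w
      (contDiff_const.add (vert 2).contDiff).contDiffAt
  have hfd (w : Fin 2 → ℝ) (j : Fin 2) : fderiv ℝ (fun w => freeTerm E i (c + vert 2 w)) w
      (Pi.single j 1) = fderiv ℝ (freeTerm E i) (c + vert 2 w) (dir 2 2 j) :=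
    fderiv_comp_affine ((contDiffAt_freeTerm hΩ hE i (hq w)).differentiableAt (by simp)) _
  let m : (Fin 2 → ℝ) →L[ℝ] ℝ :=
    (ContinuousLinearMap.proj (R := ℝ) (φ := fun _ : Fin 2 => ℝ) i).comp turn
  let ℓ : (Fin 2 → ℝ) →L[ℝ] ℝ := (fderiv ℝ (leadCoeff E) (truncate 1 r)).comp (vert 1)
  -- The product `ℓ w * m w` has exactly the Hessian found in `IsVariational.hessian_freeTerm`;
  -- after subtracting it, the free term is affine in `v'`.
  have hquad (w : Fin 2 → ℝ) : HasFDerivAt (fun w => ℓ w * m w) (ℓ w • m + m w • ℓ) w :=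
    ℓ.hasFDerivAt.mul m.hasFDerivAt
  have hJ (w : Fin 2 → ℝ) (j : Fin 2) :
      fderiv ℝ (fun w => freeTerm E i (c + vert 2 w) - ℓ w * m w) w (Pi.single j 1) =
        fderiv ℝ (freeTerm E i) (c + vert 2 w) (dir 2 2 j) -
          (ℓ w * m (Pi.single j 1) + m w * ℓ (Pi.single j 1)) := by
    rw [fderiv_fun_sub (hfs.differentiable (by simp) w) (hquad w).differentiableAt, sub_apply, hfd,
      (hquad w).fderiv]
    rfl
  have haff := eq_affine_of_hessian_eq_zero
    (f := fun w => freeTerm E i (c + vert 2 w) - ℓ w * m w)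
    (hfs.sub (ℓ.contDiff.mul m.contDiff)) (fun w j l => ?_) (r.2 2)
  · simp only [hJ, map_zero, add_zero, zero_mul, mul_zero, sub_zero] at haff
    have hr2 : c + vert 2 (r.2 2) = r := zeroSection_add_vert 1 r
    rw [hr2] at haff
    rw [toOne_eq_truncate]
    have hlin (j : Fin 2) : linearTerm E (truncate 1 r) i j = fderiv ℝ (freeTerm E i) c (dir 2 2 j) :=
      rfl
    have hcon : constTerm E (truncate 1 r) i = freeTerm E i c := rfl
    have hgrad : leadGrad E (truncate 1 r) (r.2 2) = ℓ (r.2 2) := rfl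
    have hm : turn (r.2 2) i = m (r.2 2) := rfl
    simp only [hlin, hcon, hgrad, hm]
    linarith
  · simp only [hJ]
    have hsnd : DifferentiableAt ℝ (fun w => fderiv ℝ (freeTerm E i) (c + vert 2 w) (dir 2 2 j)) w :=
      differentiableAt_comp_affine (f := fun z => fderiv ℝ (freeTerm E i) z (dir 2 2 j))
        ((contDiffAt_fderiv_apply (contDiffAt_freeTerm hΩ hE i (hq w)) _).differentiableAt (by simp))
    have hlin : HasFDerivAt (fun w => ℓ w * m (Pi.single j 1) + m w * ℓ (Pi.single j 1))
        (m (Pi.single j 1) • ℓ + ℓ (Pi.single j 1) • m) w :=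
      (ℓ.hasFDerivAt.mul_const _).add (m.hasFDerivAt.mul_const _)
    have hh := hv.hessian_freeTerm hΩ hE (hq w) i j l
    rw [hv.fderiv_skewCoeff hΩ hE (hq w), hv.fderiv_skewCoeff hΩ hE (hq w), ht] at hh
    have hdir (j : Fin 2) : truncate 1 (dir 2 1 j) = vert 1 (Pi.single j 1) := truncate_dir 1 1 j
    rw [hdir, hdir] at hh
    rw [fderiv_fun_sub hsnd hlin.differentiableAt, sub_apply, hlin.fderiv,
      fderiv_comp_affine (f := fun z => fderiv ℝ (freeTerm E i) z (dir 2 2 j))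
      ((contDiffAt_fderiv_apply (contDiffAt_freeTerm hΩ hE i (hq w)) _).differentiableAt (by simp)),
      vert_single]
    refine (congrArg (· - _) hh).trans ?_
    change ℓ (Pi.single j 1) * m (Pi.single l 1) + ℓ (Pi.single l 1) * m (Pi.single j 1) -
      (m (Pi.single j 1) * ℓ (Pi.single l 1) + ℓ (Pi.single j 1) * m (Pi.single l 1)) = 0
    ring

/-- The general form of a third-order variational expression in the plane. -/
theorem IsVariational.eq_normal_form (hΩ : IsOpen Ω) (hE : ContDiffOn ℝ ∞ E {q | toOne q ∈ Ω})
    (hv : IsVariational Ω E) {q : Jet 3} (hq : toOne q ∈ Ω) (i : Fin 2) :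
    E q i = leadCoeff E (toOne q) * turn (q.2 3) i +
      (leadGrad E (toOne q) (q.2 2) * turn (q.2 2) i +
        ∑ j, linearTerm E (toOne q) i j * q.2 2 j + constTerm E (toOne q) i) := by
  rw [hv.eq_affine hΩ hE hq, hv.freeTerm_eq hΩ hE (r := truncate 2 q) hq,
    hv.skewCoeff_eq hΩ hE (r := truncate 2 q) hq, ← toOne_eq_truncate, toOne_truncate]
  rfl

/-- At `v' = 0` the horizontal vector projects to `∂_t + v ∂_x`. This is the only link between the
skew part of the linear term and the leading coefficient, and it later kills that skew part. -/
theorem IsVariational.rotor_linearTerm (hΩ : IsOpen Ω) (hE : ContDiffOn ℝ ∞ E {q | toOne q ∈ Ω})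
    (hv : IsVariational Ω E) {p : Jet 1} (hp : p ∈ Ω) :
    linearTerm E p 0 1 - linearTerm E p 1 0 =
      3 * fderiv ℝ (leadCoeff E) p (1, ![p.2 1, 0]) := by
  have hp' : toOne (zeroSection 1 p) ∈ Ω := by rwa [toOne_zeroSection]
  have h := (hv.rotor_freeTerm hΩ hE hp').2
  rw [hv.fderiv_skewCoeff hΩ hE hp', truncate_zeroSection] at h
  have hh : truncate 1 (horizontal (zeroSection 1 p)) = (1, ![p.2 1, 0]) := by
    refine Prod.ext rfl (funext fun s => ?_)
    fin_cases s
    · exact zeroSection_castSucc 1 p 1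
    · exact zeroSection_last 1 p
  rw [hh] at h
  exact h

end

/-! ### Lie derivatives and the reduced invariance equations -/

theorem differentiable_generator (η : ℝ) (g : Fin 2 → ℝ) (a₀ : ℝ) (a π : Fin 2 → ℝ) (ρ : ℝ) :
    Differentiable ℝ (generator η g a₀ a π ρ) := by
  have hc (s : Fin 3) (i : Fin 2) : Differentiable ℝ fun p : Jet 2 => p.2 s i :=
    (dCoord 2 s i).differentiable
  have ht : Differentiable ℝ fun p : Jet 2 => p.1 := (dTime 2).differentiable
  refine Differentiable.prodMk ?_ (differentiable_pi.2 fun s => differentiable_pi.2 fun i => ?_)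
  · simp only [dot, Fin.sum_univ_two]
    have := hc 0 0
    have := hc 0 1
    fun_prop
  · have := hc 0 0
    have := hc 0 1
    have := hc 1 0
    have := hc 1 1
    have := hc 2 0
    have := hc 2 1
    fin_cases s <;> fin_cases i <;> simp [dot, rot, Fin.sum_univ_two, Matrix.vecHead, Matrix.vecTail] <;> fun_prop

/-- The components of the derivative of a prolonged infinitesimal transformation that enter the
Lie derivative of `A dv' + K dt`. -/
theorem fderiv_generator (η : ℝ) (g : Fin 2 → ℝ) (a₀ : ℝ) (a π : Fin 2 → ℝ) (ρ : ℝ) (p u : Jet 2) :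
    (fderiv ℝ (generator η g a₀ a π ρ) p u).1 = -dot g π (u.2 0) ∧
    (fderiv ℝ (generator η g a₀ a π ρ) p u).2 2 =
      (2 * dot g π (u.2 1)) • p.2 2 + (2 * dot g π (p.2 1)) • u.2 2 + dot g π (u.2 2) • p.2 1 +
        dot g π (p.2 2) • u.2 1 + rot g ρ (u.2 2) := by
  have h := (differentiable_generator η g a₀ a π ρ p).hasFDerivAt.hasLineDerivAt u
  have hd (x y : Fin 2 → ℝ) (s : ℝ) : dot g π (x + s • y) = dot g π x + s * dot g π y := by
    simp [dot, Fin.sum_univ_two]; ring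
  have hr (x y : Fin 2 → ℝ) (s : ℝ) : rot g ρ (x + s • y) = rot g ρ x + s • rot g ρ y := by
    ext i; fin_cases i <;> simp [rot] <;> ring
  have hs : HasDerivAt (fun s : ℝ => s) 1 0 := hasDerivAt_id 0
  have hs2 : HasDerivAt (fun s : ℝ => s ^ 2) 0 0 := by simpa using hasDerivAt_pow 2 (0 : ℝ)
  constructor
  · have h1 : HasDerivAt (fun s : ℝ => (generator η g a₀ a π ρ (p + s • u)).1) _ 0 :=
      (ContinuousLinearMap.fst ℝ ℝ (Fin 3 → Fin 2 → ℝ)).hasFDerivAt.comp_hasDerivAt 0 h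
    refine h1.unique ?_
    have h2 := (hs.smul_const (-dot g π (u.2 0))).const_add (a₀ - dot g π (p.2 0))
    rw [one_smul] at h2
    refine h2.congr_of_eventuallyEq (Eventually.of_forall fun s => ?_)
    simp only [generator, Prod.snd_add, Prod.smul_snd, Pi.add_apply, Pi.smul_apply, hd, smul_eq_mul]
    ring
  · have h1 : HasDerivAt (fun s : ℝ => (generator η g a₀ a π ρ (p + s • u)).2 2) _ 0 :=
      ((ContinuousLinearMap.proj (R := ℝ) (φ := fun _ : Fin 3 => Fin 2 → ℝ) 2).comp
        (ContinuousLinearMap.snd ℝ ℝ (Fin 3 → Fin 2 → ℝ))).hasFDerivAt.comp_hasDerivAt 0 h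
    refine h1.unique ?_
    -- This component of the generator is quadratic in the jet, so along a line it has a linear term
    -- and an `s ^ 2` term; the latter does not contribute at `s = 0`.
    have h2 := ((hs.smul_const ((2 * dot g π (u.2 1)) • p.2 2 + (2 * dot g π (p.2 1)) • u.2 2 +
      dot g π (u.2 2) • p.2 1 + dot g π (p.2 2) • u.2 1 + rot g ρ (u.2 2))).const_add
      ((generator η g a₀ a π ρ p).2 2)).add (hs2.smul_const ((2 * dot g π (u.2 1)) • u.2 2 +
        dot g π (u.2 2) • u.2 1))
    rw [one_smul, zero_smul, add_zero] at h2
    refine h2.congr_of_eventuallyEq (Eventually.of_forall fun s => ?_)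
    simp only [generator, Prod.snd_add, Prod.smul_snd, Pi.add_apply, Pi.smul_apply, hd, hr,
      Matrix.cons_val]
    module

theorem dir_snd_apply (k : ℕ) (s s' : Fin (k + 1)) (j i : Fin 2) :
    (dir k s j).2 s' i = if s' = s then (if i = j then 1 else 0) else 0 := by
  simp only [dir, Pi.single_apply]
  split_ifs <;> simp_all

/-- A covector on `J²` in the coframe `dt, dx - v dt, dv - v' dt, dv'`. -/
theorem clm_coframe (p : Jet 2) (α : Jet 2 →L[ℝ] ℝ) :
    α = α (horizontal p) • dTime 2 + ∑ j, (α (dir 2 0 j) • theta₁ j p + α (dir 2 1 j) • theta₂ j p +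
      α (dir 2 2 j) • dCoord 2 2 j) := by
  -- The frame dual to the coframe: `∂_t + v ∂_x + v' ∂_v`, `∂_x`, `∂_v`, `∂_{v'}`.
  have hu (u : Jet 2) : u = u.1 • horizontal p + ∑ j, ((theta₁ j p u) • dir 2 0 j +
      (theta₂ j p u) • dir 2 1 j + (dCoord 2 2 j u) • dir 2 2 j) := by
    refine Prod.ext ?_ (funext fun s => funext fun i => ?_)
    · simp [horizontal, dir]
    · simp only [Prod.snd_add, Prod.smul_snd, Pi.add_apply, Pi.smul_apply, dir_snd_apply, Fin.sum_univ_two]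
      fin_cases s <;> fin_cases i <;> simp [horizontal, theta₁, theta₂, dCoord, dTime] <;>
        ring
  refine ContinuousLinearMap.ext fun u => ?_
  conv_lhs => rw [hu u]
  simp only [map_add, map_sum, map_smul, smul_eq_mul, add_apply, sum_apply, smul_apply]
  simp only [dTime, ContinuousLinearMap.coe_fst']
  rw [mul_comm]
  congr 1
  exact Finset.sum_congr rfl fun j _ => by ring

theorem theta_horizontal (p : Jet 2) (j : Fin 2) :
    theta₁ j p (horizontal p) = 0 ∧ theta₂ j p (horizontal p) = 0 := by
  simp [theta₁, theta₂, horizontal, dCoord, dTime]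

theorem theta_dir (p : Jet 2) (i j : Fin 2) :
    theta₁ j p (dir 2 2 i) = 0 ∧ theta₂ j p (dir 2 2 i) = 0 := by
  simp [theta₁, theta₂, dir, dCoord, dTime]

section

variable {Ω : Set (Jet 1)} {E : Jet 3 → Fin 2 → ℝ}

theorem IsVariational.leading_eq (hΩ : IsOpen Ω) (hE : ContDiffOn ℝ ∞ E {q | toOne q ∈ Ω})
    (hv : IsVariational Ω E) {q : Jet 3} (hq : toOne q ∈ Ω) (i j : Fin 2) :
    leading E q i j = leadCoeff E (toOne q) * turn (Pi.single j 1) i := by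
  rw [← toOne_truncate, toOne_eq_truncate, ← hv.skewCoeff_eq hΩ hE (r := truncate 2 q) hq]
  exact hv.partialE_last hΩ hE hq i j

theorem toOne_zeroLift (p : Jet 2) : toOne (zeroLift p) = toOne p := rfl

theorem IsVariational.pfaff_eq (hΩ : IsOpen Ω) (hE : ContDiffOn ℝ ∞ E {q | toOne q ∈ Ω})
    (hv : IsVariational Ω E) {p : Jet 2} (hp : toOne p ∈ Ω) (i : Fin 2) :
    pfaff E i p = ∑ j, (leadCoeff E (truncate 1 p) * turn (Pi.single j 1) i) • dCoord 2 2 j +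
      freeTerm E i p • dTime 2 := by
  rw [pfaff, freeTerm, ← zeroLift_eq, ← toOne_eq_truncate]
  simp only [hv.leading_eq hΩ hE (q := zeroLift p) hp, toOne_zeroLift]

/-- The Lie derivative of the Pfaff forms, evaluated on a vector. -/
theorem IsVariational.lieDeriv_pfaff_apply (hΩ : IsOpen Ω)
    (hE : ContDiffOn ℝ ∞ E {q | toOne q ∈ Ω}) (hv : IsVariational Ω E) {p : Jet 2}
    (hp : toOne p ∈ Ω) (i : Fin 2) {X : Jet 2 → Jet 2} (u : Jet 2) :
    lieDeriv X (pfaff E i) p u =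
      fderiv ℝ (leadCoeff E) (truncate 1 p) (truncate 1 (X p)) * turn (u.2 2) i +
      leadCoeff E (truncate 1 p) * turn ((fderiv ℝ X p u).2 2) i +
      fderiv ℝ (freeTerm E i) p (X p) * u.1 + freeTerm E i p * (fderiv ℝ X p u).1 := by
  have hev : pfaff E i =ᶠ[𝓝 p] fun p =>
      ∑ j, (leadCoeff E (truncate 1 p) * turn (Pi.single j 1) i) • dCoord 2 2 j +
        freeTerm E i p • dTime 2 := by
    filter_upwards [eventually_over hΩ hp] with p' hp'
    exact hv.pfaff_eq hΩ hE hp' i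
  have h1 : HasFDerivAt (fun p => leadCoeff E (truncate 1 p))
      ((fderiv ℝ (leadCoeff E) (truncate 1 p)).comp (truncate 1)) p :=
    ((contDiffAt_leadCoeff hΩ hE (by rwa [← toOne_eq_truncate])).differentiableAt
      (by simp)).hasFDerivAt.comp p (truncate 1).hasFDerivAt
  have h2 := ((contDiffAt_freeTerm hΩ hE i hp).differentiableAt (by simp)).hasFDerivAt
  have h3 := (HasFDerivAt.fun_sum (u := Finset.univ) fun j _ =>
    (h1.mul_const (turn (Pi.single j 1) i)).smul_const (dCoord 2 2 j)).add
      (h2.smul_const (dTime 2))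
  have hturn (y : Fin 2 → ℝ) : turn y i = ∑ j, turn (Pi.single j 1) i * y j := by
    fin_cases i <;> simp [Fin.sum_univ_two]
  rw [lieDeriv, (hev.hasFDerivAt_iff.2 h3).fderiv, hv.pfaff_eq hΩ hE hp, hturn (u.2 2),
    hturn ((fderiv ℝ X p u).2 2)]
  simp [dCoord, dTime, Fin.sum_univ_two]
  ring

/-- The matrix `2 (π · v) + v ⊗ π + R` of the action of an infinitesimal transformation on
differentials of `v'`. -/
def actionMatrix (g π v : Fin 2 → ℝ) (ρ : ℝ) (w : Fin 2 → ℝ) : Fin 2 → ℝ :=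
  (2 * dot g π v) • w + dot g π w • v + rot g ρ w

theorem IsVariational.lieDeriv_pfaff_dir (hΩ : IsOpen Ω)
    (hE : ContDiffOn ℝ ∞ E {q | toOne q ∈ Ω}) (hv : IsVariational Ω E) {p : Jet 2}
    (hp : toOne p ∈ Ω) (i j : Fin 2) (η : ℝ) (g : Fin 2 → ℝ) (a₀ : ℝ) (a π : Fin 2 → ℝ) (ρ : ℝ) :
    lieDeriv (generator η g a₀ a π ρ) (pfaff E i) p (dir 2 2 j) =
      fderiv ℝ (leadCoeff E) (truncate 1 p) (truncate 1 (generator η g a₀ a π ρ p)) *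
        turn (Pi.single j 1) i +
      leadCoeff E (truncate 1 p) * turn (actionMatrix g π (p.2 1) ρ (Pi.single j 1)) i := by
  obtain ⟨h1, h2⟩ := fderiv_generator η g a₀ a π ρ p (dir 2 2 j)
  have d0 : (dir 2 2 j).2 0 = 0 := by ext; simp [dir_snd_apply]
  have d1 : (dir 2 2 j).2 1 = 0 := by ext; simp [dir_snd_apply]
  have d2 : (dir 2 2 j).2 2 = Pi.single j 1 := by ext; simp [dir_snd_apply, Pi.single_apply]
  have z : dot g π 0 = 0 := by simp [dot]
  rw [hv.lieDeriv_pfaff_apply hΩ hE hp, h1, h2, d0, d1, d2, z]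
  simp only [actionMatrix, dir]
  simp

theorem IsVariational.lieDeriv_pfaff_horizontal (hΩ : IsOpen Ω)
    (hE : ContDiffOn ℝ ∞ E {q | toOne q ∈ Ω}) (hv : IsVariational Ω E) {p : Jet 2}
    (hp : toOne p ∈ Ω) (i : Fin 2) (η : ℝ) (g : Fin 2 → ℝ) (a₀ : ℝ) (a π : Fin 2 → ℝ) (ρ : ℝ) :
    lieDeriv (generator η g a₀ a π ρ) (pfaff E i) p (horizontal p) =
      fderiv ℝ (freeTerm E i) p (generator η g a₀ a π ρ p) +
        3 * leadCoeff E (truncate 1 p) * dot g π (p.2 2) * turn (p.2 2) i -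
        dot g π (p.2 1) * freeTerm E i p := by
  obtain ⟨h1, h2⟩ := fderiv_generator η g a₀ a π ρ p (horizontal p)
  have d0 : (horizontal p).2 0 = p.2 1 := rfl
  have d1 : (horizontal p).2 1 = p.2 2 := rfl
  have d2 : (horizontal p).2 2 = 0 := rfl
  have dt : (horizontal p).1 = 1 := rfl
  have z : dot g π 0 = 0 := by simp [dot]
  have zr : rot g ρ 0 = 0 := by ext i; fin_cases i <;> simp [rot]
  rw [hv.lieDeriv_pfaff_apply hΩ hE hp, h1, h2, d0, d1, d2, dt, z, zr]
  simp only [map_add, map_smul, map_zero, Pi.add_apply, Pi.smul_apply, smul_eq_mul, smul_zero,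
    zero_smul, Pi.zero_apply]
  ring

/-- The reduced invariance equations at a second-order jet. -/
def ReducedInvariance (E : Jet 3 → Fin 2 → ℝ) (η : ℝ) (g : Fin 2 → ℝ) (a₀ : ℝ) (a π : Fin 2 → ℝ)
    (ρ : ℝ) (p : Jet 2) : Prop :=
  ∃ Φ : Matrix (Fin 2) (Fin 2) ℝ, ∀ i,
    (∀ j, lieDeriv (generator η g a₀ a π ρ) (pfaff E i) p (dir 2 2 j) =
      leadCoeff E (truncate 1 p) * ∑ l, Φ i l * turn (Pi.single j 1) l) ∧
    lieDeriv (generator η g a₀ a π ρ) (pfaff E i) p (horizontal p) = ∑ l, Φ i l * freeTerm E l p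

/-- The matrices `Ξ` and `Ψ` are arbitrary, so the contact components of the Lie derivative carry no
condition. Only its values on `∂_{v'}` and on the horizontal vector remain, and the condition
becomes pointwise. -/
theorem IsVariational.isInvariant_iff (hΩ : IsOpen Ω)
    (hE : ContDiffOn ℝ ∞ E {q | toOne q ∈ Ω}) (hv : IsVariational Ω E) (η : ℝ) (g : Fin 2 → ℝ) :
    IsInvariant η g Ω E ↔ ∀ a₀ a π ρ, ∀ p : Jet 2, toOne p ∈ Ω →
      ReducedInvariance E η g a₀ a π ρ p := by
  have pdir {p : Jet 2} (hp : toOne p ∈ Ω) (l j : Fin 2) : pfaff E l p (dir 2 2 j) =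
      leadCoeff E (truncate 1 p) * turn (Pi.single j 1) l := by
    rw [hv.pfaff_eq hΩ hE hp]
    simp only [add_apply, smul_apply, sum_apply, dCoord, dTime]
    fin_cases j <;> simp [Fin.sum_univ_two, dir]
  have phor {p : Jet 2} (hp : toOne p ∈ Ω) (l : Fin 2) : pfaff E l p (horizontal p) =
      freeTerm E l p := by
    rw [hv.pfaff_eq hΩ hE hp]
    simp [dCoord, dTime, horizontal]
  have pd0 {p : Jet 2} (hp : toOne p ∈ Ω) (l : Fin 2) : pfaff E l p =
      ∑ j, (leadCoeff E (truncate 1 p) * turn (Pi.single j 1) l) • dCoord 2 2 j +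
        freeTerm E l p • dTime 2 := hv.pfaff_eq hΩ hE hp l
  constructor
  · intro h a₀ a π ρ p hp
    obtain ⟨Φ, Ξ, Ψ, h⟩ := h a₀ a π ρ
    refine ⟨Φ p, fun i => ⟨fun j => ?_, ?_⟩⟩
    · rw [h p hp i]
      simp [pdir hp, (theta_dir p j _).1, (theta_dir p j _).2, Fin.sum_univ_two]
      ring
    · rw [h p hp i]
      simp [phor hp, (theta_horizontal p _).1, (theta_horizontal p _).2]
  · intro h a₀ a π ρ
    have h' : ∀ p : Jet 2, ∃ Φ : Matrix (Fin 2) (Fin 2) ℝ, toOne p ∈ Ω → ∀ i,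
        (∀ j, lieDeriv (generator η g a₀ a π ρ) (pfaff E i) p (dir 2 2 j) =
          leadCoeff E (truncate 1 p) * ∑ l, Φ i l * turn (Pi.single j 1) l) ∧
        lieDeriv (generator η g a₀ a π ρ) (pfaff E i) p (horizontal p) =
          ∑ l, Φ i l * freeTerm E l p := by
      intro p
      by_cases hp : toOne p ∈ Ω
      · obtain ⟨Φ, hΦ⟩ := h a₀ a π ρ p hp
        exact ⟨Φ, fun _ => hΦ⟩
      · exact ⟨0, fun hp' => absurd hp' hp⟩
    choose Φ hΦ using h'
    refine ⟨Φ, fun p i j => lieDeriv (generator η g a₀ a π ρ) (pfaff E i) p (dir 2 0 j),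
      fun p i j => lieDeriv (generator η g a₀ a π ρ) (pfaff E i) p (dir 2 1 j), fun p hp i => ?_⟩
    obtain ⟨h1, h2⟩ := hΦ p hp i
    conv_lhs => rw [clm_coframe p (lieDeriv (generator η g a₀ a π ρ) (pfaff E i) p)]
    rw [h2]
    simp only [h1, pd0 hp]
    simp only [Fin.sum_univ_two]
    module

theorem turn_actionMatrix_single (g π v : Fin 2 → ℝ) (ρ : ℝ) (j : Fin 2) (i : Fin 2) :
    turn (actionMatrix g π v ρ (Pi.single j 1)) i =
      if i = 0 then actionMatrix g π v ρ (Pi.single j 1) 1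
      else -actionMatrix g π v ρ (Pi.single j 1) 0 := by
  fin_cases i <;> simp

/-- The adjugate of the action matrix. -/
def adjAction (g π v : Fin 2 → ℝ) (ρ : ℝ) (k : Fin 2 → ℝ) : Fin 2 → ℝ :=
  ![actionMatrix g π v ρ (Pi.single 1 1) 1 * k 0 - actionMatrix g π v ρ (Pi.single 0 1) 1 * k 1,
    -actionMatrix g π v ρ (Pi.single 1 1) 0 * k 0 + actionMatrix g π v ρ (Pi.single 0 1) 0 * k 1]

/-- The leading matrix `A J` is invertible, so the `dv'` components force `Φ = XA / A + J M J⁻¹`,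
where `M` is the action matrix; `J M J⁻¹` is its cofactor matrix, which is how `adjAction` arises.
The equations are the `dt` components with this `Φ`, multiplied by `A`. -/
theorem IsVariational.reducedInvariance_iff (hΩ : IsOpen Ω)
    (hE : ContDiffOn ℝ ∞ E {q | toOne q ∈ Ω}) (hv : IsVariational Ω E) {p : Jet 2}
    (hp : toOne p ∈ Ω) (hA : leadCoeff E (truncate 1 p) ≠ 0)
    (η : ℝ) (g : Fin 2 → ℝ) (a₀ : ℝ) (a π : Fin 2 → ℝ) (ρ : ℝ) :
    ReducedInvariance E η g a₀ a π ρ p ↔ ∀ i,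
      leadCoeff E (truncate 1 p) * (fderiv ℝ (freeTerm E i) p (generator η g a₀ a π ρ p) +
        3 * leadCoeff E (truncate 1 p) * dot g π (p.2 2) * turn (p.2 2) i -
        dot g π (p.2 1) * freeTerm E i p) =
      fderiv ℝ (leadCoeff E) (truncate 1 p) (truncate 1 (generator η g a₀ a π ρ p)) *
        freeTerm E i p +
      leadCoeff E (truncate 1 p) * adjAction g π (p.2 1) ρ (fun i => freeTerm E i p) i := by
  simp only [ReducedInvariance, hv.lieDeriv_pfaff_dir hΩ hE hp,
    hv.lieDeriv_pfaff_horizontal hΩ hE hp, turn_actionMatrix_single]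
  set A := leadCoeff E (truncate 1 p)
  set XA := fderiv ℝ (leadCoeff E) (truncate 1 p) (truncate 1 (generator η g a₀ a π ρ p))
  set M : Fin 2 → Fin 2 → ℝ := fun l j => actionMatrix g π (p.2 1) ρ (Pi.single j 1) l with hM
  have hM' (l j : Fin 2) : actionMatrix g π (p.2 1) ρ (Pi.single j 1) l = M l j := rfl
  simp only [hM', adjAction]
  constructor
  · rintro ⟨Φ, h⟩ i
    have e00 := (h 0).1 0
    have e01 := (h 0).1 1
    have e10 := (h 1).1 0
    have e11 := (h 1).1 1
    rw [(h i).2]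
    simp [Fin.sum_univ_two] at e00 e01 e10 e11
    fin_cases i
    · simp [Fin.sum_univ_two]
      linear_combination (-freeTerm E 0 p) * e01 + freeTerm E 1 p * e00
    · simp [Fin.sum_univ_two]
      linear_combination (-freeTerm E 0 p) * e11 + freeTerm E 1 p * e10
  · intro h
    refine ⟨!![XA / A + M 1 1, -M 1 0; -M 0 1, XA / A + M 0 0], fun i => ⟨fun j => ?_, ?_⟩⟩
    · fin_cases i <;> fin_cases j <;> simp [Fin.sum_univ_two] <;> field_simp <;> ring
    · refine mul_left_cancel₀ hA ?_
      rw [h i]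
      fin_cases i <;> simp [Fin.sum_univ_two] <;> field_simp <;> ring

theorem contDiffAt_leadGrad (hΩ : IsOpen Ω) (hE : ContDiffOn ℝ ∞ E {q | toOne q ∈ Ω})
    {p : Jet 1} (hp : p ∈ Ω) (w : Fin 2 → ℝ) : ContDiffAt ℝ ∞ (fun p => leadGrad E p w) p :=
  contDiffAt_fderiv_apply (contDiffAt_leadCoeff hΩ hE hp) _

theorem IsVariational.fderiv_freeTerm (hΩ : IsOpen Ω) (hE : ContDiffOn ℝ ∞ E {q | toOne q ∈ Ω})
    (hv : IsVariational Ω E) {r : Jet 2} (hr : toOne r ∈ Ω) (i : Fin 2) (u : Jet 2) :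
    fderiv ℝ (freeTerm E i) r u =
      (∑ l, fderiv ℝ (fun p => leadGrad E p (Pi.single l 1)) (truncate 1 r) (truncate 1 u) *
        r.2 2 l) * turn (r.2 2) i +
      leadGrad E (truncate 1 r) (u.2 2) * turn (r.2 2) i +
      leadGrad E (truncate 1 r) (r.2 2) * turn (u.2 2) i +
      ∑ j, (fderiv ℝ (fun p => linearTerm E p i j) (truncate 1 r) (truncate 1 u) * r.2 2 j +
        linearTerm E (truncate 1 r) i j * u.2 2 j) +
      fderiv ℝ (fun p => constTerm E p i) (truncate 1 r) (truncate 1 u) := by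
  have hev : freeTerm E i =ᶠ[𝓝 r] fun r =>
      (∑ l, leadGrad E (truncate 1 r) (Pi.single l 1) * r.2 2 l) * turn (r.2 2) i +
      ∑ j, linearTerm E (truncate 1 r) i j * r.2 2 j + constTerm E (truncate 1 r) i := by
    filter_upwards [eventually_over hΩ hr] with r' hr'
    rw [hv.freeTerm_eq hΩ hE hr', leadGrad_eq, Fin.sum_univ_two, toOne_eq_truncate]
    simp only [Fin.sum_univ_two]
  have hp : truncate 1 r ∈ Ω := by rwa [← toOne_eq_truncate]
  have hcomp {f : Jet 1 → ℝ} (hf : ContDiffAt ℝ ∞ f (truncate 1 r)) :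
      HasFDerivAt (fun r => f (truncate 1 r)) ((fderiv ℝ f (truncate 1 r)).comp (truncate 1)) r :=
    (hf.differentiableAt (by simp)).hasFDerivAt.comp r (truncate 1).hasFDerivAt
  have hw (j : Fin 2) : HasFDerivAt (fun r : Jet 2 => r.2 2 j) (dCoord 2 2 j) r :=
    (dCoord 2 2 j).hasFDerivAt
  let m : Jet 2 →L[ℝ] ℝ := (ContinuousLinearMap.proj (R := ℝ) (φ := fun _ : Fin 2 => ℝ) i).comp
    (turn.comp ((ContinuousLinearMap.proj (R := ℝ) (φ := fun _ : Fin 3 => Fin 2 → ℝ) 2).comp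
      (ContinuousLinearMap.snd ℝ ℝ _)))
  have hm : HasFDerivAt (fun r : Jet 2 => turn (r.2 2) i) m r := m.hasFDerivAt
  have h := (((HasFDerivAt.fun_sum (u := Finset.univ) fun l _ =>
    (hcomp (contDiffAt_leadGrad hΩ hE hp (Pi.single l 1))).mul (hw l)).mul hm).add
    (HasFDerivAt.fun_sum (u := Finset.univ) fun j _ =>
      (hcomp (contDiffAt_linearTerm hΩ hE hp i j)).mul (hw j))).add
    (hcomp (contDiffAt_constTerm hΩ hE hp i))
  rw [(hev.hasFDerivAt_iff.2 h).fderiv, leadGrad_eq _ (u.2 2), leadGrad_eq _ (r.2 2)]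
  simp [dCoord, Fin.sum_univ_two, m]
  ring

/-- The infinitesimal (pseudo)Euclidean transformation prolonged to `J¹`. -/
def generatorOne (η : ℝ) (g : Fin 2 → ℝ) (a₀ : ℝ) (a π : Fin 2 → ℝ) (ρ : ℝ) (p : Jet 1) : Jet 1 :=
  (a₀ - dot g π (p.2 0), ![a + (η * p.1) • π + rot g ρ (p.2 0),
    η • π + dot g π (p.2 1) • p.2 1 + rot g ρ (p.2 1)])

theorem truncate_generator (η : ℝ) (g : Fin 2 → ℝ) (a₀ : ℝ) (a π : Fin 2 → ℝ) (ρ : ℝ) (r : Jet 2) :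
    truncate 1 (generator η g a₀ a π ρ r) = generatorOne η g a₀ a π ρ (truncate 1 r) :=
  Prod.ext rfl (funext fun s => by fin_cases s <;> rfl)

theorem generator_last (η : ℝ) (g : Fin 2 → ℝ) (a₀ : ℝ) (a π : Fin 2 → ℝ) (ρ : ℝ) (r : Jet 2) :
    (generator η g a₀ a π ρ r).2 2 = actionMatrix g π (r.2 1) ρ (r.2 2) := rfl

/-- The invariance equations as equations between polynomials in `v'`. -/
theorem IsInvariant.polynomial_eq (hΩ : IsOpen Ω)
    (hE : ContDiffOn ℝ ∞ E {q | toOne q ∈ Ω}) (hv : IsVariational Ω E) {η : ℝ} {g : Fin 2 → ℝ}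
    (hi : IsInvariant η g Ω E) {p : Jet 1} (hp : p ∈ Ω) (hA : leadCoeff E p ≠ 0)
    (a₀ : ℝ) (a π : Fin 2 → ℝ) (ρ : ℝ) (w : Fin 2 → ℝ) (i : Fin 2) :
    let X := generatorOne η g a₀ a π ρ p
    let K : Fin 2 → ℝ := fun i => leadGrad E p w * turn w i + ∑ j, linearTerm E p i j * w j +
      constTerm E p i
    leadCoeff E p *
      ((∑ l, fderiv ℝ (fun p => leadGrad E p (Pi.single l 1)) p X * w l) * turn w i +
      leadGrad E p (actionMatrix g π (p.2 1) ρ w) * turn w i +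
      leadGrad E p w * turn (actionMatrix g π (p.2 1) ρ w) i +
      ∑ j, (fderiv ℝ (fun p => linearTerm E p i j) p X * w j +
        linearTerm E p i j * actionMatrix g π (p.2 1) ρ w j) +
      fderiv ℝ (fun p => constTerm E p i) p X + 3 * leadCoeff E p * dot g π w * turn w i -
      dot g π (p.2 1) * K i) =
    fderiv ℝ (leadCoeff E) p X * K i + leadCoeff E p * adjAction g π (p.2 1) ρ K i := by
  intro X K
  set r := zeroSection 1 p + vert 2 w with hr
  have hrp : truncate 1 r = p := truncate_zeroSection_add_vert 1 p w
  have hrp' : toOne r = p := by rw [toOne_eq_truncate, hrp]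
  have hrw : r.2 2 = w := zeroSection_add_vert_last 1 p w
  have hrv : r.2 1 = p.2 1 := by rw [← hrp]; rfl
  have hrΩ : toOne r ∈ Ω := by rwa [hrp']
  have h := (hv.reducedInvariance_iff hΩ hE hrΩ (by rwa [hrp]) η g a₀ a π ρ).1
    ((hv.isInvariant_iff hΩ hE η g).1 hi a₀ a π ρ r hrΩ) i
  have hK (i : Fin 2) : freeTerm E i r = K i := by rw [hv.freeTerm_eq hΩ hE hrΩ, hrp', hrw]
  rw [hv.fderiv_freeTerm hΩ hE hrΩ, generator_last, truncate_generator] at h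
  simp only [hK, hrp, hrw, hrv] at h
  exact h

theorem actionMatrix_eq (g π v : Fin 2 → ℝ) (ρ : ℝ) (w : Fin 2 → ℝ) (l : Fin 2) :
    actionMatrix g π v ρ w l = actionMatrix g π v ρ (Pi.single 0 1) l * w 0 +
      actionMatrix g π v ρ (Pi.single 1 1) l * w 1 := by
  fin_cases l <;> simp [actionMatrix, dot, rot, Fin.sum_univ_two] <;> ring

/-- The invariance equations sorted by powers of `v'`. -/
theorem IsInvariant.graded_eq (hΩ : IsOpen Ω)
    (hE : ContDiffOn ℝ ∞ E {q | toOne q ∈ Ω}) (hv : IsVariational Ω E) {η : ℝ} {g : Fin 2 → ℝ}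
    (hi : IsInvariant η g Ω E) {p : Jet 1} (hp : p ∈ Ω) (hA : leadCoeff E p ≠ 0)
    (a₀ : ℝ) (a π : Fin 2 → ℝ) (ρ : ℝ) :
    let X := generatorOne η g a₀ a π ρ p
    let M : Fin 2 → Fin 2 → ℝ := fun l j => actionMatrix g π (p.2 1) ρ (Pi.single j 1) l
    let A := leadCoeff E p
    let XA := fderiv ℝ (leadCoeff E) p X
    let B := linearTerm E p
    (∀ i, A * (fderiv ℝ (fun p => constTerm E p i) p X - dot g π (p.2 1) * constTerm E p i) =
      XA * constTerm E p i + A * ![M 1 1 * constTerm E p 0 - M 1 0 * constTerm E p 1,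
        -M 0 1 * constTerm E p 0 + M 0 0 * constTerm E p 1] i) ∧
    (∀ i j, A * (fderiv ℝ (fun p => linearTerm E p i j) p X + (B i 0 * M 0 j + B i 1 * M 1 j) -
      dot g π (p.2 1) * B i j) = XA * B i j +
        A * ![M 1 1 * B 0 j - M 1 0 * B 1 j, -M 0 1 * B 0 j + M 0 0 * B 1 j] i) ∧
    (∀ j, A * (fderiv ℝ (fun p => leadGrad E p (Pi.single j 1)) p X +
      (leadGrad E p (Pi.single 0 1) * M 0 j + leadGrad E p (Pi.single 1 1) * M 1 j) +
      3 * A * (g j * π j) - dot g π (p.2 1) * leadGrad E p (Pi.single j 1)) =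
        XA * leadGrad E p (Pi.single j 1)) := by
  intro X M A XA B
  have h := hi.polynomial_eq hΩ hE hv hp hA a₀ a π ρ
  have hM (w : Fin 2 → ℝ) (l : Fin 2) : actionMatrix g π (p.2 1) ρ w l =
      M l 0 * w 0 + M l 1 * w 1 := actionMatrix_eq g π (p.2 1) ρ w l
  have hM' (l j : Fin 2) : actionMatrix g π (p.2 1) ρ (Pi.single j 1) l = M l j := rfl
  have hπ (w : Fin 2 → ℝ) : dot g π w = g 0 * π 0 * w 0 + g 1 * π 1 * w 1 := by
    simp [dot, Fin.sum_univ_two]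
  have hG := leadGrad_eq (E := E) p
  set πv := dot g π (p.2 1)
  have hX : generatorOne η g a₀ a π ρ p = X := rfl
  simp only [hX] at h
  have hA' : leadCoeff E p = A := rfl
  have hXA : fderiv ℝ (leadCoeff E) p X = XA := rfl
  have hB (i j : Fin 2) : linearTerm E p i j = B i j := rfl
  obtain ⟨G, hG'⟩ : ∃ G : Fin 2 → ℝ, ∀ l, leadGrad E p (Pi.single l 1) = G l := ⟨_, fun _ => rfl⟩
  obtain ⟨DG, hDG⟩ : ∃ DG : Fin 2 → ℝ, ∀ l,
      fderiv ℝ (fun p => leadGrad E p (Pi.single l 1)) p X = DG l := ⟨_, fun _ => rfl⟩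
  obtain ⟨C, hC⟩ : ∃ C : Fin 2 → ℝ, ∀ l, constTerm E p l = C l := ⟨_, fun _ => rfl⟩
  obtain ⟨DC, hDC⟩ : ∃ DC : Fin 2 → ℝ, ∀ l, fderiv ℝ (fun p => constTerm E p l) p X = DC l :=
    ⟨_, fun _ => rfl⟩
  obtain ⟨DB, hDB⟩ : ∃ DB : Fin 2 → Fin 2 → ℝ, ∀ i j,
      fderiv ℝ (fun p => linearTerm E p i j) p X = DB i j := ⟨_, fun _ _ => rfl⟩
  simp only [hG'] at hG
  have hGM (w : Fin 2 → ℝ) : leadGrad E p (actionMatrix g π (p.2 1) ρ w) =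
      G 0 * (M 0 0 * w 0 + M 0 1 * w 1) + G 1 * (M 1 0 * w 0 + M 1 1 * w 1) := by
    rw [hG, hM, hM]
  simp only [hGM, hDG, hDC, hDB, hC, hB, hA', hXA, adjAction, hM', hπ] at h
  simp only [hG, hM, Fin.sum_univ_two] at h
  simp only [hG', hDG, hDC, hDB, hC]
  have h0 (w) := h w 0
  have h1 (w) := h w 1
  simp only [turn_zero, turn_one, hM, Matrix.cons_val_zero, Matrix.cons_val_one] at h0 h1
  -- Both sides have degree two in `w`, so the values at `0` and at plus or minus the basis vectors
  -- separate the degrees. The terms with `turn` of the action matrix cancel in degree two, leaving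
  -- a linear form times `turn w`; pure squares already determine that form.
  have z0 := h0 0
  have z1 := h1 0
  have p00 := h0 (Pi.single 0 1)
  have p01 := h0 (Pi.single 1 1)
  have p10 := h1 (Pi.single 0 1)
  have p11 := h1 (Pi.single 1 1)
  have m00 := h0 (-Pi.single 0 1)
  have m01 := h0 (-Pi.single 1 1)
  have m10 := h1 (-Pi.single 0 1)
  have m11 := h1 (-Pi.single 1 1)
  clear h h0 h1 hG hM hGM hπ
  simp only [Pi.single_eq_same, ne_eq, one_ne_zero, zero_ne_one, Pi.neg_apply, Pi.zero_apply,
      not_false_eq_true, Pi.single_eq_of_ne] at *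
  refine ⟨fun i => ?_, fun i j => ?_, fun j => ?_⟩
  · fin_cases i
    · simp only [Fin.zero_eta, Matrix.cons_val_zero]
      linear_combination z0
    · simp only [Fin.mk_one, Matrix.cons_val_one, Matrix.cons_val_fin_one]
      linear_combination z1
  · fin_cases i <;> fin_cases j
    · simp only [Fin.zero_eta, Matrix.cons_val_zero]
      linear_combination (p00 - m00) / 2
    · simp only [Fin.zero_eta, Fin.mk_one, Matrix.cons_val_zero]
      linear_combination (p01 - m01) / 2
    · simp only [Fin.zero_eta, Fin.mk_one, Matrix.cons_val_one, Matrix.cons_val_fin_one]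
      linear_combination (p10 - m10) / 2
    · simp only [Fin.mk_one, Matrix.cons_val_one, Matrix.cons_val_fin_one]
      linear_combination (p11 - m11) / 2
  · fin_cases j
    · simp only [Fin.zero_eta]
      linear_combination -(p10 + m10) / 2 + z1
    · simp only [Fin.mk_one]
      linear_combination (p01 + m01) / 2 - z0

end

/-! ### Isotropy, transitivity and invariant ratios -/

section

variable {Ω : Set (Jet 1)} {E : Jet 3 → Fin 2 → ℝ} {η : ℝ} {g : Fin 2 → ℝ}

theorem sq_eq_one_of_sign {x : ℝ} (h : x = 1 ∨ x = -1) : x ^ 2 = 1 := by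
  rcases h with h | h <;> simp [h]

/-- The infinitesimal rotation that fixes a first-order contact element. -/
theorem exists_isotropy (hη : η ^ 2 = 1) (p : Jet 1) :
    ∃ a₀ a π ρ, generatorOne η g a₀ a π ρ p = 0 ∧ dot g π (p.2 1) = 0 ∧
      (∀ j, g j * π j = ![η * g 0 * g 1 * p.2 1 1, -(η * g 0 * g 1 * p.2 1 0)] j) ∧
      actionMatrix g π (p.2 1) ρ (Pi.single 0 1) 0 = η * g 0 * g 1 * p.2 1 0 * p.2 1 1 ∧
      actionMatrix g π (p.2 1) ρ (Pi.single 1 1) 0 = -(g 1 * (1 + η * g 0 * p.2 1 0 ^ 2)) ∧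
      actionMatrix g π (p.2 1) ρ (Pi.single 0 1) 1 = g 0 * (1 + η * g 1 * p.2 1 1 ^ 2) ∧
      actionMatrix g π (p.2 1) ρ (Pi.single 1 1) 1 = -(η * g 0 * g 1 * p.2 1 0 * p.2 1 1) := by
  -- With `ρ = 1` this is `π = -η rot v`. As `rot v` is orthogonal to `v`, the term `(π · v) v`
  -- drops out and `η π + rot v = 0`; translations then cancel the motion of `(t, x)`.
  set π : Fin 2 → ℝ := ![η * g 1 * p.2 1 1, -(η * g 0 * p.2 1 0)] with hπ
  have hd : dot g π (p.2 1) = 0 := by simp [dot, hπ, Fin.sum_univ_two]; ring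
  refine ⟨dot g π (p.2 0), -((η * p.1) • π + rot g 1 (p.2 0)), π, 1, ?_, hd, fun j => ?_,
    ?_, ?_, ?_, ?_⟩
  · refine Prod.ext (by simp [generatorOne]) (funext fun s => funext fun i => ?_)
    simp only [generatorOne, hd]
    fin_cases s <;> fin_cases i
    · simp
    · simp
    · simp [hπ, rot]
      linear_combination (g 1 * p.2 1 1) * hη
    · simp [hπ, rot]
      linear_combination -(g 0 * p.2 1 0) * hη
  · fin_cases j <;> simp [hπ] <;> ring
  all_goals
    simp [actionMatrix, rot, dot, hπ, Fin.sum_univ_two]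
    ring

theorem speedSq_eq (v : Fin 2 → ℝ) : speedSq η g v = 1 + η * (g 0 * v 0 ^ 2 + g 1 * v 1 ^ 2) := by
  simp only [speedSq, dot, Fin.sum_univ_two]; ring

/-- The consequences of invariance under the isotropy group of a contact element. -/
theorem IsInvariant.isotropy_eq (hΩ : IsOpen Ω)
    (hE : ContDiffOn ℝ ∞ E {q | toOne q ∈ Ω}) (hv : IsVariational Ω E)
    (hη : η ^ 2 = 1) (hg : ∀ i, g i ^ 2 = 1)
    (hi : IsInvariant η g Ω E) {p : Jet 1} (hp : p ∈ Ω) (hA : leadCoeff E p ≠ 0)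
    (hN : 0 < speedSq η g (p.2 1)) :
    let N := speedSq η g (p.2 1)
    let T := g 0 * linearTerm E p 0 0 + g 1 * linearTerm E p 1 1
    (∀ i, constTerm E p i = 0) ∧
    (∀ i, N * leadGrad E p (Pi.single i 1) = -3 * η * g i * p.2 1 i * leadCoeff E p) ∧
    (N + 1) * linearTerm E p 0 0 = T * (g 0 * (1 + η * g 1 * p.2 1 1 ^ 2)) ∧
    (N + 1) * linearTerm E p 1 1 = T * (g 1 * (1 + η * g 0 * p.2 1 0 ^ 2)) ∧
    (N + 1) * (linearTerm E p 0 1 + linearTerm E p 1 0) =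
      T * (-2 * η * g 0 * g 1 * p.2 1 0 * p.2 1 1) := by
  intro N T
  obtain ⟨a₀, a, π, ρ, hX, hd, hπ, m00, m01, m10, m11⟩ := exists_isotropy (g := g) hη p
  obtain ⟨h0, h1, h2⟩ := hi.graded_eq hΩ hE hv hp hA a₀ a π ρ
  simp only [hX, map_zero, zero_mul, zero_add, sub_zero, hd, m00, m01, m10, m11, mul_zero] at h0 h1 h2
  have cancel {x y : ℝ} (h : leadCoeff E p * x = leadCoeff E p * y) : x = y := mul_left_cancel₀ hA h
  have k0 := cancel ((mul_zero _).trans (h0 0))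
  have k1 := cancel ((mul_zero _).trans (h0 1))
  have b00 := cancel (h1 0 0)
  have b01 := cancel (h1 0 1)
  have b10 := cancel (h1 1 0)
  have b11 := cancel (h1 1 1)
  have l0 := cancel ((h2 0).trans (mul_zero _).symm)
  have l1 := cancel ((h2 1).trans (mul_zero _).symm)
  have g0 := hg 0
  have g1 := hg 1
  simp only [mul_assoc (3 : ℝ), hπ] at l0 l1
  simp only [Matrix.cons_val_zero, Matrix.cons_val_one, Matrix.cons_val_fin_one] at *
  have hNe : N = 1 + η * (g 0 * p.2 1 0 ^ 2 + g 1 * p.2 1 1 ^ 2) := speedSq_eq _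
  have hN' : N ≠ 0 := hN.ne'
  have hN1 : N + 1 ≠ 0 := by positivity
  have hT : T = g 0 * linearTerm E p 0 0 + g 1 * linearTerm E p 1 1 := rfl
  clear_value T
  generalize linearTerm E p 0 0 = B00 at *
  generalize linearTerm E p 0 1 = B01 at *
  generalize linearTerm E p 1 0 = B10 at *
  generalize linearTerm E p 1 1 = B11 at *
  generalize hG0 : leadGrad E p (Pi.single 0 1) = G0 at *
  generalize hG1 : leadGrad E p (Pi.single 1 1) = G1 at *
  generalize constTerm E p = C at *
  clear_value N
  generalize hx : p.2 1 0 = x at *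
  generalize hy : p.2 1 1 = y at *
  -- `P`, `Q`, `-s` are the coefficients of the form `N g(w, w) - η (v·w)²`, which the isotropy
  -- rotation preserves. Its determinant `g₀ g₁ N` is non-zero, so the linear systems for `C` and
  -- for the gradient of `A` have unique solutions; its trace against `g` is `N + 1`, the
  -- normalization of `T`.
  set P := g 0 * (1 + η * g 1 * y ^ 2) with hP
  set Q := g 1 * (1 + η * g 0 * x ^ 2) with hQ
  set s := η * g 0 * g 1 * x * y with hs
  have hPQ : N + 1 = g 0 * P + g 1 * Q := by
    rw [hNe, hP, hQ]
    linear_combination -(1 + η * g 1 * y ^ 2) * g0 - (1 + η * g 0 * x ^ 2) * g1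
  have hdet : P * Q - s ^ 2 = g 0 * g 1 * N := by rw [hNe, hP, hQ, hs]; ring
  have hgg : g 0 * g 1 ≠ 0 := fun h => by
    have : (g 0 * g 1) ^ 2 = 1 := by rw [mul_pow, g0, g1, one_mul]
    rw [h] at this
    norm_num at this
  have hP' : P * x - s * y = g 0 * x := by rw [hP, hs]; ring
  have hQ' : Q * y - s * x = g 1 * y := by rw [hQ, hs]; ring
  clear_value P Q s
  rw [m00, m10] at b00 b10 l0
  rw [m01, m11] at b01 b11 l1
  refine ⟨fun i => ?_, fun i => ?_, ?_, ?_, ?_⟩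
  · refine mul_left_cancel₀ (mul_ne_zero hgg hN') ?_
    fin_cases i
    · simp only [Fin.zero_eta]
      linear_combination -P * k1 - s * k0 - C 0 * hdet
    · simp only [Fin.mk_one]
      linear_combination Q * k0 + s * k1 - C 1 * hdet
  · refine mul_left_cancel₀ hgg ?_
    fin_cases i
    · simp only [Fin.zero_eta, hG0, hx]
      linear_combination -s * l0 - P * l1 - G0 * hdet - 3 * η * g 0 * g 1 * leadCoeff E p * hP'
    · simp only [Fin.mk_one, hG1, hy]
      linear_combination Q * l0 + s * l1 - G1 * hdet - 3 * η * g 0 * g 1 * leadCoeff E p * hQ'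
  · rw [hPQ, hT]
    linear_combination -g 1 * b01
  · rw [hPQ, hT]
    linear_combination g 0 * b01
  · rw [hPQ, hT]
    linear_combination g 0 * b00 - g 1 * b11 - 2 * (g 0 * B00 + g 1 * B11) * hs

/-- Infinitesimal (pseudo)Euclidean transformations act transitively on contact elements. -/
theorem exists_generatorOne (hη : η ^ 2 = 1) (p u : Jet 1) (hN : speedSq η g (p.2 1) ≠ 0) :
    ∃ a₀ a π, generatorOne η g a₀ a π 0 p = u := by
  set N := speedSq η g (p.2 1) with hNd
  -- The solution of `η π + (π · v) v = u` for the velocity part `u`: a rank-one perturbation of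
  -- `η`, invertible because `N ≠ 0`.
  set π : Fin 2 → ℝ := η • (u.2 1 - (η * dot g (u.2 1) (p.2 1) / N) • p.2 1) with hπ
  have hd : dot g π (p.2 1) = η * dot g (u.2 1) (p.2 1) / N := by
    have h1 : dot g π (p.2 1) = η * dot g (u.2 1) (p.2 1) -
        dot g (u.2 1) (p.2 1) / N * (η ^ 2 * dot g (p.2 1) (p.2 1)) := by
      simp [hπ, dot, Fin.sum_univ_two]; ring
    have h2 : η ^ 2 * dot g (p.2 1) (p.2 1) = η * (N - 1) := by rw [hNd, speedSq]; ring
    rw [h1, h2]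
    field_simp
    ring
  have hr (x : Fin 2 → ℝ) : rot g 0 x = 0 := by ext i; fin_cases i <;> simp [rot]
  refine ⟨u.1 + dot g π (p.2 0), u.2 0 - (η * p.1) • π, π, ?_⟩
  refine Prod.ext (by simp [generatorOne]) (funext fun s => ?_)
  fin_cases s
  · simp [generatorOne, hr]
  · have hη' : η * η = 1 := by rw [← sq, hη]
    simp only [generatorOne, hr, hd]
    simp [hπ, smul_smul, hη']

/-- The generators span the tangent space at `p` by `exists_generatorOne`. This is how invariance
becomes local constancy. -/
theorem fderiv_eq_zero_of_generatorOne (hη : η ^ 2 = 1) {f : Jet 1 → ℝ} {p : Jet 1}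
    (hN : speedSq η g (p.2 1) ≠ 0)
    (h : ∀ a₀ a π ρ, fderiv ℝ f p (generatorOne η g a₀ a π ρ p) = 0) : fderiv ℝ f p = 0 := by
  refine ContinuousLinearMap.ext fun u => ?_
  obtain ⟨a₀, a, π, hu⟩ := exists_generatorOne (g := g) hη p u hN
  rw [← hu]
  exact h a₀ a π 0

theorem hasFDerivAt_speedSq (p : Jet 1) : HasFDerivAt (fun p : Jet 1 => speedSq η g (p.2 1))
    (∑ j, (2 * η * g j * p.2 1 j) • dCoord 1 1 j) p := by
  have h (j : Fin 2) : HasFDerivAt (fun p : Jet 1 => p.2 1 j) (dCoord 1 1 j) p :=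
    (dCoord 1 1 j).hasFDerivAt
  have := ((((h 0).pow 2).const_mul (g 0)).add (((h 1).pow 2).const_mul (g 1))).const_mul η
    |>.const_add 1
  refine (this.congr_fderiv ?_).congr_of_eventuallyEq
    (Eventually.of_forall fun p => speedSq_eq (p.2 1))
  ext u
  · simp [dCoord]
  · simp [Fin.sum_univ_two]; ring

/-- `N` is a relative invariant of weight `2 π · v`; suitable powers of it compensate the weights of
the coefficients of `E`. -/
theorem fderiv_speedSq_generatorOne (hη : η ^ 2 = 1) (a₀ : ℝ) (a π : Fin 2 → ℝ) (ρ : ℝ) (p : Jet 1) :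
    (∑ j, (2 * η * g j * p.2 1 j) • dCoord 1 1 j) (generatorOne η g a₀ a π ρ p) =
      2 * dot g π (p.2 1) * speedSq η g (p.2 1) := by
  rw [speedSq_eq]
  simp [dCoord, generatorOne, dot, rot, Fin.sum_univ_two, Matrix.vecHead, Matrix.vecTail]
  linear_combination 2 * (g 0 * p.2 1 0 * π 0 + g 1 * p.2 1 1 * π 1) * hη

/-- The symmetric part of the coefficient at `v'`, divided by the leading coefficient. -/
def symmRatio (E : Jet 3 → Fin 2 → ℝ) (η : ℝ) (g : Fin 2 → ℝ) (p : Jet 1) : ℝ :=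
  (g 0 * linearTerm E p 0 0 + g 1 * linearTerm E p 1 1) /
    (leadCoeff E p * (speedSq η g (p.2 1) + 1))

/-- The skew part of the coefficient at `v'`, suitably normalized. -/
def skewRatio (E : Jet 3 → Fin 2 → ℝ) (η : ℝ) (g : Fin 2 → ℝ) (p : Jet 1) : ℝ :=
  (linearTerm E p 0 1 - linearTerm E p 1 0) / (leadCoeff E p * √(speedSq η g (p.2 1)))

theorem HasFDerivAt.fderiv_div_eq_zero {V : Type*} [NormedAddCommGroup V] [NormedSpace ℝ V]
    {f h : V → ℝ} {f' h' : V →L[ℝ] ℝ} {p u : V} (hf : HasFDerivAt f f' p) (hh : HasFDerivAt h h' p)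
    (h0 : h p ≠ 0) (he : f' u * h p = f p * h' u) : fderiv ℝ (fun x => f x / h x) p u = 0 := by
  have := hf.mul (HasDerivAt.comp_hasFDerivAt p (hasDerivAt_inv h0) hh)
  have h2 : (fun x => f x / h x) = f * (fun x => (h x)⁻¹) := by ext; simp [div_eq_mul_inv]
  rw [h2]
  refine (congrArg (fun m => m u) this.fderiv).trans ?_
  simp
  field_simp
  linear_combination he

/-- Along every generator, numerator and denominator of each ratio have the same weight: directly
for the skew part, and through the isotropy relations for the trace part. Transitivity then kills
the whole differential. -/
theorem IsInvariant.fderiv_ratio (hΩ : IsOpen Ω)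
    (hE : ContDiffOn ℝ ∞ E {q | toOne q ∈ Ω}) (hv : IsVariational Ω E)
    (hη : η ^ 2 = 1) (hg : ∀ i, g i ^ 2 = 1)
    (hi : IsInvariant η g Ω E) {p : Jet 1} (hp : p ∈ Ω) (hA : leadCoeff E p ≠ 0)
    (hN : 0 < speedSq η g (p.2 1)) :
    fderiv ℝ (symmRatio E η g) p = 0 ∧ fderiv ℝ (skewRatio E η g) p = 0 := by
  have hB (i j : Fin 2) := ((contDiffAt_linearTerm hΩ hE hp i j).differentiableAt
    (by simp)).hasFDerivAt
  have hA' := ((contDiffAt_leadCoeff hΩ hE hp).differentiableAt (by simp)).hasFDerivAt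
  have hS := hasFDerivAt_speedSq (η := η) (g := g) p
  obtain ⟨-, -, i0, i1, i2⟩ := hi.isotropy_eq hΩ hE hv hη hg hp hA hN
  have hsq : √(speedSq η g (p.2 1)) ≠ 0 := (Real.sqrt_pos.2 hN).ne'
  have hsq2 := Real.sq_sqrt hN.le
  have g0 := hg 0
  have g1 := hg 1
  constructor
  · refine fderiv_eq_zero_of_generatorOne hη hN.ne' fun a₀ a π ρ => ?_
    refine HasFDerivAt.fderiv_div_eq_zero (((hB 0 0).const_mul (g 0)).add ((hB 1 1).const_mul (g 1)))
      (hA'.mul (hS.add_const 1)) (by positivity) ?_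
    obtain ⟨-, h1, -⟩ := hi.graded_eq hΩ hE hv hp hA a₀ a π ρ
    have b00 := h1 0 0
    have b11 := h1 1 1
    simp only [add_apply, smul_apply, smul_eq_mul, fderiv_speedSq_generatorOne hη] at *
    -- The identity left over once the isotropy relations replace the diagonal entries and the
    -- off-diagonal sum of `B` by multiples of the trace.
    have hMM : (actionMatrix g π (p.2 1) ρ (Pi.single 1 1) 1 -
        actionMatrix g π (p.2 1) ρ (Pi.single 0 1) 0) *
          (g 0 * (g 0 * (1 + η * g 1 * p.2 1 1 ^ 2)) - g 1 * (g 1 * (1 + η * g 0 * p.2 1 0 ^ 2))) -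
        (g 0 * actionMatrix g π (p.2 1) ρ (Pi.single 0 1) 1 +
          g 1 * actionMatrix g π (p.2 1) ρ (Pi.single 1 1) 0) *
          (-2 * η * g 0 * g 1 * p.2 1 0 * p.2 1 1) =
        dot g π (p.2 1) * (speedSq η g (p.2 1) - 1) := by
      rw [speedSq_eq]
      rcases sq_eq_one_iff.1 g0 with h0 | h0 <;>
        rcases sq_eq_one_iff.1 g1 with h1 | h1 <;>
        simp [h0, h1, actionMatrix, dot, rot, Fin.sum_univ_two] <;> ring
    simp only [Matrix.cons_val_zero, Matrix.cons_val_one, Matrix.cons_val_fin_one] at b00 b11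
    linear_combination (speedSq η g (p.2 1) + 1) * (g 0 * b00 + g 1 * b11) +
      leadCoeff E p * (actionMatrix g π (p.2 1) ρ (Pi.single 1 1) 1 -
        actionMatrix g π (p.2 1) ρ (Pi.single 0 1) 0) * (g 0 * i0 - g 1 * i1) -
      leadCoeff E p * (g 0 * actionMatrix g π (p.2 1) ρ (Pi.single 0 1) 1 +
          g 1 * actionMatrix g π (p.2 1) ρ (Pi.single 1 1) 0) * i2 +
      leadCoeff E p * (g 0 * linearTerm E p 0 0 + g 1 * linearTerm E p 1 1) * hMM
  · refine fderiv_eq_zero_of_generatorOne hη hN.ne' fun a₀ a π ρ => ?_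
    refine HasFDerivAt.fderiv_div_eq_zero ((hB 0 1).sub (hB 1 0))
      (hA'.mul (hS.sqrt hN.ne')) (by positivity) ?_
    obtain ⟨-, h1, -⟩ := hi.graded_eq hΩ hE hv hp hA a₀ a π ρ
    have b01 := h1 0 1
    have b10 := h1 1 0
    simp only [sub_apply, add_apply, smul_apply, smul_eq_mul, fderiv_speedSq_generatorOne hη] at *
    simp only [Matrix.cons_val_zero, Matrix.cons_val_one, Matrix.cons_val_fin_one] at b01 b10
    have hr : 1 / (2 * √(speedSq η g (p.2 1))) *
        (2 * dot g π (p.2 1) * speedSq η g (p.2 1)) = dot g π (p.2 1) * √(speedSq η g (p.2 1)) := by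
      field_simp
      rw [hsq2, mul_comm]
    rw [hr]
    linear_combination √(speedSq η g (p.2 1)) * (b01 - b10)

theorem dCoord_vert (w : Fin 2 → ℝ) (j : Fin 2) : dCoord 1 1 j (vert 1 w) = w j := by
  simp [dCoord, vert_apply]

/-- A function `α` of contact elements, constant along the fibres, whose derivative in the direction
of motion is `c α √N / 3` with constant `c`, is constant. -/
theorem fderiv_eq_zero_of_drift (hη : η ^ 2 = 1) (hg : ∀ i, g i ^ 2 = 1) {U : Set (Jet 1)}
    (hU : IsOpen U) (hN : ∀ p ∈ U, 0 < speedSq η g (p.2 1)) {α c : Jet 1 → ℝ}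
    (hα : ∀ p ∈ U, ContDiffAt ℝ ∞ α p) (hc : ∀ p ∈ U, HasFDerivAt c (0 : Jet 1 →L[ℝ] ℝ) p)
    (hv : ∀ p ∈ U, ∀ w, fderiv ℝ α p (vert 1 w) = 0)
    (hr : ∀ p ∈ U, c p * α p * √(speedSq η g (p.2 1)) = 3 * fderiv ℝ α p (1, ![p.2 1, 0]))
    {p : Jet 1} (hp : p ∈ U) : fderiv ℝ α p = 0 ∧ c p * α p = 0 := by
  -- Derivatives of `α` in constant directions have zero fibre derivative too. Hence the right side
  -- of `hr'` behaves as an affine function of `v`, which `√N` is not.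
  have hmix (u : Jet 1) (w : Fin 2 → ℝ) {p : Jet 1} (hp : p ∈ U) :
      fderiv ℝ (fun q => fderiv ℝ α q u) p (vert 1 w) = 0 := by
    rw [fderiv_fderiv_apply_symm (hα p hp)]
    have : (fun q => fderiv ℝ α q (vert 1 w)) =ᶠ[𝓝 p] fun _ => 0 := by
      filter_upwards [hU.mem_nhds hp] with q hq
      exact hv q hq w
    rw [this.fderiv_eq]
    simp
  have hd (u : Jet 1) {p : Jet 1} (hp : p ∈ U) :
      HasFDerivAt (fun q => fderiv ℝ α q u) (fderiv ℝ (fun q => fderiv ℝ α q u) p) p :=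
    ((contDiffAt_fderiv_apply (hα p hp) u).differentiableAt (by simp)).hasFDerivAt
  have hα' {p : Jet 1} (hp : p ∈ U) := ((hα p hp).differentiableAt (by simp)).hasFDerivAt
  have hcoord (j : Fin 2) (p : Jet 1) : HasFDerivAt (fun p : Jet 1 => p.2 1 j) (dCoord 1 1 j) p :=
    (dCoord 1 1 j).hasFDerivAt
  have hsqrt {p : Jet 1} (hp : p ∈ U) :=
    (hasFDerivAt_speedSq (η := η) (g := g) p).sqrt (hN p hp).ne'
  have hY (p : Jet 1) : ((1, ![p.2 1, 0]) : Jet 1) = (1, 0) + ∑ j, p.2 1 j • dir 1 0 j := by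
    refine Prod.ext (by simp [dir]) (funext fun s => funext fun i => ?_)
    fin_cases s <;> fin_cases i <;> simp [Fin.sum_univ_two, dir_snd_apply]
  have hr' {p : Jet 1} (hp : p ∈ U) : c p * α p * √(speedSq η g (p.2 1)) =
      3 * (fderiv ℝ α p (1, 0) + (p.2 1 0 * fderiv ℝ α p (dir 1 0 0) +
        p.2 1 1 * fderiv ℝ α p (dir 1 0 1))) := by
    rw [hr p hp, hY]
    simp [Fin.sum_univ_two]
  have h1 {p : Jet 1} (hp : p ∈ U) (k : Fin 2) : 3 * fderiv ℝ α p (dir 1 0 k) =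
      c p * α p * (η * g k * p.2 1 k / √(speedSq η g (p.2 1))) := by
    have e1 := ((hc p hp).mul (hα' hp)).mul (hsqrt hp)
    have e2 := ((hd (1, 0) hp).add (((hcoord 0 p).mul (hd (dir 1 0 0) hp)).add
      ((hcoord 1 p).mul (hd (dir 1 0 1) hp)))).const_mul 3
    have e3 := e1.unique (e2.congr_of_eventuallyEq (by
      filter_upwards [hU.mem_nhds hp] with q hq
      exact hr' hq))
    have e4 := congrArg (fun m => m (vert 1 (Pi.single k 1))) e3
    simp only [add_apply, smul_apply, hmix _ _ hp, hv p hp, dCoord_vert, smul_eq_mul,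
      Fin.sum_univ_two] at e4
    have hs : √(speedSq η g (p.2 1)) ≠ 0 := (Real.sqrt_pos.2 (hN p hp)).ne'
    fin_cases k
    · simp at e4 ⊢
      rw [← e4]
      field_simp
    · simp at e4 ⊢
      rw [← e4]
      field_simp
  -- A second differentiation in `v^k`: the left side of `h1` has no `v`-derivative, while that of
  -- `v^k / √N` is `(N - η g_k (v^k)²) / N^{3/2}`.
  have h2 (k : Fin 2) : c p * α p * (speedSq η g (p.2 1) - η * g k * p.2 1 k ^ 2) = 0 := by
    have hs : √(speedSq η g (p.2 1)) ≠ 0 := (Real.sqrt_pos.2 (hN p hp)).ne'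
    have hs2 := Real.sq_sqrt (hN p hp).le
    have e1 := ((hc p hp).mul (hα' hp)).mul ((hcoord k p).const_mul (η * g k))
    have e2 := ((hd (dir 1 0 k) hp).const_mul 3).mul (hsqrt hp)
    have e3 := e1.unique (e2.congr_of_eventuallyEq (by
      filter_upwards [hU.mem_nhds hp] with q hq
      have hs : √(speedSq η g (q.2 1)) ≠ 0 := (Real.sqrt_pos.2 (hN q hq)).ne'
      simp only [Pi.mul_apply, h1 hq]
      field_simp))
    have e4 := congrArg (fun m => m (vert 1 (Pi.single k 1))) e3
    simp only [add_apply, smul_apply, hmix _ _ hp, hv p hp, dCoord_vert, smul_eq_mul,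
      Fin.sum_univ_two, h1 hp] at e4
    have e5 : c p * α p * (η * g k) * speedSq η g (p.2 1) =
        c p * α p * (η * g k * p.2 1 k) ^ 2 := by
      rw [← eq_div_iff (hN p hp).ne']
      fin_cases k
      · simp at e4 ⊢
        rw [e4, ← hs2, Real.sqrt_sq (Real.sqrt_nonneg _)]
        field_simp
      · simp at e4 ⊢
        rw [e4, ← hs2, Real.sqrt_sq (Real.sqrt_nonneg _)]
        field_simp
    have gk := hg k
    linear_combination η * g k * e5 + c p * α p * (η * g k * p.2 1 k ^ 2 - speedSq η g (p.2 1)) *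
      (hη * g k ^ 2 + gk)
  -- Summed over both `k`, the brackets in `h2` give `2 N - (N - 1) = N + 1 > 0`, so the factor `c
  -- α` vanishes.
  have h3 : c p * α p = 0 := by
    have e0 := h2 0
    have e1 := h2 1
    have hN1 : speedSq η g (p.2 1) + 1 ≠ 0 := by linarith [hN p hp]
    refine (mul_eq_zero.1 (?_ : c p * α p * (speedSq η g (p.2 1) + 1) = 0)).resolve_right hN1
    rw [speedSq_eq] at *
    linear_combination e0 + e1
  refine ⟨ContinuousLinearMap.ext fun u => ?_, h3⟩
  have h4 (k : Fin 2) : fderiv ℝ α p (dir 1 0 k) = 0 := by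
    have := h1 hp k
    rw [h3] at this
    linarith
  have h5 : fderiv ℝ α p (1, 0) = 0 := by
    have := hr' hp
    rw [h3, h4, h4] at this
    linarith
  have hu : u = u.1 • (1, 0) + (∑ j, u.2 0 j • dir 1 0 j + vert 1 (u.2 1)) := by
    refine Prod.ext (by simp [dir, vert_apply]) (funext fun s => funext fun i => ?_)
    fin_cases s <;> fin_cases i <;> simp [Fin.sum_univ_two, dir_snd_apply, vert_apply]
  rw [hu, map_add, map_smul, h5]
  simp [h4, hv p hp, Fin.sum_univ_two]

end

/-! ### Rigidity: reduction to the standard expression -/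

theorem rpow_three_halves {x : ℝ} (hx : 0 < x) : x ^ (3 / 2 : ℝ) = x * √x := by
  rw [show (3 / 2 : ℝ) = 1 + 1 / 2 by norm_num, Real.rpow_add hx, Real.rpow_one, Real.sqrt_eq_rpow]

theorem rpow_five_halves {x : ℝ} (hx : 0 < x) : x ^ (5 / 2 : ℝ) = x ^ 2 * √x := by
  rw [show (5 / 2 : ℝ) = (2 : ℕ) + 1 / 2 by norm_num, Real.rpow_add hx, Real.rpow_natCast,
    Real.sqrt_eq_rpow]

theorem differentiableAt_div {V : Type*} [NormedAddCommGroup V] [NormedSpace ℝ V] {f h : V → ℝ}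
    {p : V} (hf : DifferentiableAt ℝ f p) (hh : DifferentiableAt ℝ h p) (h0 : h p ≠ 0) :
    DifferentiableAt ℝ (fun x => f x / h x) p := by
  simpa only [div_eq_mul_inv] using hf.fun_mul (hh.fun_inv h0)

section

variable {Ω : Set (Jet 1)} {E : Jet 3 → Fin 2 → ℝ} {η : ℝ} {g : Fin 2 → ℝ}

/-- The leading coefficient multiplied by `N^{3/2}`. -/
def weighted (E : Jet 3 → Fin 2 → ℝ) (η : ℝ) (g : Fin 2 → ℝ) (p : Jet 1) : ℝ :=
  leadCoeff E p * (speedSq η g (p.2 1) * √(speedSq η g (p.2 1)))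

theorem hasFDerivAt_weighted (hΩ : IsOpen Ω) (hE : ContDiffOn ℝ ∞ E {q | toOne q ∈ Ω})
    {p : Jet 1} (hp : p ∈ Ω) (hN : 0 < speedSq η g (p.2 1)) :
    HasFDerivAt (weighted E η g)
      ((speedSq η g (p.2 1) * √(speedSq η g (p.2 1))) • fderiv ℝ (leadCoeff E) p +
        (3 / 2 * leadCoeff E p * √(speedSq η g (p.2 1))) •
          ∑ j, (2 * η * g j * p.2 1 j) • dCoord 1 1 j) p := by
  have hA := ((contDiffAt_leadCoeff hΩ hE hp).differentiableAt (by simp)).hasFDerivAt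
  have hS := hasFDerivAt_speedSq (η := η) (g := g) p
  refine (hA.fun_mul (hS.fun_mul (hS.sqrt hN.ne'))).congr_fderiv ?_
  have hs : √(speedSq η g (p.2 1)) ≠ 0 := (Real.sqrt_pos.2 hN).ne'
  have hs2 := Real.sq_sqrt hN.le
  have h1 : speedSq η g (p.2 1) * (1 / (2 * √(speedSq η g (p.2 1)))) =
      1 / 2 * √(speedSq η g (p.2 1)) := by
    field_simp
    rw [hs2]
  rw [smul_smul, h1]
  module

theorem contDiffAt_weighted (hΩ : IsOpen Ω) (hE : ContDiffOn ℝ ∞ E {q | toOne q ∈ Ω})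
    {p : Jet 1} (hp : p ∈ Ω) (hN : 0 < speedSq η g (p.2 1)) :
    ContDiffAt ℝ ∞ (weighted E η g) p := by
  have hS : ContDiff ℝ ∞ fun p : Jet 1 => speedSq η g (p.2 1) := by
    simp only [speedSq_eq]
    fun_prop
  exact (contDiffAt_leadCoeff hΩ hE hp).mul (hS.contDiffAt.mul (hS.contDiffAt.sqrt hN.ne'))

theorem isOpen_leadCoeff_ne_zero (hΩ : IsOpen Ω) (hE : ContDiffOn ℝ ∞ E {q | toOne q ∈ Ω}) :
    IsOpen {p | p ∈ Ω ∧ leadCoeff E p ≠ 0} := by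
  refine isOpen_iff_mem_nhds.2 fun p hp => ?_
  filter_upwards [hΩ.mem_nhds hp.1,
    (contDiffAt_leadCoeff hΩ hE hp.1).continuousAt.eventually_ne hp.2] with q h1 h2
  exact ⟨h1, h2⟩

/-- The weighted coefficient is fibre-constant by `IsInvariant.isotropy_eq`, and
`IsVariational.rotor_linearTerm` is the drift equation for it with factor `skewRatio`. Both
conclusions come from `fderiv_eq_zero_of_drift`. -/
theorem IsInvariant.fderiv_weighted (hΩ : IsOpen Ω)
    (hE : ContDiffOn ℝ ∞ E {q | toOne q ∈ Ω}) (hv : IsVariational Ω E)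
    (hη : η ^ 2 = 1) (hg : ∀ i, g i ^ 2 = 1) (hN : ∀ p ∈ Ω, 0 < speedSq η g (p.2 1))
    (hi : IsInvariant η g Ω E) {p : Jet 1} (hp : p ∈ Ω) (hA : leadCoeff E p ≠ 0) :
    fderiv ℝ (weighted E η g) p = 0 ∧ linearTerm E p 0 1 = linearTerm E p 1 0 := by
  have hs {p : Jet 1} (hp : p ∈ Ω) : √(speedSq η g (p.2 1)) ≠ 0 := (Real.sqrt_pos.2 (hN p hp)).ne'
  have hcd {p : Jet 1} (hp : p ∈ Ω) (hA : leadCoeff E p ≠ 0) :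
      DifferentiableAt ℝ (skewRatio E η g) p := by
    have hB (i j : Fin 2) := (contDiffAt_linearTerm hΩ hE hp i j).differentiableAt (by simp)
    have hA' := (contDiffAt_leadCoeff hΩ hE hp).differentiableAt (by simp)
    have hS := (hasFDerivAt_speedSq (η := η) (g := g) p).sqrt (hN p hp).ne'
    refine differentiableAt_div ((hB 0 1).fun_sub (hB 1 0)) (hA'.fun_mul hS.differentiableAt) ?_
    exact mul_ne_zero hA (hs hp)
  have hzero : fderiv ℝ (weighted E η g) p = 0 ∧ skewRatio E η g p * weighted E η g p = 0 := by
    refine fderiv_eq_zero_of_drift (c := skewRatio E η g) hη hg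
      (isOpen_leadCoeff_ne_zero hΩ hE) (fun p hp => hN p hp.1)
      (fun p hp => contDiffAt_weighted hΩ hE hp.1 (hN p hp.1)) (fun p hp => ?_) (fun p hp w => ?_)
      (fun p hp => ?_) ⟨hp, hA⟩
    · rw [← (hi.fderiv_ratio hΩ hE hv hη hg hp.1 hp.2 (hN p hp.1)).2]
      exact (hcd hp.1 hp.2).hasFDerivAt
    · obtain ⟨-, h, -⟩ := hi.isotropy_eq hΩ hE hv hη hg hp.1 hp.2 (hN p hp.1)
      have hl : fderiv ℝ (leadCoeff E) p (vert 1 w) = leadGrad E p w := rfl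
      rw [(hasFDerivAt_weighted hΩ hE hp.1 (hN p hp.1)).fderiv]
      simp only [add_apply, smul_apply, dCoord_vert, hl, leadGrad_eq p w, smul_eq_mul,
        Fin.sum_univ_two]
      linear_combination √(speedSq η g (p.2 1)) * (w 0 * h 0 + w 1 * h 1)
    · have h := hv.rotor_linearTerm hΩ hE hp.1
      rw [(hasFDerivAt_weighted hΩ hE hp.1 (hN p hp.1)).fderiv]
      have hz (j : Fin 2) : dCoord 1 1 j ((1, ![p.2 1, 0]) : Jet 1) = 0 := by simp [dCoord]
      simp only [add_apply, smul_apply, sum_apply, hz, smul_eq_mul, mul_zero, Finset.sum_const_zero,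
        add_zero]
      rw [skewRatio, weighted, h]
      have := hs hp.1
      have hA := hp.2
      field_simp
  refine ⟨hzero.1, ?_⟩
  have hne : weighted E η g p ≠ 0 := mul_ne_zero hA (mul_ne_zero (hN p hp).ne' (hs hp))
  have h3 := (mul_eq_zero.1 hzero.2).resolve_right hne
  have h4 := (div_eq_zero_iff.1 h3).resolve_right (mul_ne_zero hA (hs hp))
  linarith

/-- A third-order invariant variational expression has the standard form. -/
theorem IsInvariant.exists_eq_standardExpr (hΩ : IsOpen Ω) (hΩc : IsConnected Ω)
    (hE : ContDiffOn ℝ ∞ E {q | toOne q ∈ Ω}) (h3 : IsThirdOrder Ω E) (hv : IsVariational Ω E)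
    (hη : η ^ 2 = 1) (hg : ∀ i, g i ^ 2 = 1) (hN : ∀ p ∈ Ω, 0 < speedSq η g (p.2 1))
    (hi : IsInvariant η g Ω E) :
    ∃ c μ : ℝ, c ≠ 0 ∧ ∀ q : Jet 3, toOne q ∈ Ω → E q = c • standardExpr η g μ q := by
  have hs {p : Jet 1} (hp : p ∈ Ω) : √(speedSq η g (p.2 1)) ≠ 0 := (Real.sqrt_pos.2 (hN p hp)).ne'
  obtain ⟨q₀, hq₀, i₀, j₀, hne⟩ := h3
  rw [hv.leading_eq hΩ hE hq₀] at hne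
  have hA₀ := left_ne_zero_of_mul hne
  have hconn := hΩc.isPreconnected
  have hw {p : Jet 1} (hp : p ∈ Ω) := (contDiffAt_weighted hΩ hE hp (hN p hp)).differentiableAt
    (by simp)
  have hw0 {p : Jet 1} (hp : p ∈ Ω) : weighted E η g p ≠ 0 ↔ leadCoeff E p ≠ 0 := by
    rw [weighted, mul_ne_zero_iff, and_iff_left (mul_ne_zero (hN p hp).ne' (hs hp))]
  -- Squaring disposes of the zeros of `A`, where invariance gives no information: there the
  -- derivative of the square vanishes anyway. So the square is constant on `Ω` and `A` has no
  -- zeros.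
  have hsq {p : Jet 1} (hp : p ∈ Ω) : weighted E η g p ^ 2 = weighted E η g (toOne q₀) ^ 2 := by
    refine hΩ.is_const_of_fderiv_eq_zero (𝕜 := ℝ) (f := fun p => weighted E η g p ^ 2) hconn
      (fun p hp => ((hw hp).pow 2).differentiableWithinAt) (fun p hp => ?_) hp hq₀
    rw [((hw hp).hasFDerivAt.pow 2).fderiv]
    by_cases hA : leadCoeff E p = 0
    · have : weighted E η g p = 0 := by simp [weighted, hA]
      simp [this]
    · rw [(hi.fderiv_weighted hΩ hE hv hη hg hN hp hA).1]
      simp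
  have hA {p : Jet 1} (hp : p ∈ Ω) : leadCoeff E p ≠ 0 := by
    rw [← hw0 hp, ← pow_ne_zero_iff two_ne_zero, hsq hp]
    exact pow_ne_zero 2 ((hw0 hq₀).2 hA₀)
  have hα {p : Jet 1} (hp : p ∈ Ω) : weighted E η g p = weighted E η g (toOne q₀) :=
    hΩ.is_const_of_fderiv_eq_zero (𝕜 := ℝ) hconn
      (fun p hp => (hw hp).differentiableWithinAt)
      (fun p hp => (hi.fderiv_weighted hΩ hE hv hη hg hN hp (hA hp)).1) hp hq₀
  have hβ {p : Jet 1} (hp : p ∈ Ω) : symmRatio E η g p = symmRatio E η g (toOne q₀) := by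
    refine hΩ.is_const_of_fderiv_eq_zero (𝕜 := ℝ) hconn
      (fun p hp => ?_)
      (fun p hp => (hi.fderiv_ratio hΩ hE hv hη hg hp (hA hp) (hN p hp)).1) hp hq₀
    have hB (i j : Fin 2) := (contDiffAt_linearTerm hΩ hE hp i j).differentiableAt (by simp)
    have hA' := (contDiffAt_leadCoeff hΩ hE hp).differentiableAt (by simp)
    have hS := (hasFDerivAt_speedSq (η := η) (g := g) p).differentiableAt
    refine (differentiableAt_div (((hB 0 0).const_mul _).fun_add ((hB 1 1).const_mul _))
      (hA'.fun_mul (hS.add_const 1)) ?_).differentiableWithinAt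
    exact mul_ne_zero (hA hp) (by linarith [hN p hp])
  refine ⟨weighted E η g (toOne q₀), symmRatio E η g (toOne q₀), (hw0 hq₀).2 hA₀, fun q hq => ?_⟩
  rw [← hα hq, ← hβ hq]
  have hNq : 0 < speedSq η g (q.2 1) := hN _ hq
  obtain ⟨e1, e2, e3, e4, e5⟩ := hi.isotropy_eq hΩ hE hv hη hg hq (hA hq) (hN _ hq)
  have e6 := (hi.fderiv_weighted hΩ hE hv hη hg hN hq (hA hq)).2
  have hNe := speedSq_eq (η := η) (g := g) (q.2 1)
  have hv1 : (toOne q).2 1 = q.2 1 := rfl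
  have hA' := hA hq
  have hN1 : speedSq η g (q.2 1) + 1 ≠ 0 := by linarith
  have hsq := hs hq
  have hss := Real.sq_sqrt hNq.le
  have hNq' := hNq.ne'
  have hG (i : Fin 2) : leadGrad E (toOne q) (Pi.single i 1) =
      -3 * η * g i * q.2 1 i * leadCoeff E (toOne q) / speedSq η g (q.2 1) := by
    rw [eq_div_iff hNq', mul_comm]
    exact e2 i
  rw [← e6, hv1] at e5
  rw [hv1] at e3 e4
  obtain ⟨T, hT⟩ : ∃ T, g 0 * linearTerm E (toOne q) 0 0 + g 1 * linearTerm E (toOne q) 1 1 = T :=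
    ⟨_, rfl⟩
  rw [hT] at e3 e4 e5
  have f0 := eq_div_of_mul_eq hN1 ((mul_comm _ _).trans e3)
  have f1 := eq_div_of_mul_eq hN1 ((mul_comm _ _).trans e4)
  have f2 : linearTerm E (toOne q) 0 1 =
      T * (-η * g 0 * g 1 * q.2 1 0 * q.2 1 1) / (speedSq η g (q.2 1) + 1) :=
    eq_div_of_mul_eq hN1 (by linear_combination e5 / 2)
  have g0 := hg 0
  have g1 := hg 1
  funext i
  rw [hv.eq_normal_form hΩ hE hq, leadGrad_eq, hG, hG]
  have k0 : speedSq η g (q.2 1) * (g 0 * q.2 2 0) - η * (g 0 * q.2 2 0 * q.2 1 0 +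
      g 1 * q.2 2 1 * q.2 1 1) * (g 0 * q.2 1 0) = g 0 * (1 + η * g 1 * q.2 1 1 ^ 2) * q.2 2 0 -
        η * g 0 * g 1 * q.2 1 0 * q.2 1 1 * q.2 2 1 := by
    rw [hNe]
    ring
  have k1 : speedSq η g (q.2 1) * (g 1 * q.2 2 1) - η * (g 0 * q.2 2 0 * q.2 1 0 +
      g 1 * q.2 2 1 * q.2 1 1) * (g 1 * q.2 1 1) = g 1 * (1 + η * g 0 * q.2 1 0 ^ 2) * q.2 2 1 -
        η * g 0 * g 1 * q.2 1 0 * q.2 1 1 * q.2 2 0 := by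
    rw [hNe]
    ring
  simp only [Pi.smul_apply, standardExpr, Pi.add_apply, Pi.sub_apply, smul_eq_mul, weighted, symmRatio,
    rpow_three_halves hNq, rpow_five_halves hNq, hv1, Fin.sum_univ_two, star, lower, dot, e1,
    add_zero, hT]
  rw [hv1] at hsq
  fin_cases i
  · simp only [Fin.zero_eta, turn_zero, Matrix.cons_val_zero]
    rw [k0, f0, f2]
    field_simp
    ring
  · simp only [Fin.mk_one, turn_one, Matrix.cons_val_one, Matrix.cons_val_fin_one]
    rw [k1, f1, ← e6, f2]
    field_simp
    ring

end

/-! ### The Lagrange functions -/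

theorem hasDerivAt_iteratedDeriv {γ : ℝ → Fin 2 → ℝ} (hγ : ContDiff ℝ ∞ γ) (s : ℕ) (t : ℝ) :
    HasDerivAt (iteratedDeriv s γ) (iteratedDeriv (s + 1) γ t) t := by
  rw [iteratedDeriv_succ]
  exact (hγ.differentiable_iteratedDeriv s (by exact_mod_cast WithTop.coe_lt_top _) t).hasDerivAt

/-- The Euler–Poisson expression of a second-order Lagrange function that is affine in the
accelerations and does not depend on `t` and `x`. -/
theorem eulerPoisson_affine {Φ S : (Fin 2 → ℝ) → ℝ} {V : Set (Fin 2 → ℝ)} (hV : IsOpen V)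
    (hΦ : ContDiffOn ℝ ∞ Φ V) (hS : ContDiffOn ℝ ∞ S V) (k : Fin 2) {γ : ℝ → Fin 2 → ℝ}
    (hγ : ContDiff ℝ ∞ γ) {t : ℝ} (ht : iteratedDeriv 1 γ t ∈ V) (i : Fin 2) :
    eulerPoisson 2 (fun p => Φ (p.2 1) * p.2 2 k + S (p.2 1)) γ i t = deriv (fun τ =>
      (if i = k then fderiv ℝ Φ (iteratedDeriv 1 γ τ) (iteratedDeriv 2 γ τ) else 0) -
        fderiv ℝ Φ (iteratedDeriv 1 γ τ) (Pi.single i 1) * iteratedDeriv 2 γ τ k -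
        fderiv ℝ S (iteratedDeriv 1 γ τ) (Pi.single i 1)) t := by
  have hΦ' {v : Fin 2 → ℝ} (hv : v ∈ V) : ContDiffAt ℝ ∞ Φ v := hΦ.contDiffAt (hV.mem_nhds hv)
  have hS' {v : Fin 2 → ℝ} (hv : v ∈ V) : ContDiffAt ℝ ∞ S v := hS.contDiffAt (hV.mem_nhds hv)
  have hev : ∀ᶠ τ in 𝓝 t, iteratedDeriv 1 γ τ ∈ V :=
    (hasDerivAt_iteratedDeriv hγ 1 t).continuousAt.eventually (hV.mem_nhds ht)
  let c1 : Jet 2 →L[ℝ] (Fin 2 → ℝ) := (ContinuousLinearMap.proj (R := ℝ)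
    (φ := fun _ : Fin 3 => Fin 2 → ℝ) 1).comp (ContinuousLinearMap.snd ℝ ℝ _)
  have hL {p : Jet 2} (hp : p.2 1 ∈ V) (u : Jet 2) :
      fderiv ℝ (fun p : Jet 2 => Φ (p.2 1) * p.2 2 k + S (p.2 1)) p u =
        Φ (p.2 1) * u.2 2 k + p.2 2 k * fderiv ℝ Φ (p.2 1) (u.2 1) + fderiv ℝ S (p.2 1) (u.2 1) := by
    have h1 : HasFDerivAt (fun p : Jet 2 => Φ (p.2 1)) ((fderiv ℝ Φ (p.2 1)).comp c1) p :=
      ((hΦ' hp).differentiableAt (by simp)).hasFDerivAt.comp p c1.hasFDerivAt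
    have h2 : HasFDerivAt (fun p : Jet 2 => S (p.2 1)) ((fderiv ℝ S (p.2 1)).comp c1) p :=
      ((hS' hp).differentiableAt (by simp)).hasFDerivAt.comp p c1.hasFDerivAt
    have h3 : HasFDerivAt (fun p : Jet 2 => p.2 2 k) (dCoord 2 2 k) p := (dCoord 2 2 k).hasFDerivAt
    exact congrArg (fun m => m u) ((h1.mul h3).add h2).fderiv
  have d (s s' : Fin 3) (h : s' ≠ s) (i : Fin 2) : (dir 2 s i).2 s' = 0 := by
    ext; simp [dir_snd_apply, h]
  have d' (s : Fin 3) (i : Fin 2) : (dir 2 s i).2 s = Pi.single i 1 := by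
    ext; simp [dir_snd_apply, Pi.single_apply]
  have hmem {τ : ℝ} (hτ : iteratedDeriv 1 γ τ ∈ V) : (jet 2 γ τ).2 1 ∈ V := hτ
  have hcomp {f : (Fin 2 → ℝ) → ℝ} {τ : ℝ} (hf : DifferentiableAt ℝ f (iteratedDeriv 1 γ τ)) :
      HasDerivAt (fun τ => f (iteratedDeriv 1 γ τ))
        (fderiv ℝ f (iteratedDeriv 1 γ τ) (iteratedDeriv 2 γ τ)) τ :=
    hf.hasFDerivAt.comp_hasDerivAt τ (hasDerivAt_iteratedDeriv hγ 1 τ)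
  have hacc (τ : ℝ) : HasDerivAt (fun τ => iteratedDeriv 2 γ τ k) (iteratedDeriv 3 γ τ k) τ :=
    hasDerivAt_pi.1 (hasDerivAt_iteratedDeriv hγ 2 τ) k
  -- The Lagrange function does not depend on `x`, so what is left is a single total derivative; the
  -- term `Φ'` cancels all third derivatives of `γ` inside it.
  have e0 : fderiv ℝ (fun p : Jet 2 => Φ (p.2 1) * p.2 2 k + S (p.2 1)) (jet 2 γ t) (dir 2 0 i) = 0 := by
    rw [hL (hmem ht), d 0 1 (by decide), d 0 2 (by decide)]
    simp
  have e1 : (fun τ => fderiv ℝ (fun p : Jet 2 => Φ (p.2 1) * p.2 2 k + S (p.2 1)) (jet 2 γ τ)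
      (dir 2 1 i)) =ᶠ[𝓝 t] fun τ =>
        fderiv ℝ Φ (iteratedDeriv 1 γ τ) (Pi.single i 1) * iteratedDeriv 2 γ τ k +
        fderiv ℝ S (iteratedDeriv 1 γ τ) (Pi.single i 1) := by
    filter_upwards [hev] with τ hτ
    rw [hL (hmem hτ), d 1 2 (by decide), d']
    simp [jet, mul_comm]
  have e2 : (fun τ => fderiv ℝ (fun p : Jet 2 => Φ (p.2 1) * p.2 2 k + S (p.2 1)) (jet 2 γ τ)
      (dir 2 2 i)) =ᶠ[𝓝 t] fun τ => Φ (iteratedDeriv 1 γ τ) * (if i = k then 1 else 0) := by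
    filter_upwards [hev] with τ hτ
    rw [hL (hmem hτ), d 2 1 (by decide), d']
    simp [jet, Pi.single_apply, eq_comm]
  have e3 : deriv (fun τ => fderiv ℝ (fun p : Jet 2 => Φ (p.2 1) * p.2 2 k + S (p.2 1))
      (jet 2 γ τ) (dir 2 2 i)) =ᶠ[𝓝 t] fun τ =>
        if i = k then fderiv ℝ Φ (iteratedDeriv 1 γ τ) (iteratedDeriv 2 γ τ) else 0 := by
    refine e2.deriv.trans ?_
    filter_upwards [hev] with τ hτ
    rw [((hcomp ((hΦ' hτ).differentiableAt (by simp))).mul_const _).deriv]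
    split_ifs <;> simp
  have hd1 : DifferentiableAt ℝ (fun τ =>
      fderiv ℝ Φ (iteratedDeriv 1 γ τ) (Pi.single i 1) * iteratedDeriv 2 γ τ k +
        fderiv ℝ S (iteratedDeriv 1 γ τ) (Pi.single i 1)) t :=
    ((hcomp ((contDiffAt_fderiv_apply (hΦ' ht) _).differentiableAt (by simp))).differentiableAt.fun_mul
      (hacc t).differentiableAt).fun_add
      (hcomp ((contDiffAt_fderiv_apply (hS' ht) _).differentiableAt (by simp))).differentiableAt
  have hd2 : DifferentiableAt ℝ (fun τ =>
      if i = k then fderiv ℝ Φ (iteratedDeriv 1 γ τ) (iteratedDeriv 2 γ τ) else 0) t := by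
    split_ifs
    · have h1 : DifferentiableAt ℝ (fun τ => fderiv ℝ Φ (iteratedDeriv 1 γ τ)) t :=
        (((hΦ' ht).fderiv_right (m := ∞) (by simp)).differentiableAt (by simp)).comp t
          (hasDerivAt_iteratedDeriv hγ 1 t).differentiableAt
      exact h1.clm_apply (hasDerivAt_iteratedDeriv hγ 2 t).differentiableAt
    · exact differentiableAt_const _
  have x1 := (congrFun iteratedDeriv_one t).trans e1.deriv_eq
  have x2 := (congrFun iteratedDeriv_succ t).trans
    (((congrArg (fun f => deriv f t) iteratedDeriv_one)).trans e3.deriv_eq)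
  refine (Fin.sum_univ_three _).trans ?_
  refine (congrArg₂ (· + ·) (congrArg₂ (· + ·) (congrArg ((-1) ^ 0 * ·) e0)
    (congrArg ((-1) ^ 1 * ·) x1)) (congrArg ((-1) ^ 2 * ·) x2)).trans ?_
  simp only [sub_sub]
  rw [deriv_fun_sub hd2 hd1]
  ring

section

variable {η : ℝ} {g : Fin 2 → ℝ}

/-- In `Fin 2` the sum `j + 1` wraps around and is the index other than `j`; thus the denominator is
free of `v^j`. -/
theorem lagDenom_eq (hg : ∀ i, g i ^ 2 = 1) (j : Fin 2) (v : Fin 2 → ℝ) :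
    lagDenom η g j v = 1 + η * g (j + 1) * v (j + 1) ^ 2 := by
  have g0 := hg 0
  have g1 := hg 1
  fin_cases j
  · simp [lagDenom, wedgeSq, dot, Fin.sum_univ_two, -add_right_inj]
    linear_combination (η * g 1 * v 1 ^ 2) * g0
  · simp [lagDenom, wedgeSq, dot, Fin.sum_univ_two, -add_right_inj]
    linear_combination (η * g 0 * v 0 ^ 2) * g1

/-- The velocities at which the Lagrange function `L_(j)` is smooth. -/
def regularSet (η : ℝ) (g : Fin 2 → ℝ) (j : Fin 2) : Set (Fin 2 → ℝ) :=
  {v | 0 < speedSq η g v ∧ lagDenom η g j v ≠ 0}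

theorem contDiff_speedSq : ContDiff ℝ ∞ (speedSq η g) := by
  have : speedSq η g = fun v => 1 + η * (g 0 * v 0 ^ 2 + g 1 * v 1 ^ 2) :=
    funext fun v => speedSq_eq v
  rw [this]
  fun_prop

theorem contDiff_lagDenom (hg : ∀ i, g i ^ 2 = 1) (j : Fin 2) : ContDiff ℝ ∞ (lagDenom η g j) := by
  rw [funext (lagDenom_eq (η := η) hg j)]
  fun_prop

theorem isOpen_regularSet (hg : ∀ i, g i ^ 2 = 1) (j : Fin 2) : IsOpen (regularSet η g j) :=
  (isOpen_lt continuous_const contDiff_speedSq.continuous).inter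
    (isOpen_ne_fun (contDiff_lagDenom hg j).continuous continuous_const)

/-- The coefficient of `L_(j)` at the acceleration `v'^{j+1}`. -/
def accCoeff (η : ℝ) (g : Fin 2 → ℝ) (j : Fin 2) (v : Fin 2 → ℝ) : ℝ :=
  ![-1, 1] j * (v j / (√(speedSq η g v) * lagDenom η g j v))

theorem lagrangian_eq (μ : ℝ) (j : Fin 2) : lagrangian η g μ j = fun p =>
    accCoeff η g j (p.2 1) * p.2 2 (j + 1) + -(η * μ * √(speedSq η g (p.2 1))) := by
  funext p
  fin_cases j <;> simp [lagrangian, accCoeff, starWedge] <;> ring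

theorem contDiffOn_accCoeff (hg : ∀ i, g i ^ 2 = 1) (j : Fin 2) :
    ContDiffOn ℝ ∞ (accCoeff η g j) (regularSet η g j) := by
  refine contDiffOn_const.mul (ContDiffOn.div (contDiff_apply ℝ ℝ j).contDiffOn
    ((contDiff_speedSq.contDiffOn.sqrt fun _ hv => hv.1.ne').mul (contDiff_lagDenom hg j).contDiffOn)
    fun v hv => mul_ne_zero (Real.sqrt_pos.2 hv.1).ne' hv.2)

theorem contDiffOn_sqrt_speedSq (μ : ℝ) (j : Fin 2) :
    ContDiffOn ℝ ∞ (fun v => -(η * μ * √(speedSq η g v))) (regularSet η g j) :=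
  (contDiffOn_const.mul (contDiff_speedSq.contDiffOn.sqrt fun _ hv => hv.1.ne')).neg

theorem hasDerivAt_speedSq {v : ℝ → Fin 2 → ℝ} {v' : Fin 2 → ℝ} {t : ℝ} (h : HasDerivAt v v' t) :
    HasDerivAt (fun τ => speedSq η g (v τ)) (2 * (η * dot g (v t) v')) t := by
  have h' := hasDerivAt_pi.1 h
  have := ((((h' 0).pow 2).const_mul (g 0)).add (((h' 1).pow 2).const_mul (g 1))).const_mul η
    |>.const_add 1
  refine (this.congr_deriv ?_).congr_of_eventuallyEq (Eventually.of_forall fun τ => speedSq_eq _)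
  simp [dot, Fin.sum_univ_two]
  ring

theorem fderiv_sqrt_speedSq (hη : η ^ 2 = 1) (μ : ℝ) {v : Fin 2 → ℝ} (hv : 0 < speedSq η g v)
    (i : Fin 2) : fderiv ℝ (fun v => -(η * μ * √(speedSq η g v))) v (Pi.single i 1) =
      -(μ * g i * v i / √(speedSq η g v)) := by
  have hline : HasDerivAt (fun s : ℝ => v + s • Pi.single i (1 : ℝ)) (Pi.single i 1) 0 := by
    simpa using ((hasDerivAt_id (0 : ℝ)).smul_const (Pi.single i (1 : ℝ))).const_add v
  have hd : DifferentiableAt ℝ (fun v => -(η * μ * √(speedSq η g v))) v :=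
    (((contDiff_speedSq.differentiable (by simp) v).sqrt hv.ne').const_mul _).fun_neg
  have h1 : HasDerivAt (fun s : ℝ => -(η * μ * √(speedSq η g (v + s • Pi.single i (1 : ℝ))))) _ 0 :=
    hd.hasFDerivAt.hasLineDerivAt (Pi.single i 1)
  have hz : speedSq η g (v + (0 : ℝ) • Pi.single i (1 : ℝ)) = speedSq η g v := by simp
  have h2 := (((hasDerivAt_speedSq (η := η) (g := g) hline).sqrt (by rw [hz]; exact hv.ne')).const_mul
    (η * μ)).neg
  rw [h1.unique h2, hz]
  have : √(speedSq η g v) ≠ 0 := (Real.sqrt_pos.2 hv).ne'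
  have hdot : dot g (v + (0 : ℝ) • Pi.single i (1 : ℝ)) (Pi.single i 1) = g i * v i := by
    fin_cases i <;> simp [dot, Fin.sum_univ_two]
  rw [hdot]
  field_simp
  linear_combination -(μ * g i * v i) * hη

/-- Since `N = D + η g_j (v^j)²` with `D` free of `v^j`, the derivative of `v^j / √N` is `D /
N^{3/2}`, and `D` cancels. This is why both Lagrange functions yield the same equation. -/
theorem fderiv_accCoeff (hg : ∀ i, g i ^ 2 = 1) {j : Fin 2} {v : Fin 2 → ℝ}
    (hv : v ∈ regularSet η g j) : fderiv ℝ (accCoeff η g j) v (Pi.single j 1) =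
      ![-1, 1] j / (speedSq η g v * √(speedSq η g v)) := by
  have hline : HasDerivAt (fun s : ℝ => v + s • Pi.single j (1 : ℝ)) (Pi.single j 1) 0 := by
    simpa using ((hasDerivAt_id (0 : ℝ)).smul_const (Pi.single j (1 : ℝ))).const_add v
  have hd := ((contDiffOn_accCoeff hg j).contDiffAt
    ((isOpen_regularSet hg j).mem_nhds hv)).differentiableAt (by simp)
  have h1 : HasDerivAt (fun s : ℝ => accCoeff η g j (v + s • Pi.single j (1 : ℝ))) _ 0 :=
    hd.hasFDerivAt.hasLineDerivAt (Pi.single j 1)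
  have hz : v + (0 : ℝ) • Pi.single j (1 : ℝ) = v := by simp
  have hs : √(speedSq η g v) ≠ 0 := (Real.sqrt_pos.2 hv.1).ne'
  have hs2 := Real.sq_sqrt hv.1.le
  have hden (s : ℝ) : lagDenom η g j (v + s • Pi.single j (1 : ℝ)) = lagDenom η g j v := by
    rw [lagDenom_eq hg, lagDenom_eq hg]
    fin_cases j <;> simp
  have hnum : HasDerivAt (fun s : ℝ => (v + s • Pi.single j (1 : ℝ) : Fin 2 → ℝ) j) 1 0 := by
    simpa using hasDerivAt_pi.1 hline j
  have h2 := (hnum.div (((hasDerivAt_speedSq (η := η) (g := g) hline).sqrt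
    (by rw [hz]; exact hv.1.ne')).mul_const (lagDenom η g j v))
    (mul_ne_zero (by rw [hz]; exact hs) hv.2)).const_mul (![-1, 1] j)
  have h3 : (fun s : ℝ => accCoeff η g j (v + s • Pi.single j (1 : ℝ))) = fun s : ℝ => ![-1, 1] j *
      ((v + s • Pi.single j (1 : ℝ) : Fin 2 → ℝ) j /
        (√(speedSq η g (v + s • Pi.single j (1 : ℝ))) * lagDenom η g j v)) := by
    funext s
    rw [accCoeff, hden]
  rw [h3] at h1
  rw [h1.unique h2, hz]
  have hdot : dot g v (Pi.single j 1) = g j * v j := by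
    fin_cases j <;> simp [dot, Fin.sum_univ_two]
  have hl : speedSq η g v = lagDenom η g j v + η * g j * v j ^ 2 := by
    rw [lagDenom_eq hg, speedSq_eq]
    fin_cases j <;> simp <;> ring
  have hd0 := hv.2
  have hN := hv.1.ne'
  rw [hdot]
  field_simp
  rw [hs2]
  linear_combination ![-1, 1] j * speedSq η g v * hl

/-- The standard expression is a total time derivative. -/
theorem hasDerivAt_momentum {γ : ℝ → Fin 2 → ℝ} (hγ : ContDiff ℝ ∞ γ) (μ : ℝ) {t : ℝ}
    (ht : 0 < speedSq η g (iteratedDeriv 1 γ t)) (i : Fin 2) :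
    HasDerivAt (fun τ => -(star (iteratedDeriv 2 γ τ) i / (speedSq η g (iteratedDeriv 1 γ τ) *
      √(speedSq η g (iteratedDeriv 1 γ τ)))) +
        μ * g i * iteratedDeriv 1 γ τ i / √(speedSq η g (iteratedDeriv 1 γ τ)))
      (standardExpr η g μ (jet 3 γ t) i) t := by
  have hv := hasDerivAt_iteratedDeriv hγ 1 t
  have hN := hasDerivAt_speedSq (η := η) (g := g) hv
  have hR := hN.sqrt ht.ne'
  have hs : √(speedSq η g (iteratedDeriv 1 γ t)) ≠ 0 := (Real.sqrt_pos.2 ht).ne'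
  have hs2 := Real.sq_sqrt ht.le
  have hstar : HasDerivAt (fun τ => star (iteratedDeriv 2 γ τ) i) (star (iteratedDeriv 3 γ t) i) t := by
    have h := hasDerivAt_pi.1 (hasDerivAt_iteratedDeriv hγ 2 t)
    fin_cases i
    · exact (h 1).neg
    · exact h 0
  have h := (hstar.div (hN.mul hR) (mul_ne_zero ht.ne' hs)).neg.add
    (((hasDerivAt_pi.1 hv i).const_mul (μ * g i)).div hR hs)
  refine h.congr_deriv ?_
  have j1 : (jet 3 γ t).2 1 = iteratedDeriv 1 γ t := rfl
  have j2 : (jet 3 γ t).2 2 = iteratedDeriv 2 γ t := rfl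
  have j3 : (jet 3 γ t).2 3 = iteratedDeriv 3 γ t := rfl
  have hc : dot g (iteratedDeriv 2 γ t) (iteratedDeriv 1 γ t) =
      dot g (iteratedDeriv 1 γ t) (iteratedDeriv 2 γ t) := by
    simp only [dot, mul_right_comm]
  have hN0 := ht.ne'
  simp only [standardExpr, j1, j2, j3, rpow_three_halves ht, rpow_five_halves ht, Pi.add_apply,
    Pi.sub_apply, Pi.smul_apply, smul_eq_mul, lower, hc, Pi.mul_apply]
  generalize √(speedSq η g (iteratedDeriv 1 γ t)) = r at *
  generalize speedSq η g (iteratedDeriv 1 γ t) = N at *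
  subst hs2
  field_simp
  ring

/-- Both sides are total derivatives, so the momenta are compared near `t`. In the one from
`eulerPoisson_affine` only the derivative of `accCoeff` in the direction `j` survives. -/
theorem isLagrangianOn_lagrangian {Ω : Set (Jet 1)} (hΩ : IsOpen Ω) (hη : η ^ 2 = 1)
    (hg : ∀ i, g i ^ 2 = 1) (hN : ∀ p ∈ Ω, 0 < speedSq η g (p.2 1)) (μ : ℝ) (j : Fin 2) :
    IsLagrangianOn Ω 2 (lagrangian η g μ j) {p | toOne p ∈ Ω ∧ lagDenom η g j (p.2 1) ≠ 0}
      (standardExpr η g μ) := by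
  have hv : ContDiff ℝ ∞ fun p : Jet 2 => p.2 1 := by fun_prop
  have hmaps : MapsTo (fun p : Jet 2 => p.2 1) {p | toOne p ∈ Ω ∧ lagDenom η g j (p.2 1) ≠ 0}
      (regularSet η g j) := fun p hp => ⟨hN _ hp.1, hp.2⟩
  refine ⟨(isOpen_over hΩ 1).inter (isOpen_ne_fun ((contDiff_lagDenom hg j).continuous.comp
    hv.continuous) continuous_const), ?_, fun γ hγ t ht _ i => ?_⟩
  · rw [lagrangian_eq]
    exact (((contDiffOn_accCoeff hg j).comp hv.contDiffOn hmaps).mul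
      (contDiff_apply_apply ℝ ℝ 2 (j + 1) |>.comp contDiff_snd).contDiffOn).add
      ((contDiffOn_sqrt_speedSq μ j).comp hv.contDiffOn hmaps)
  · have ht' : iteratedDeriv 1 γ t ∈ regularSet η g j := hmaps ht
    rw [lagrangian_eq, eulerPoisson_affine (isOpen_regularSet hg j) (contDiffOn_accCoeff hg j)
      (contDiffOn_sqrt_speedSq μ j) (j + 1) hγ ht' i, ← (hasDerivAt_momentum hγ μ ht'.1 i).deriv]
    refine EventuallyEq.deriv_eq ?_
    filter_upwards [(hasDerivAt_iteratedDeriv hγ 1 t).continuousAt.eventually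
      ((isOpen_regularSet hg j).mem_nhds ht')] with τ hτ
    rw [fderiv_sqrt_speedSq hη μ hτ.1]
    have hd := fderiv_accCoeff hg hτ
    have hw (w : Fin 2 → ℝ) : w = w 0 • Pi.single 0 1 + w 1 • Pi.single 1 1 := by
      ext i; fin_cases i <;> simp
    rw [hw (iteratedDeriv 2 γ τ)]
    fin_cases j <;> fin_cases i <;> simp [star] at hd ⊢ <;> rw [hd] <;> ring

end

/-! ### The difference of the Lagrange functions -/

section

variable {η : ℝ} {g : Fin 2 → ℝ}

theorem hasDerivAt_half_log_ratio {z : ℝ → ℝ} {z' t : ℝ} (h : HasDerivAt z z' t)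
    (hz : 1 - z t ^ 2 ≠ 0) :
    HasDerivAt (fun τ => 1 / 2 * Real.log |(1 + z τ) / (1 - z τ)|) (z' / (1 - z t ^ 2)) t := by
  have h1 : 1 + z t ≠ 0 := fun h0 => hz (by linear_combination (1 - z t) * h0)
  have h2 : 1 - z t ≠ 0 := fun h0 => hz (by linear_combination (1 + z t) * h0)
  simp only [Real.log_abs]
  have h3 := (((h.const_add 1).div (h.const_sub 1) h2).log (div_ne_zero h1 h2)).const_mul (1 / 2)
  refine h3.congr_deriv ?_
  have h4 : 1 - z t ^ 2 = (1 + z t) * (1 - z t) := by ring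
  rw [h4]
  simp only [Pi.div_apply]
  field_simp
  ring

theorem hasDerivAt_gauge (hg : ∀ i, g i ^ 2 = 1) (hη : η ^ 2 = 1) (μ : ℝ) {γ : ℝ → Fin 2 → ℝ}
    (hγ : ContDiff ℝ ∞ γ) {t : ℝ} (hN : 0 < speedSq η g (deriv γ t))
    (hd : ∀ j, lagDenom η g j (deriv γ t) ≠ 0) :
    HasDerivAt (fun τ => gauge η g (deriv γ τ))
      (lagrangian η g μ 1 (jet 2 γ t) - lagrangian η g μ 0 (jet 2 γ t)) t := by
  have hv : HasDerivAt (deriv γ) (iteratedDeriv 2 γ t) t := by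
    rw [← iteratedDeriv_one]
    exact hasDerivAt_iteratedDeriv hγ 1 t
  have hv' := hasDerivAt_pi.1 hv
  have hs : √(speedSq η g (deriv γ t)) ≠ 0 := (Real.sqrt_pos.2 hN).ne'
  have hs2 := Real.sq_sqrt hN.le
  have hz : HasDerivAt (fun τ => deriv γ τ 0 * deriv γ τ 1 / √(speedSq η g (deriv γ τ))) _ t :=
    ((hv' 0).mul (hv' 1)).div ((hasDerivAt_speedSq (η := η) (g := g) hv).sqrt hN.ne') hs
  have d0 := hd 0
  have d1 := hd 1
  have e0 := lagDenom_eq (η := η) hg 0 (deriv γ t)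
  have e1 := lagDenom_eq (η := η) hg 1 (deriv γ t)
  have hNe := speedSq_eq (η := η) (g := g) (deriv γ t)
  have hL : lagrangian η g μ 1 (jet 2 γ t) - lagrangian η g μ 0 (jet 2 γ t) =
      iteratedDeriv 2 γ t 0 * deriv γ t 1 /
          (√(speedSq η g (deriv γ t)) * lagDenom η g 1 (deriv γ t)) +
        iteratedDeriv 2 γ t 1 * deriv γ t 0 /
          (√(speedSq η g (deriv γ t)) * lagDenom η g 0 (deriv γ t)) := by
    have j1 : (jet 2 γ t).2 1 = deriv γ t := congrFun iteratedDeriv_one t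
    have j2 : (jet 2 γ t).2 2 = iteratedDeriv 2 γ t := rfl
    simp [lagrangian_eq, accCoeff, j1, j2]
    ring
  -- This identity matches the two denominators with the one from differentiating `arctan` or
  -- `artanh`, and shows that the latter is non-zero.
  have hdd : lagDenom η g 0 (deriv γ t) * lagDenom η g 1 (deriv γ t) = speedSq η g (deriv γ t) *
      (1 + g 0 * g 1 * (deriv γ t 0 * deriv γ t 1 / √(speedSq η g (deriv γ t))) ^ 2) := by
    rw [div_pow, hs2, mul_add, mul_one, mul_div_assoc', mul_div_cancel₀ _ hN.ne', e0, e1, hNe]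
    simp
    linear_combination (g 0 * g 1 * deriv γ t 0 ^ 2 * deriv γ t 1 ^ 2) * hη
  have hne : 1 + g 0 * g 1 * (deriv γ t 0 * deriv γ t 1 / √(speedSq η g (deriv γ t))) ^ 2 ≠ 0 :=
    right_ne_zero_of_mul (hdd ▸ mul_ne_zero d0 d1)
  have hgg : g 0 * g 1 = 1 ∨ g 0 * g 1 = -1 := sq_eq_one_iff.1 (by rw [mul_pow, hg, hg, one_mul])
  have key : ∀ z', HasDerivAt (fun τ => deriv γ τ 0 * deriv γ τ 1 / √(speedSq η g (deriv γ τ))) z' t →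
      z' / (1 + g 0 * g 1 * (deriv γ t 0 * deriv γ t 1 / √(speedSq η g (deriv γ t))) ^ 2) =
        lagrangian η g μ 1 (jet 2 γ t) - lagrangian η g μ 0 (jet 2 γ t) := by
    intro z' h
    rw [hL, h.unique hz, div_eq_iff hne]
    have hdd := (eq_div_of_mul_eq hN.ne' ((mul_comm _ _).trans hdd.symm))
    have hdot : dot g (deriv γ t) (iteratedDeriv 2 γ t) = g 0 * deriv γ t 0 * iteratedDeriv 2 γ t 0 +
      g 1 * deriv γ t 1 * iteratedDeriv 2 γ t 1 := by simp [dot, Fin.sum_univ_two]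
    have f0 : lagDenom η g 0 (deriv γ t) = speedSq η g (deriv γ t) - η * g 0 * deriv γ t 0 ^ 2 := by
      rw [e0, hNe]
      simp
      ring
    have f1 : lagDenom η g 1 (deriv γ t) = speedSq η g (deriv γ t) - η * g 1 * deriv γ t 1 ^ 2 := by
      rw [e1, hNe]
      simp
      ring
    rw [hdd, hdot]
    clear hz
    simp only [Pi.mul_apply]
    clear hL hdd hne h hv hv' hNe e0 e1
    generalize √(speedSq η g (deriv γ t)) = r at *
    generalize speedSq η g (deriv γ t) = N at *
    generalize lagDenom η g 0 (deriv γ t) = D0 at *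
    generalize lagDenom η g 1 (deriv γ t) = D1 at *
    subst hs2
    field_simp
    rw [f0, f1]
    ring
  rcases hgg with h1 | h1
  · simp only [gauge, h1, if_true]
    refine hz.arctan.congr_deriv ?_
    rw [← key _ hz, h1]
    ring
  · have h2 : ¬((-1 : ℝ) = 1) := by norm_num
    simp only [gauge, h1, h2, if_false]
    refine (hasDerivAt_half_log_ratio hz ?_).congr_deriv ?_
    · rw [h1] at hne
      convert hne using 1
      ring
    · rw [← key _ hz, h1]
      ring

end

/-! ### The converse: the standard expression has all three properties -/

section

variable {Ω : Set (Jet 1)} {E : Jet 3 → Fin 2 → ℝ} {η : ℝ} {g : Fin 2 → ℝ} {c μ : ℝ}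

theorem eulerPoisson_const_mul (k : ℕ) (c : ℝ) (L : Jet k → ℝ) (γ : ℝ → Fin 2 → ℝ) (i : Fin 2)
    (t : ℝ) : eulerPoisson k (fun p => c * L p) γ i t = c * eulerPoisson k L γ i t := by
  have h (p u : Jet k) : fderiv ℝ (fun p => c * L p) p u = c * fderiv ℝ L p u := by
    have : (fun p => c * L p) = c • L := rfl
    rw [this, fderiv_const_smul_field]
    rfl
  simp only [eulerPoisson, h, Finset.mul_sum, iteratedDeriv_const_mul_field]
  exact Finset.sum_congr rfl fun s _ => by ring

/-- `N` is the sum of the two denominators minus one, so it would be `-1` if both vanished. Hence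
one of the two Lagrange functions is regular at every contact element. -/
theorem exists_lagDenom_ne_zero (hg : ∀ i, g i ^ 2 = 1) {v : Fin 2 → ℝ}
    (hN : 0 < speedSq η g v) : ∃ j, lagDenom η g j v ≠ 0 := by
  by_contra! h
  have h0 := h 0
  have h1 := h 1
  rw [lagDenom_eq hg] at h0 h1
  rw [speedSq_eq] at hN
  simp at h0 h1
  linarith

theorem isVariational_of_eq (hΩ : IsOpen Ω) (hη : η ^ 2 = 1)
    (hg : ∀ i, g i ^ 2 = 1) (hN : ∀ p ∈ Ω, 0 < speedSq η g (p.2 1))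
    (h : ∀ q : Jet 3, toOne q ∈ Ω → E q = c • standardExpr η g μ q) : IsVariational Ω E := by
  intro γ hγ t ht
  obtain ⟨j, hj⟩ := exists_lagDenom_ne_zero hg (hN _ ht)
  obtain ⟨h1, h2, h3⟩ := isLagrangianOn_lagrangian hΩ hη hg hN μ j
  have hmem : jet 2 γ t ∈ {p : Jet 2 | toOne p ∈ Ω ∧ lagDenom η g j (p.2 1) ≠ 0} :=
    ⟨by rwa [toOne_jet], hj⟩
  refine ⟨2, fun p => c * lagrangian η g μ j p, _, hmem, h1, contDiffOn_const.mul h2,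
    fun γ hγ t ht ht' i => ?_⟩
  rw [eulerPoisson_const_mul, ← h3 γ hγ t ht ht' i, h _ (by rwa [toOne_jet])]
  rfl

/-- The standard expression at `v'' = 0`, multiplied by `N^{3/2}`. -/
def reducedFree (η : ℝ) (g : Fin 2 → ℝ) (μ : ℝ) (v w : Fin 2 → ℝ) (i : Fin 2) : ℝ :=
  3 * (η * dot g v w) / speedSq η g v * star w i +
    μ * (speedSq η g v * (g i * w i) - η * dot g w v * (g i * v i))

theorem standardExpr_eq {q : Jet 3} (hN : 0 < speedSq η g (q.2 1)) (i : Fin 2) :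
    standardExpr η g μ q i = 1 / (speedSq η g (q.2 1) * √(speedSq η g (q.2 1))) *
      (turn (q.2 3) i + reducedFree η g μ (q.2 1) (q.2 2) i) := by
  have hs : √(speedSq η g (q.2 1)) ≠ 0 := (Real.sqrt_pos.2 hN).ne'
  have ht : turn (q.2 3) i = -star (q.2 3) i := by fin_cases i <;> simp [star]
  have hN0 := hN.ne'
  rw [ht]
  simp only [standardExpr, rpow_three_halves hN, rpow_five_halves hN, Pi.add_apply, Pi.sub_apply,
    Pi.smul_apply, smul_eq_mul, lower, reducedFree]
  field_simp
  ring

theorem zeroSection_two_apply (r : Jet 2) : (zeroSection 2 r).2 1 = r.2 1 ∧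
    (zeroSection 2 r).2 2 = r.2 2 ∧ (zeroSection 2 r).2 3 = 0 :=
  ⟨zeroSection_castSucc 2 r 1, zeroSection_castSucc 2 r 2, zeroSection_last 2 r⟩

/-- Read off from the normal form by comparing `v'' = 0` with a unit `v''` at `v' = 0`. -/
theorem leadCoeff_of_eq (hΩ : IsOpen Ω) (hE : ContDiffOn ℝ ∞ E {q | toOne q ∈ Ω})
    (hv : IsVariational Ω E) (hN : ∀ p ∈ Ω, 0 < speedSq η g (p.2 1))
    (h : ∀ q : Jet 3, toOne q ∈ Ω → E q = c • standardExpr η g μ q) {p : Jet 1} (hp : p ∈ Ω) :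
    leadCoeff E p = c * (1 / (speedSq η g (p.2 1) * √(speedSq η g (p.2 1)))) := by
  have hq (w : Fin 2 → ℝ) : toOne ((p.1, ![p.2 0, p.2 1, 0, w]) : Jet 3) = p :=
    Prod.ext rfl (funext fun s => by fin_cases s <;> rfl)
  have e (w : Fin 2 → ℝ) := (congrFun (h _ (by rw [hq w]; exact hp)) 0).symm.trans
    (hv.eq_normal_form hΩ hE (q := (p.1, ![p.2 0, p.2 1, 0, w])) (by rw [hq w]; exact hp) 0)
  have e1 := e (Pi.single 1 1)
  have e0 := e 0
  rw [Pi.smul_apply, standardExpr_eq (hN p hp)] at e0 e1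
  rw [hq] at e0 e1
  simp at e0 e1
  rw [one_div, mul_inv]
  linarith

theorem isThirdOrder_of_eq (hΩ : IsOpen Ω) (hΩn : Ω.Nonempty)
    (hE : ContDiffOn ℝ ∞ E {q | toOne q ∈ Ω})
    (hv : IsVariational Ω E) (hN : ∀ p ∈ Ω, 0 < speedSq η g (p.2 1)) (hc : c ≠ 0)
    (h : ∀ q : Jet 3, toOne q ∈ Ω → E q = c • standardExpr η g μ q) : IsThirdOrder Ω E := by
  obtain ⟨p, hp⟩ := hΩn
  have hq : toOne (zeroLift (zeroSection 1 p)) = p := by rw [toOne_zeroLift, toOne_zeroSection]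
  refine ⟨zeroLift (zeroSection 1 p), by rwa [hq], 0, 1, ?_⟩
  rw [hv.leading_eq hΩ hE (by rwa [hq]), hq, leadCoeff_of_eq hΩ hE hv hN h hp]
  have h1 := (hN p hp).ne'
  have h2 : √(speedSq η g (p.2 1)) ≠ 0 := (Real.sqrt_pos.2 (hN p hp)).ne'
  simpa using ⟨hc, h2, h1⟩

theorem freeTerm_of_eq (hΩ : IsOpen Ω) (hE : ContDiffOn ℝ ∞ E {q | toOne q ∈ Ω})
    (hv : IsVariational Ω E) (hN : ∀ p ∈ Ω, 0 < speedSq η g (p.2 1))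
    (h : ∀ q : Jet 3, toOne q ∈ Ω → E q = c • standardExpr η g μ q) {r : Jet 2} (hr : toOne r ∈ Ω)
    (i : Fin 2) :
    freeTerm E i r = leadCoeff E (truncate 1 r) * reducedFree η g μ (r.2 1) (r.2 2) i := by
  obtain ⟨z1, z2, z3⟩ := zeroSection_two_apply r
  have hz : toOne (zeroSection 2 r) ∈ Ω := by rwa [← toOne_truncate, truncate_zeroSection]
  have hNr : 0 < speedSq η g ((zeroSection 2 r).2 1) := by rw [z1]; exact hN _ hr
  rw [freeTerm, h _ hz, Pi.smul_apply, standardExpr_eq hNr, z1, z2, z3, ← toOne_eq_truncate,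
    leadCoeff_of_eq hΩ hE hv hN h hr, map_zero, Pi.zero_apply, zero_add, smul_eq_mul, mul_assoc]
  rfl

theorem hasDerivAt_dot {x y : ℝ → Fin 2 → ℝ} {x' y' : Fin 2 → ℝ} {t : ℝ} (hx : HasDerivAt x x' t)
    (hy : HasDerivAt y y' t) :
    HasDerivAt (fun τ => dot g (x τ) (y τ)) (dot g x' (y t) + dot g (x t) y') t := by
  have hx' := hasDerivAt_pi.1 hx
  have hy' := hasDerivAt_pi.1 hy
  have h (x y : Fin 2 → ℝ) : dot g x y = g 0 * x 0 * y 0 + g 1 * x 1 * y 1 := by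
    simp [dot, Fin.sum_univ_two]
  simp only [h]
  refine ((((hx' 0).const_mul (g 0)).mul (hy' 0)).add
    (((hx' 1).const_mul (g 1)).mul (hy' 1))).congr_deriv ?_
  ring

/-- The infinitesimal equivariance of the standard expression. -/
theorem hasDerivAt_reducedFree (hη : η = 1 ∨ η = -1) (hg : ∀ i, g i = 1 ∨ g i = -1)
    {v w : ℝ → Fin 2 → ℝ} (π : Fin 2 → ℝ) (ρ : ℝ) (hN : speedSq η g (v 0) ≠ 0)
    (hv : HasDerivAt v (η • π + dot g π (v 0) • v 0 + rot g ρ (v 0)) 0)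
    (hw : HasDerivAt w (actionMatrix g π (v 0) ρ (w 0)) 0) (i : Fin 2) :
    HasDerivAt (fun s => reducedFree η g μ (v s) (w s) i)
      (dot g π (v 0) * reducedFree η g μ (v 0) (w 0) i +
        adjAction g π (v 0) ρ (reducedFree η g μ (v 0) (w 0)) i -
        3 * dot g π (w 0) * turn (w 0) i) 0 := by
  have hS := hasDerivAt_speedSq (η := η) (g := g) hv
  have hstar : HasDerivAt (fun s => star (w s) i) (star (actionMatrix g π (v 0) ρ (w 0)) i) 0 := by
    have h := hasDerivAt_pi.1 hw
    fin_cases i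
    · exact (h 1).neg
    · exact h 0
  have h1 := ((((hasDerivAt_dot (g := g) hv hw).const_mul η).const_mul 3).div hS hN).mul hstar
  have h2 := (((hS.mul ((hasDerivAt_pi.1 hw i).const_mul (g i))).sub
    (((hasDerivAt_dot (g := g) hw hv).const_mul η).mul
      ((hasDerivAt_pi.1 hv i).const_mul (g i)))).const_mul μ)
  refine (h1.add h2).congr_deriv ?_
  clear h1 h2 hstar hS hv hw
  simp only [Pi.div_apply]
  generalize v 0 = v at *
  generalize w 0 = w at *
  simp only [reducedFree, adjAction, actionMatrix, rot]
  obtain ⟨N, hN'⟩ : ∃ N, speedSq η g v = N := ⟨_, rfl⟩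
  have hNe := speedSq_eq (η := η) (g := g) v
  rw [hN'] at hNe hN ⊢
  fin_cases i
  · simp [dot, star, Fin.sum_univ_two]
    field_simp
    rw [hNe]
    -- The identity holds modulo the relations that `η`, `g 0`, `g 1` are signs, so it is checked
    -- for each choice.
    rcases hη with rfl | rfl <;> rcases hg 0 with h0 | h0 <;> rcases hg 1 with h1 | h1 <;>
      simp only [h0, h1] <;> ring
  · simp [dot, star, Fin.sum_univ_two]
    field_simp
    rw [hNe]
    rcases hη with rfl | rfl <;> rcases hg 0 with h0 | h0 <;> rcases hg 1 with h1 | h1 <;>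
      simp only [h0, h1] <;> ring

/-- Writing the free term as `A R` with `R` the `reducedFree` factor, the derivative of `A` cancels
from the reduced invariance equation, leaving the derivative of `R` computed in
`hasDerivAt_reducedFree`. -/
theorem isInvariant_of_eq (hΩ : IsOpen Ω) (hE : ContDiffOn ℝ ∞ E {q | toOne q ∈ Ω})
    (hv : IsVariational Ω E) (hη : η = 1 ∨ η = -1) (hg : ∀ i, g i = 1 ∨ g i = -1)
    (hN : ∀ p ∈ Ω, 0 < speedSq η g (p.2 1)) (hc : c ≠ 0)
    (h : ∀ q : Jet 3, toOne q ∈ Ω → E q = c • standardExpr η g μ q) : IsInvariant η g Ω E := by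
  rw [hv.isInvariant_iff hΩ hE]
  intro a₀ a π ρ p hp
  have hp' : truncate 1 p ∈ Ω := by rwa [← toOne_eq_truncate]
  have hNp : 0 < speedSq η g (p.2 1) := hN _ hp
  have hA : leadCoeff E (truncate 1 p) ≠ 0 := by
    rw [leadCoeff_of_eq hΩ hE hv hN h hp']
    have h2 := (hN _ hp').ne'
    have h3 : √(speedSq η g ((truncate 1 p).2 1)) ≠ 0 := (Real.sqrt_pos.2 (hN _ hp')).ne'
    simpa using ⟨hc, h3, h2⟩
  rw [hv.reducedInvariance_iff hΩ hE hp hA]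
  intro i
  set X := generator η g a₀ a π ρ p with hX
  have hline : HasDerivAt (fun s : ℝ => p + s • X) X 0 := by
    simpa using ((hasDerivAt_id (0 : ℝ)).smul_const X).const_add p
  have hz : p + (0 : ℝ) • X = p := by simp
  have hcomp (s : Fin 3) : HasDerivAt (fun σ : ℝ => (p + σ • X).2 s) (X.2 s) 0 :=
    ((ContinuousLinearMap.proj (R := ℝ) (φ := fun _ : Fin 3 => Fin 2 → ℝ) s).comp
      (ContinuousLinearMap.snd ℝ ℝ (Fin 3 → Fin 2 → ℝ))).hasFDerivAt.comp_hasDerivAt 0 hline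
  have h1 : HasDerivAt (fun s : ℝ => freeTerm E i (p + s • X)) (fderiv ℝ (freeTerm E i) p X) 0 :=
    ((contDiffAt_freeTerm hΩ hE i hp).differentiableAt (by simp)).hasFDerivAt.hasLineDerivAt X
  have h2 : HasDerivAt (fun s : ℝ => leadCoeff E (truncate 1 (p + s • X)))
      (fderiv ℝ (leadCoeff E) (truncate 1 p) (truncate 1 X)) 0 := by
    have := ((contDiffAt_leadCoeff hΩ hE hp').differentiableAt (by simp)).hasFDerivAt.comp p
      (truncate 1).hasFDerivAt
    exact this.hasLineDerivAt X
  have h3 := hasDerivAt_reducedFree (μ := μ) hη hg (v := fun s : ℝ => (p + s • X).2 1)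
    (w := fun s : ℝ => (p + s • X).2 2) π ρ (by simpa using hNp.ne')
    ((hcomp 1).congr_deriv (by simp only [zero_smul, add_zero]; rfl))
    ((hcomp 2).congr_deriv (by simp only [zero_smul, add_zero]; rfl)) i
  have hev : (fun s : ℝ => freeTerm E i (p + s • X)) =ᶠ[𝓝 0] fun s =>
      leadCoeff E (truncate 1 (p + s • X)) *
        reducedFree η g μ ((p + s • X).2 1) ((p + s • X).2 2) i := by
    have hcont : Tendsto (fun s : ℝ => p + s • X) (𝓝 0) (𝓝 p) := by
      simpa using hline.continuousAt.tendsto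
    filter_upwards [hcont.eventually (eventually_over hΩ hp)] with s hs
    exact freeTerm_of_eq hΩ hE hv hN h hs i
  rw [h1.unique ((h2.mul h3).congr_of_eventuallyEq hev)]
  simp only [freeTerm_of_eq hΩ hE hv hN h hp, hz]
  simp only [adjAction]
  fin_cases i
  · simp
    ring
  · simp
    ring

end

end MatsyukThird

end

open MatsyukThird in
theorem proposition3 (η : ℝ) (hη : η = 1 ∨ η = -1) (g : Fin 2 → ℝ) (hg : ∀ i, g i = 1 ∨ g i = -1)
    (Ω : Set (Jet 1)) (hΩo : IsOpen Ω) (hΩc : IsConnected Ω)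
    (hΩ : ∀ p ∈ Ω, 0 < speedSq η g (p.2 1)) :
    -- the classification
    (∀ E : Jet 3 → Fin 2 → ℝ, ContDiffOn ℝ ∞ E {q | toOne q ∈ Ω} →
      ((IsThirdOrder Ω E ∧ IsVariational Ω E ∧ IsInvariant η g Ω E) ↔
        ∃ c μ : ℝ, c ≠ 0 ∧ ∀ q : Jet 3, toOne q ∈ Ω → E q = c • standardExpr η g μ q)) ∧
    -- the two Lagrange functions
    (∀ (μ : ℝ) (j : Fin 2),
      IsLagrangianOn Ω 2 (lagrangian η g μ j) {p | toOne p ∈ Ω ∧ lagDenom η g j (p.2 1) ≠ 0}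
        (standardExpr η g μ)) ∧
    -- they differ by a total time derivative
    (∀ (μ : ℝ) (γ : ℝ → Fin 2 → ℝ), ContDiff ℝ ∞ γ → ∀ t : ℝ, jet 1 γ t ∈ Ω →
      (∀ j, lagDenom η g j (deriv γ t) ≠ 0) →
        HasDerivAt (fun τ => gauge η g (deriv γ τ))
          (lagrangian η g μ 1 (jet 2 γ t) - lagrangian η g μ 0 (jet 2 γ t)) t) := by
  have hη' : η ^ 2 = 1 := sq_eq_one_of_sign hη
  have hg' : ∀ i, g i ^ 2 = 1 := fun i => sq_eq_one_of_sign (hg i)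
  refine ⟨fun E hE => ⟨fun ⟨h3, hv, hi⟩ => ?_, fun ⟨c, μ, hc, h⟩ => ?_⟩, fun μ j => ?_,
    fun μ γ hγ t ht hd => ?_⟩
  · exact hi.exists_eq_standardExpr hΩo hΩc hE h3 hv hη' hg' hΩ
  · have hv := isVariational_of_eq hΩo hη' hg' hΩ h
    exact ⟨isThirdOrder_of_eq hΩo hΩc.nonempty hE hv hΩ hc h, hv,
      isInvariant_of_eq hΩo hE hv hη hg hΩ hc h⟩
  · exact isLagrangianOn_lagrangian hΩo hη' hg' hΩ μ j
  · refine hasDerivAt_gauge hg' hη' μ hγ ?_ hd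
    have := hΩ _ ht
    rwa [show (jet 1 γ t).2 1 = deriv γ t from congrFun iteratedDeriv_one t] at this
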